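/- Let $H=\bigoplus_{(k,p)\in\mathbb Z\times\mathbb Z_2}H_{k,p}$ be a real graded vector space of arbitrary dimension ($k$ is the ghost degree and $p$ the Grassmann parity, which governs all signs; without fermions $p=k\bmod 2$). Let $(l_n)_{n\ge1}$ be an $L_\infty$-algebra structure on $H$: graded symmetric multilinear maps $l_n:H^{\times n}\to H$ of ghost degree $1$ and odd parity that satisfy the generalized Jacobi identities. Put $D=l_1$. The functions on the formal pointed graded manifold $M_H$ are the formal series $f=\sum_n\frac1{n!}\psi^{A_1}\cdots\psi^{A_n}f_n(e_{A_1},\dots,e_{A_n})$, where each $f_n$ is a graded symmetric $n$-linear form on $H$ and $\psi^A$ are the coordinates dual to a homogeneous basis $e_A$; they carry the graded commutative product of series and the topology of pointwise convergence of all Taylor coefficients $f_n$. The homological vector field $Q$ on $M_H$ is the derivation determined by $Q\Psi=\sum_{n\ge1}\frac1{n!}l_n(\Psi,\dots,\Psi)$, $\Psi=\psi^Ae_A$. A morphism $M_H\to M_K$ is given by a continuous degree-preserving unital algebra homomorphism from functions on $M_K$ to functions on $M_H$ that preserves the value at the base point; it is a $Q$-map if it intertwines the vector fields $Q$. An $L_\infty$-morphism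 is a $Q$-map of the associated formal manifolds; it is a quasi-isomorphism if its linear part induces an isomorphism of the cohomologies of the first structure maps. A minimal model of $(H,l_n)$ is an $L_\infty$-algebra $(H',l'_n)$ with $l'_1=0$ and an $L_\infty$-quasi-isomorphism from $(H',l'_n)$ to $(H,l_n)$. A formal pointed $Q$-manifold $(N,Q_N)$ is an equivalent reduction of $(M_H,Q)$, with section $i:N\to M_H$, if $i$ is a $Q$-map and there are a $Q$-map $\pi:M_H\to N$ with $\pi\circ i=\mathrm{id}$, a graded vector space $V$, and an isomorphism of $Q$-manifolds $M_H\cong N\times (T[1]V,d_V)$ that carries $\pi$ to the projection onto $N$. Then there are graded subspaces $E,F\subset H$ with $H=E\oplus F\oplus\operatorname{Im}D$ and $E\oplus\operatorname{Im}D=\operatorname{Ker}D$. For every such pair $(E,F)$, the map $E\to H_D(H)=\operatorname{Ker}D/\operatorname{Im}D$, $x\mapsto[x]$, is a linear isomorphism, and there are an $L_\infty$-algebra structure $(l'_n)$ on $E$, with associated formal $Q$-manifold $(N,Q_N)=(M_E,Q_N)$, and a $Q$-map $i:N\to M_H$ such that 1. $(N,Q_N)$ is an equivalent reduction of $(M_H,Q)$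 with section $i$; 2. $(E,l'_n)$ is a minimal model of $(H,l_n)$; moreover the linear part of $i$ is the inclusion $E\subset H$, and it is a quasi-isomorphism $(E,l'_1)\to(H,D)$; 3. $N$ is the submanifold of $M_H$ cut out by $W$ and $QW$ (so that $Q_N=Q|_N$), where $W$ is the space of linear functions on $M_H$ given by the linear functionals on $H$ that vanish on $E\oplus F$: the restriction $i^*$ of functions is surjective and its kernel is the closed ideal generated by $W\cup QW$. If $H$ is finite-dimensional, the kernel is the ideal generated by $W\cup QW$, without closure. -/

import Mathlib

universe u

namespace QMan

/-- A real graded (super) vector space `H = ⨁ H_(k,p)`. The first label is the ghost degree, the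
second one the Grassmann parity, which governs all signs. In the absence of fermions the only
nonzero pieces are those with `p = k mod 2`. -/
structure GrSpace : Type (u + 1) where
  carrier : Type u
  [addCommGroup : AddCommGroup carrier]
  [module : Module ℝ carrier]
  gr : ℤ × ZMod 2 → Submodule ℝ carrier
  internal : DirectSum.IsInternal gr

namespace GrSpace

instance : CoeSort GrSpace.{u} (Type u) := ⟨GrSpace.carrier⟩

attribute [instance] GrSpace.addCommGroup GrSpace.module

theorem bijective_coe (H : GrSpace.{u}) : Function.Bijective (DirectSum.coeLinearMap H.gr) :=
  H.internal

/-- The linear projection onto the even (`ε = 0`) or odd (`ε = 1`) part. -/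
noncomputable def parityProj (H : GrSpace.{u}) (ε : ZMod 2) : H →ₗ[ℝ] H :=
  (DirectSum.toModule ℝ (ℤ × ZMod 2) H
      (fun d => if d.2 = ε then (H.gr d).subtype else 0)).comp
    (LinearEquiv.ofBijective (DirectSum.coeLinearMap H.gr) H.bijective_coe).symm.toLinearMap

theorem parityProj_of_mem (H : GrSpace.{u}) (ε : ZMod 2) {d : ℤ × ZMod 2} {x : H}
    (hx : x ∈ H.gr d) : H.parityProj ε x = if d.2 = ε then x else 0 := by
  have h : (LinearEquiv.ofBijective (DirectSum.coeLinearMap H.gr) H.bijective_coe).symm x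
      = DirectSum.lof ℝ (ℤ × ZMod 2) (fun d => H.gr d) d ⟨x, hx⟩ := by
    rw [LinearEquiv.symm_apply_eq]
    simp [LinearEquiv.ofBijective_apply]
  simp only [parityProj, LinearMap.comp_apply, LinearEquiv.coe_coe]
  rw [h, DirectSum.toModule_lof]
  split_ifs <;> simp

/-- A graded subspace: a subspace that is the sum of its homogeneous parts. -/
def IsGraded (H : GrSpace.{u}) (E : Submodule ℝ H) : Prop :=
  E = ⨆ d, E ⊓ H.gr d

theorem iSupIndep_gr (H : GrSpace.{u}) : iSupIndep H.gr :=
  (DirectSum.isInternal_submodule_iff_iSupIndep_and_iSup_eq_top _).1 H.internal |>.1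

theorem iSup_gr (H : GrSpace.{u}) : ⨆ d, H.gr d = ⊤ :=
  (DirectSum.isInternal_submodule_iff_iSupIndep_and_iSup_eq_top _).1 H.internal |>.2

/-- A graded subspace as a graded space. -/
abbrev sub (H : GrSpace.{u}) (E : Submodule ℝ H) (hE : H.IsGraded E) : GrSpace.{u} where
  carrier := E
  gr d := (H.gr d).comap E.subtype
  internal := by
    rw [DirectSum.isInternal_submodule_iff_iSupIndep_and_iSup_eq_top]
    constructor
    · rw [iSupIndep_def]
      intro d
      rw [Submodule.disjoint_def]
      intro x hx hx'
      have h1 : E.subtype x ∈ ⨆ (j) (_ : j ≠ d), H.gr j := by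
        have h2 := Submodule.mem_map_of_mem (f := E.subtype) hx'
        simp only [Submodule.map_iSup] at h2
        refine SetLike.le_def.1 (iSup₂_mono fun j _ => ?_) h2
        exact Submodule.map_comap_le _ _
      have h3 := (Submodule.disjoint_def.1 ((iSupIndep_def.1 H.iSupIndep_gr) d)) _ hx h1
      exact Subtype.ext h3
    · apply Submodule.map_injective_of_injective E.injective_subtype
      rw [Submodule.map_iSup, Submodule.map_top, Submodule.range_subtype]
      simp only [Submodule.map_comap_subtype]
      exact hE.symm

/-- The direct sum of two graded spaces. -/
abbrev prod (H K : GrSpace.{u}) : GrSpace.{u} where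
  carrier := H × K
  gr d := (H.gr d).prod (K.gr d)
  internal := by
    rw [DirectSum.isInternal_submodule_iff_iSupIndep_and_iSup_eq_top]
    constructor
    · rw [iSupIndep_def]
      intro d
      rw [Submodule.disjoint_def]
      rintro x ⟨hx1, hx2⟩ hx'
      have h1 : x.1 ∈ ⨆ (j) (_ : j ≠ d), H.gr j := by
        have h2 := Submodule.mem_map_of_mem (f := LinearMap.fst ℝ H K) hx'
        simp only [Submodule.map_iSup] at h2
        refine SetLike.le_def.1 (iSup₂_mono fun j _ => ?_) h2
        rw [Submodule.map_le_iff_le_comap]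
        exact fun y hy => hy.1
      have h1' : x.2 ∈ ⨆ (j) (_ : j ≠ d), K.gr j := by
        have h2 := Submodule.mem_map_of_mem (f := LinearMap.snd ℝ H K) hx'
        simp only [Submodule.map_iSup] at h2
        refine SetLike.le_def.1 (iSup₂_mono fun j _ => ?_) h2
        rw [Submodule.map_le_iff_le_comap]
        exact fun y hy => hy.2
      exact Prod.ext
        ((Submodule.disjoint_def.1 ((iSupIndep_def.1 H.iSupIndep_gr) d)) _ hx1 h1)
        ((Submodule.disjoint_def.1 ((iSupIndep_def.1 K.iSupIndep_gr) d)) _ hx2 h1')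
    · rw [eq_top_iff]
      have hl : Submodule.map (LinearMap.inl ℝ H K) ⊤ ≤ ⨆ d, (H.gr d).prod (K.gr d) := by
        rw [← H.iSup_gr, Submodule.map_iSup]
        refine iSup_mono fun d => ?_
        rw [Submodule.map_le_iff_le_comap]
        exact fun y hy => ⟨hy, (K.gr d).zero_mem⟩
      have hr : Submodule.map (LinearMap.inr ℝ H K) ⊤ ≤ ⨆ d, (H.gr d).prod (K.gr d) := by
        rw [← K.iSup_gr, Submodule.map_iSup]
        refine iSup_mono fun d => ?_
        rw [Submodule.map_le_iff_le_comap]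
        exact fun y hy => ⟨(H.gr d).zero_mem, hy⟩
      rintro ⟨a, b⟩ -
      have : ((a, b) : H × K) = LinearMap.inl ℝ H K a + LinearMap.inr ℝ H K b := by simp
      rw [this]
      exact add_mem (hl (Submodule.mem_map_of_mem trivial))
        (hr (Submodule.mem_map_of_mem trivial))

/-- The shifted space `V[1]`, with `(V[1])_d = V_{d+1}` (the parity is flipped as well). -/
abbrev shift (V : GrSpace.{u}) : GrSpace.{u} where
  carrier := V
  gr d := V.gr (d + (1, 1))
  internal := by
    rw [DirectSum.isInternal_submodule_iff_iSupIndep_and_iSup_eq_top]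
    refine ⟨V.iSupIndep_gr.comp (add_left_injective _), ?_⟩
    rw [← V.iSup_gr]
    exact (Equiv.addRight ((1, 1) : ℤ × ZMod 2)).iSup_comp (g := V.gr)

end GrSpace

/-! ### Koszul signs and graded symmetrization -/

/-- The Koszul sign `ε(σ; p)` with `x_{σ 1} ⋯ x_{σ n} = ε(σ; p) x_1 ⋯ x_n` in a graded commutative
algebra, the parity of `x_i` being `p i`: a factor `-1` for each inverted pair of odd elements. -/
def koszul {n : ℕ} (σ : Equiv.Perm (Fin n)) (p : Fin n → ZMod 2) : ℝ :=
  ∏ ij : Fin n × Fin n,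
    if ij.1 < ij.2 ∧ σ ij.2 < σ ij.1 ∧ p (σ ij.1) = 1 ∧ p (σ ij.2) = 1 then -1 else 1

theorem koszul_mul {n : ℕ} (τ σ : Equiv.Perm (Fin n)) (p : Fin n → ZMod 2) :
    koszul (τ * σ) p = koszul τ p * koszul σ (p ∘ τ) := by
  have key : koszul τ p = ∏ ij : Fin n × Fin n,
      if ij.1 < ij.2 ∧ ((σ ij.1 < σ ij.2 ∧ τ (σ ij.2) < τ (σ ij.1)) ∨
        (σ ij.2 < σ ij.1 ∧ τ (σ ij.1) < τ (σ ij.2))) ∧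
        p (τ (σ ij.1)) = 1 ∧ p (τ (σ ij.2)) = 1 then (-1 : ℝ) else 1 := by
    unfold koszul
    rw [← Finset.prod_filter, ← Finset.prod_filter]
    symm
    refine Finset.prod_bij'
      (fun ij _ => if σ ij.1 < σ ij.2 then (σ ij.1, σ ij.2) else (σ ij.2, σ ij.1))
      (fun ij _ => if σ.symm ij.1 < σ.symm ij.2 then (σ.symm ij.1, σ.symm ij.2)
        else (σ.symm ij.2, σ.symm ij.1)) ?_ ?_ ?_ ?_ ?_
    · rintro ⟨i, j⟩ h
      simp only [Finset.mem_filter, Finset.mem_univ, true_and] at h ⊢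
      split_ifs with h1 <;> grind
    · rintro ⟨i, j⟩ h
      simp only [Finset.mem_filter, Finset.mem_univ, true_and] at h ⊢
      have hne : σ.symm i ≠ σ.symm j := fun e => by
        have := σ.symm.injective e
        grind
      split_ifs with h1 <;> simp only [Equiv.apply_symm_apply] <;> grind
    · rintro ⟨i, j⟩ h
      simp only [Finset.mem_filter, Finset.mem_univ, true_and] at h ⊢
      split_ifs with h1 h2 h2 <;> simp only [Equiv.symm_apply_apply] at * <;> grind
    · rintro ⟨i, j⟩ h
      simp only [Finset.mem_filter, Finset.mem_univ, true_and] at h ⊢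
      split_ifs with h1 h2 h2 <;> simp only [Equiv.apply_symm_apply] at * <;> grind
    · intros; rfl
  rw [key]
  unfold koszul
  rw [← Finset.prod_mul_distrib]
  refine Finset.prod_congr rfl ?_
  rintro ⟨i, j⟩ -
  simp only [Equiv.Perm.mul_apply, Function.comp_apply]
  by_cases hij : i < j
  · have h1 : σ i ≠ σ j := fun e => hij.ne (σ.injective e)
    have h2 : τ (σ i) ≠ τ (σ j) := fun e => h1 (τ.injective e)
    by_cases hp : p (τ (σ i)) = 1 <;> by_cases hq : p (τ (σ j)) = 1 <;>
    rcases lt_or_gt_of_ne h1 with h1' | h1' <;> rcases lt_or_gt_of_ne h2 with h2' | h2' <;>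
    simp [hij, hp, hq, h1', h2', h1'.not_gt, h2'.not_gt]
  · simp [hij]

/-- The tuple `x` consists of homogeneous elements of degrees `d`. -/
def HomTuple (H : GrSpace.{u}) {n : ℕ} (d : Fin n → ℤ × ZMod 2) (x : Fin n → H) : Prop :=
  ∀ i, x i ∈ H.gr (d i)

/-- The multilinear map whose value at homogeneous `x_1, …, x_n` is
`∑_σ ε(σ; x) t(x_{σ 1}, …, x_{σ n})`. -/
noncomputable def symmetrize {H : GrSpace.{u}} {n : ℕ}
    (t : MultilinearMap ℝ (fun _ : Fin n => H) ℝ) : MultilinearMap ℝ (fun _ : Fin n => H) ℝ :=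
  ∑ σ : Equiv.Perm (Fin n), ∑ p : Fin n → ZMod 2,
    koszul σ p • (t.domDomCongr σ).compLinearMap (fun i => H.parityProj (p i))

theorem symmetrize_apply {H : GrSpace.{u}} {n : ℕ}
    (t : MultilinearMap ℝ (fun _ : Fin n => H) ℝ) {d : Fin n → ℤ × ZMod 2} {x : Fin n → H}
    (hx : HomTuple H d x) :
    symmetrize t x
      = ∑ σ : Equiv.Perm (Fin n), koszul σ (fun i => (d i).2) * t (fun i => x (σ i)) := by
  simp only [symmetrize, sum_apply]
  refine Finset.sum_congr rfl fun σ _ => ?_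
  rw [Finset.sum_eq_single (fun i => (d i).2)]
  · simp [H.parityProj_of_mem _ (hx _)]
  · intro p _ hp
    obtain ⟨i, hi⟩ : ∃ i, p i ≠ (d i).2 := by
      by_contra! h
      exact hp (funext h)
    simp only [smul_apply, MultilinearMap.compLinearMap_apply,
      MultilinearMap.domDomCongr_apply]
    rw [MultilinearMap.map_coord_zero t (σ.symm i), smul_zero]
    simp [H.parityProj_of_mem _ (hx _), hi.symm]
  · simp

/-- Graded symmetry of a multilinear map. -/
def IsGradedSymm (H : GrSpace.{u}) {M : Type*} [AddCommGroup M] [Module ℝ M] {n : ℕ}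
    (t : MultilinearMap ℝ (fun _ : Fin n => H) M) : Prop :=
  ∀ (d : Fin n → ℤ × ZMod 2) (x : Fin n → H), HomTuple H d x → ∀ σ : Equiv.Perm (Fin n),
    t (fun i => x (σ i)) = koszul σ (fun i => (d i).2) • t x

theorem koszul_mul_self {n : ℕ} (σ : Equiv.Perm (Fin n)) (p : Fin n → ZMod 2) :
    koszul σ p * koszul σ p = 1 := by
  unfold koszul
  rw [← Finset.prod_mul_distrib]
  refine Finset.prod_eq_one fun ij _ => ?_
  split_ifs <;> norm_num

theorem isGradedSymm_symmetrize {H : GrSpace.{u}} {n : ℕ}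
    (t : MultilinearMap ℝ (fun _ : Fin n => H) ℝ) : IsGradedSymm H (symmetrize t) := by
  intro d x hx τ
  rw [symmetrize_apply t hx,
    symmetrize_apply t (d := fun i => d (τ i)) (x := fun i => x (τ i)) (fun i => hx (τ i)),
    smul_eq_mul, Finset.mul_sum]
  rw [← Equiv.sum_comp (Equiv.mulLeft τ)
    (fun σ => koszul τ (fun i => (d i).2) *
      (koszul σ (fun i => (d i).2) * t (fun i => x (σ i))))]
  refine Finset.sum_congr rfl fun σ _ => ?_
  simp only [Equiv.coe_mulLeft, Equiv.Perm.mul_apply]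
  rw [koszul_mul, ← mul_assoc, ← mul_assoc, koszul_mul_self, one_mul]
  rfl

/-- The identification `{1,…,k} ⊔ {1,…,n-k} = {1,…,n}` (first block, second block). -/
def split {n : ℕ} (k : Fin (n + 1)) : Fin (k : ℕ) ⊕ Fin (n - k) ≃ Fin n :=
  finSumFinEquiv.trans (finCongr (by omega))

/-! ### Functions on the formal pointed graded manifold of a graded space -/

/-- Sequences `(f_n)` of graded symmetric multilinear forms on `H`. -/
def formalFun (H : GrSpace.{u}) :
    Submodule ℝ (∀ n : ℕ, MultilinearMap ℝ (fun _ : Fin n => H) ℝ) where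
  carrier := {f | ∀ n, IsGradedSymm H (f n)}
  add_mem' := fun hf hg n d x hx σ => by
    simp [hf n d x hx σ, hg n d x hx σ, mul_add]
  zero_mem' := fun n d x hx σ => by simp
  smul_mem' := fun c f hf n d x hx σ => by
    simp [hf n d x hx σ, mul_left_comm]

/-- The algebra of functions on the formal pointed graded manifold `M_H`: the completed graded
symmetric algebra of the dual of `H`. The sequence `(f_n)` stands for the formal series
`∑_n (1/n!) ψ^{A_1} ⋯ ψ^{A_n} f_n(e_{A_1}, …, e_{A_n})` in the coordinates `ψ^A` dual to a
homogeneous basis `e_A` of `H`. -/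
abbrev FormalFun (H : GrSpace.{u}) : Type u := formalFun H

namespace FormalFun

variable {H : GrSpace.{u}}

/-- Convergence of formal series: pointwise convergence of all Taylor coefficients. -/
instance : TopologicalSpace (FormalFun H) :=
  TopologicalSpace.induced
    (fun (f : FormalFun H) (a : Σ n : ℕ, (Fin n → H)) => f.1 a.1 a.2) inferInstance

/-- The constant function `1`. -/
noncomputable instance : One (FormalFun H) :=
  ⟨⟨fun n => if n = 0 then
      MultilinearMap.mkPiAlgebra ℝ (Fin n) ℝ |>.compLinearMap (fun _ => (0 : H →ₗ[ℝ] ℝ)) else 0, by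
    rintro (_ | n) d x hx σ
    · simp [koszul]
    · simp⟩⟩

/-- The product of formal series: for homogeneous `x_1, …, x_n`,
`(f g)_n(x) = ∑_k 1/(k!(n-k)!) ∑_σ ε(σ; x) f_k(x_{σ 1}, …, x_{σ k}) g_{n-k}(x_{σ(k+1)}, …)`. -/
noncomputable instance : Mul (FormalFun H) :=
  ⟨fun f g => ⟨fun n => ∑ k : Fin (n + 1), ((Nat.factorial k : ℝ) * (Nat.factorial (n - k) : ℝ))⁻¹ •
      symmetrize (((LinearMap.mul' ℝ ℝ).compMultilinearMap
        ((f.1 k).domCoprod (g.1 (n - k)))).domDomCongr (split k)), by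
    intro n d x hx σ
    simp only [sum_apply, smul_apply, Finset.smul_sum]
    refine Finset.sum_congr rfl fun k _ => ?_
    rw [isGradedSymm_symmetrize _ d x hx σ, smul_comm]⟩⟩

/-- The value at the base point (constant term). -/
def const (f : FormalFun H) : ℝ := f.1 0 Fin.elim0

/-- `f` is homogeneous of degree `d`, where the coordinate dual to a vector of degree `e`
has degree `-e`. -/
def IsHomogeneous (f : FormalFun H) (d : ℤ × ZMod 2) : Prop :=
  ∀ (n : ℕ) (e : Fin n → ℤ × ZMod 2) (x : Fin n → H), HomTuple H e x → f.1 n x ≠ 0 →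
    d = -∑ i, e i

/-- `f` is a linear function, i.e. given by a linear functional on `H`. -/
def IsLinear (f : FormalFun H) : Prop := ∀ n, n ≠ 1 → f.1 n = 0

/-- Ideals of the algebra of functions. -/
def IsIdeal (J : Submodule ℝ (FormalFun H)) : Prop :=
  ∀ f : FormalFun H, ∀ g ∈ J, f * g ∈ J ∧ g * f ∈ J

/-- The ideal generated by a set of functions. -/
def idealGen (S : Set (FormalFun H)) : Submodule ℝ (FormalFun H) :=
  sInf {J | IsIdeal J ∧ S ⊆ J}

/-- The closed ideal generated by a set of functions. -/
def closedIdealGen (S : Set (FormalFun H)) : Submodule ℝ (FormalFun H) :=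
  sInf {J | IsIdeal J ∧ IsClosed (J : Set (FormalFun H)) ∧ S ⊆ J}

end FormalFun

/-- A morphism `M_H → M_K` of formal pointed graded manifolds, given by its pullback of
functions. -/
structure FormalMap (H K : GrSpace.{u}) where
  pullback : FormalFun K →ₗ[ℝ] FormalFun H
  map_one : pullback 1 = 1
  map_mul : ∀ f g, pullback (f * g) = pullback f * pullback g
  continuous : Continuous pullback
  degree : ∀ f d, FormalFun.IsHomogeneous f d → FormalFun.IsHomogeneous (pullback f) d
  basePoint : ∀ f, (pullback f).const = f.const

/-- The linear map `χ` is the differential at the base point (the first Taylor coefficient) of the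
map `φ : M_H → M_K`. -/
def FormalMap.HasLinearPart {H K : GrSpace.{u}} (φ : FormalMap H K) (χ : H →ₗ[ℝ] K) : Prop :=
  ∀ (f : FormalFun K) (x : H), (φ.pullback f).1 1 (fun _ => x) = f.1 1 (fun _ => χ x)

/-! ### `L_∞`-algebras and their formal pointed `Q`-manifolds -/

/-- `L_∞`-algebra structures on `H`, in the convention where all maps are graded symmetric of
degree `1`. The generalized Jacobi identities are written as sums over all permutations; because of
the graded symmetry, the factor `1/(k!(n-k)!)` turns them into sums over unshuffles. -/
structure LInfty (H : GrSpace.{u}) where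
  l : ∀ n : ℕ, MultilinearMap ℝ (fun _ : Fin n => H) H
  l_zero : l 0 = 0
  degree : ∀ (n : ℕ) (d : Fin n → ℤ × ZMod 2) (x : Fin n → H), HomTuple H d x →
    l n x ∈ H.gr (∑ i, d i + (1, 1))
  symm : ∀ n, IsGradedSymm H (l n)
  jacobi : ∀ (n : ℕ) (d : Fin n → ℤ × ZMod 2) (x : Fin n → H), HomTuple H d x →
    ∑ k : Fin (n + 1), ((Nat.factorial k : ℝ) * (Nat.factorial (n - k) : ℝ))⁻¹ •
      ∑ σ : Equiv.Perm (Fin n), koszul σ (fun i => (d i).2) •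
        l (n - k + 1) (Fin.cons (l k (fun i => x (σ (split k (Sum.inl i)))))
          (fun j => x (σ (split k (Sum.inr j))))) = 0

namespace LInfty

variable {H K : GrSpace.{u}}

/-- The differential `D = l_1`. -/
def D (L : LInfty H) : H →ₗ[ℝ] H :=
  (MultilinearMap.ofSubsingleton ℝ (H : Type u) (H : Type u) (0 : Fin 1)).symm (L.l 1)

/-- The homological vector field of `M_H`, acting on functions. It is the derivation with
`Q Ψ = ∑_k (1/k!) l_k(Ψ, …, Ψ)`; for homogeneous `x_1, …, x_n`,
`(Q f)_n(x) = ∑_k 1/(k!(n-k)!) ∑_σ ε(σ; x) f_{n-k+1}(l_k(x_{σ 1}, …, x_{σ k}), x_{σ(k+1)}, …)`. -/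
noncomputable def Q (L : LInfty H) (f : FormalFun H) : FormalFun H :=
  ⟨fun n => ∑ k : Fin (n + 1), ((Nat.factorial k : ℝ) * (Nat.factorial (n - k) : ℝ))⁻¹ •
      symmetrize ((MultilinearMap.uncurrySum (R := ℝ) (N := fun _ => (H : Type u))
        ((f.1 (n - k + 1)).curryLeft.compMultilinearMap (L.l k))).domDomCongr (split k)), by
    intro n d x hx σ
    simp only [sum_apply, smul_apply, Finset.smul_sum]
    refine Finset.sum_congr rfl fun k _ => ?_
    rw [isGradedSymm_symmetrize _ d x hx σ, smul_comm]⟩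

/-- `φ : M_H → M_K` is a `Q`-map; equivalently, its Taylor coefficients form an
`L_∞`-morphism. -/
def IsQMap (L : LInfty H) (L' : LInfty K) (φ : FormalMap H K) : Prop :=
  ∀ f, φ.pullback (L'.Q f) = L.Q (φ.pullback f)

/-- The linear map `χ : K → H` induces an isomorphism `H_{D'}(K) ≅ H_D(H)` of cohomology. -/
structure IsQuasiIso (L' : LInfty K) (L : LInfty H) (χ : K →ₗ[ℝ] H) : Prop where
  comm : ∀ x, χ (L'.D x) = L.D (χ x)
  injective : ∀ x, L'.D x = 0 → χ x ∈ LinearMap.range L.D → x ∈ LinearMap.range L'.D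
  surjective : ∀ y, L.D y = 0 → ∃ x, L'.D x = 0 ∧ y - χ x ∈ LinearMap.range L.D

/-- The cohomology `Ker D / Im D`. -/
abbrev Cohomology (L : LInfty H) : Type u :=
  LinearMap.ker L.D ⧸ (LinearMap.range L.D).submoduleOf (LinearMap.ker L.D)

/-- `(K, L')` is a minimal model of `(H, L)`: `l'_1 = 0` and there is an `L_∞`-quasi-isomorphism
from `(K, L')` to `(H, L)`. -/
def IsMinimalModel (L' : LInfty K) (L : LInfty H) : Prop :=
  L'.l 1 = 0 ∧ ∃ (m : FormalMap K H) (χ : K →ₗ[ℝ] H),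
    IsQMap L' L m ∧ m.HasLinearPart χ ∧ IsQuasiIso L' L χ

/-! ### Contractible `Q`-manifolds, products, equivalent reductions -/

/-- The `L_∞`-algebra given by a complex: `l_1` is the differential, all other maps vanish. -/
def ofDifferential (δ : H →ₗ[ℝ] H) (hdeg : ∀ d, ∀ x ∈ H.gr d, δ x ∈ H.gr (d + (1, 1)))
    (hsq : ∀ x, δ (δ x) = 0) : LInfty H where
  l n := match n with
    | 1 => MultilinearMap.ofSubsingleton ℝ (H : Type u) (H : Type u) (0 : Fin 1) δ
    | _ => 0
  l_zero := rfl
  degree := by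
    rintro (_ | _ | n) d x hx
    · exact Submodule.zero_mem _
    · simpa using hdeg _ _ (hx 0)
    · exact Submodule.zero_mem _
  symm := by
    rintro (_ | _ | n) d x hx σ
    · simp
    · have h1 : koszul σ (fun i => (d i).2) = 1 := by
        refine Finset.prod_eq_one fun ij _ => ?_
        rw [if_neg]
        omega
      have h2 : ∀ i, σ i = i := fun i => by omega
      simp only [h1, one_smul, h2]
    · simp
  jacobi := by
    rintro (_ | _ | n) d x hx
    · simp
    · simp [Fin.sum_univ_two, hsq]
    · refine Finset.sum_eq_zero fun k _ => ?_
      rw [Finset.sum_eq_zero, smul_zero]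
      intro σ _
      obtain ⟨k, hk⟩ := k
      rcases k with _ | _ | k
      · simp
      · exact smul_zero _
      · rw [MultilinearMap.map_coord_zero _ 0, smul_zero]
        simp

/-- The product of formal pointed `Q`-manifolds, as an `L_∞`-structure on the direct sum. -/
def prod (L : LInfty H) (L' : LInfty K) : LInfty (H.prod K) where
  l n := MultilinearMap.prod
    ((L.l n).compLinearMap (fun _ => LinearMap.fst ℝ H K))
    ((L'.l n).compLinearMap (fun _ => LinearMap.snd ℝ H K))
  l_zero := by
    rw [L.l_zero, L'.l_zero]
    rfl
  degree := fun n d x hx =>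
    ⟨L.degree n d (fun i => (x i).1) (fun i => (hx i).1),
      L'.degree n d (fun i => (x i).2) (fun i => (hx i).2)⟩
  symm := fun n d x hx σ => Prod.ext
    (L.symm n d (fun i => (x i).1) (fun i => (hx i).1) σ)
    (L'.symm n d (fun i => (x i).2) (fun i => (hx i).2) σ)
  jacobi := fun n d x hx => by
    have h1 := L.jacobi n d (fun i => (x i).1) (fun i => (hx i).1)
    have h2 := L'.jacobi n d (fun i => (x i).2) (fun i => (hx i).2)
    refine Prod.ext ?_ ?_
    · rw [Prod.fst_sum]
      simp only [Prod.smul_fst, Prod.fst_sum]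
      refine Eq.trans ?_ h1
      refine Finset.sum_congr rfl fun k _ => congrArg _ (Finset.sum_congr rfl fun σ _ =>
        congrArg _ (congrArg (L.l (n - k + 1)) (funext fun j => ?_)))
      refine Fin.cases ?_ (fun j => ?_) j <;> rfl
    · rw [Prod.snd_sum]
      simp only [Prod.smul_snd, Prod.snd_sum]
      refine Eq.trans ?_ h2
      refine Finset.sum_congr rfl fun k _ => congrArg _ (Finset.sum_congr rfl fun σ _ =>
        congrArg _ (congrArg (L'.l (n - k + 1)) (funext fun j => ?_)))
      refine Fin.cases ?_ (fun j => ?_) j <;> rfl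

/-- The contractible `Q`-manifold `(T[1]V, d_V)`: the underlying graded space is `V ⊕ V[1]`, and
`d_V v^a = dv^a`, `d_V dv^a = 0` for the linear coordinates `v^a` on `V` and the corresponding
coordinates `dv^a` on `V[1]`. -/
def shiftedTangent (V : GrSpace.{u}) : LInfty (V.prod V.shift) :=
  ofDifferential (H := V.prod V.shift)
    ((LinearMap.inl ℝ V V).comp (LinearMap.snd ℝ V V))
    (fun _ _ hx => ⟨hx.2, Submodule.zero_mem _⟩)
    (fun _ => rfl)

end LInfty

/-- The pullback of functions along the projection `M_H × M_K → M_H`. -/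
def FormalFun.fstPullback {H : GrSpace.{u}} (K : GrSpace.{u}) (f : FormalFun H) :
    FormalFun (H.prod K) :=
  ⟨fun n => (f.1 n).compLinearMap (fun _ => LinearMap.fst ℝ H K),
    fun n d x hx σ => f.2 n d (fun i => (x i).1) (fun i => (hx i).1) σ⟩

namespace LInfty

variable {H K : GrSpace.{u}}

/-- `(M_K, Q')` is an equivalent reduction of `(M_H, Q)`, with `s : M_K → M_H` as global
`Q`-section: there is a `Q`-map `π : M_H → M_K` with `π ∘ s = id` that is a trivial `Q`-bundle with
contractible fibre, i.e. for some `V` there is an isomorphism of `Q`-manifolds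
`t : M_H → M_K × T[1]V` (with inverse `t'`) over `M_K`. As the body of a formal pointed manifold is
one point, local triviality means triviality. -/
def IsEquivalentReduction (L' : LInfty K) (L : LInfty H) (s : FormalMap K H) : Prop :=
  IsQMap L' L s ∧
  ∃ π : FormalMap H K, IsQMap L L' π ∧ (∀ f, s.pullback (π.pullback f) = f) ∧
  ∃ (V : GrSpace.{u}) (t : FormalMap H (K.prod (V.prod V.shift)))
    (t' : FormalMap (K.prod (V.prod V.shift)) H),
    IsQMap L (L'.prod (shiftedTangent V)) t ∧
    IsQMap (L'.prod (shiftedTangent V)) L t' ∧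
    (∀ f, t'.pullback (t.pullback f) = f) ∧
    (∀ f, t.pullback (t'.pullback f) = f) ∧
    ∀ f : FormalFun K, t.pullback (f.fstPullback (V.prod V.shift)) = π.pullback f

/-- A splitting `H = E ⊕ F ⊕ Im D` into graded subspaces with `E ⊕ Im D = Ker D`. -/
structure IsSplitting (L : LInfty H) (E F : Submodule ℝ H) : Prop where
  gradedE : H.IsGraded E
  gradedF : H.IsGraded F
  disjoint : Disjoint E (LinearMap.range L.D)
  sup_eq : E ⊔ LinearMap.range L.D = LinearMap.ker L.D
  isCompl : IsCompl F (LinearMap.ker L.D)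

end LInfty

/-- The linear functions on `M_H` whose linear functionals vanish on `E ⊕ F`. -/
def linearVanishing (H : GrSpace.{u}) (E F : Submodule ℝ H) : Set (FormalFun H) :=
  {w | w.IsLinear ∧ ∀ x ∈ E ⊔ F, w.1 1 (fun _ => x) = 0}

end QMan

/-! Functions and vector fields are treated together as sequences of graded symmetric multilinear
maps, `VFun H M`. A vector field `v` acts by `ins v`, which inserts its values into the derivative
of a function. An L_∞-structure is then an odd field `q` with `ins q q = 0` and linear part `D`. The
Leibniz rule `ins_smulStar` and the commutator formula `ins_ins` avoid sums over shuffles: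
`coeff_succ_eq` reduces order n+1 to order n by differentiating in constant directions, and only the
derivative of the insertion product, `dd_star`, needs permutations.

A splitting yields the projection P onto E and a homotopy h inverting D : F → Im D, with kernel E ⊕
F and D h + h D = 1 - P (`exists_contraction`). The aim is a change of coordinates after which q is
D plus a nonlinear field that depends only on the P-components of its arguments and has values in E.
Suppose this holds up to order n. Then q² = 0 forces the component u of order n+1 to commute with D
in the graded sense (`Good.cocycle`), because the quadratic terms of that order live on E alone and
the projection of the equation to E makes them vanish. Contracting values and arguments onto E shows
that u is cohomologous to P u(P,…,P), with an explicit even field v of order n+1 as primitive;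
conjugation with exp(v) performs the step (`Good.exists_gauge`). The orders of these fields
increase, so the infinite composite of exponentials stabilizes in each order and defines an
automorphism T of the function algebra (`exists_normalForm`).

In normal form a linear map suffices: x ↦ (P x, D h x, D x) identifies H with E × V × V[1] for V =
Im D and turns q into the reduced structure times d_V (`toSplit_coeff`). Composition with T gives
the equivalent reduction. The linear part of the section is the inclusion of E because T does not
change linear terms, and E represents the cohomology, which gives the minimal model.

The description by W and QW rests on choosing every v with values in Ker h = E ⊕ F: then v
annihilates W, so T fixes W. The normal form acts on W by composition with D, since its nonlinear
part has values in E, and φ = φ D h + φ h D for φ vanishing on E. Hence every linear function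
vanishing on E is a sum of one in W and one in qW (`linF_mem_comapT'`). A general function vanishing
on E has the form `ins (linF C.N) f` with N = 1 - P (`ins_N_numPrim`), that is, a sum of products of
linear functions vanishing on E with derivatives of f. This sum is finite in finite dimension and a
limit of finite sums in general, which is why the closure appears. -/

namespace QMan

/-! ### Reduction to homogeneous arguments; signs of pairs. -/

variable {H : GrSpace.{u}} {M M' M'' : Type*} [AddCommGroup M] [Module ℝ M]
  [AddCommGroup M'] [Module ℝ M'] [AddCommGroup M''] [Module ℝ M'']

/-- A basis of a graded space consisting of homogeneous vectors. -/
theorem GrSpace.exists_homogeneous_basis (H : GrSpace.{u}) :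
    ∃ (J : Type u) (b : Module.Basis J ℝ H) (deg : J → ℤ × ZMod 2), ∀ j, b j ∈ H.gr (deg j) :=
  ⟨_, H.internal.collectedBasis fun d => Module.Basis.ofVectorSpace ℝ (H.gr d), Sigma.fst,
    fun j => H.internal.collectedBasis_mem _ j⟩

/-- Koszul signs are attached to homogeneous arguments only. A homogeneous basis exists, so by
multilinearity nothing is lost by testing there. -/
theorem multilinear_ext_hom {n : ℕ} {f g : MultilinearMap ℝ (fun _ : Fin n => (H : Type u)) M}
    (h : ∀ (d : Fin n → ℤ × ZMod 2) (x : Fin n → H), HomTuple H d x → f x = g x) : f = g := by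
  obtain ⟨J, b, deg, hb⟩ := H.exists_homogeneous_basis
  exact Module.Basis.ext_multilinear (fun _ => b)
    fun v => h (fun i => deg (v i)) _ fun i => hb (v i)

theorem linear_ext_hom {f g : (H : Type u) →ₗ[ℝ] M}
    (h : ∀ (d : ℤ × ZMod 2), ∀ x ∈ H.gr d, f x = g x) : f = g := by
  obtain ⟨J, b, deg, hb⟩ := H.exists_homogeneous_basis
  exact b.ext fun j => h _ _ (hb j)

/-- The Koszul sign of exchanging two elements of parities `a` and `b`. -/
def sg (a b : ZMod 2) : ℝ := if a = 1 ∧ b = 1 then -1 else 1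

theorem zmod2_cases (a : ZMod 2) : a = 0 ∨ a = 1 := by
  revert a; decide

@[simp] theorem sg_zero_left (a : ZMod 2) : sg 0 a = 1 := by simp [sg]
@[simp] theorem sg_zero_right (a : ZMod 2) : sg a 0 = 1 := by simp [sg]
@[simp] theorem sg_one_one : sg 1 1 = -1 := by simp [sg]

theorem sg_comm (a b : ZMod 2) : sg a b = sg b a := by
  simp [sg, and_comm]

theorem sg_add_right (a b c : ZMod 2) : sg a (b + c) = sg a b * sg a c := by
  have h : (1 + 1 : ZMod 2) = 0 := by decide
  rcases zmod2_cases a with rfl | rfl <;> rcases zmod2_cases b with rfl | rfl <;>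
    rcases zmod2_cases c with rfl | rfl <;> simp [h]

theorem sg_add_left (a b c : ZMod 2) : sg (a + b) c = sg a c * sg b c := by
  rw [sg_comm, sg_add_right, sg_comm c, sg_comm c]

@[simp] theorem sg_mul_self (a b : ZMod 2) : sg a b * sg a b = 1 := by
  unfold sg; split_ifs <;> norm_num

@[simp] theorem sg_smul_sg_smul (a b : ZMod 2) (x : M) : sg a b • sg a b • x = x := by
  rw [smul_smul, sg_mul_self, one_smul]

theorem sg_sum {ι : Type*} (s : Finset ι) (a : ZMod 2) (p : ι → ZMod 2) :
    sg a (∑ i ∈ s, p i) = ∏ i ∈ s, sg a (p i) := by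
  classical
  induction s using Finset.induction_on with
  | empty => simp
  | insert i s hi ih => rw [Finset.sum_insert hi, Finset.prod_insert hi, sg_add_right, ih]

/-- The operator `x ↦ (-1)^(δ |x|) x`. -/
noncomputable def parOp (H : GrSpace.{u}) (δ : ZMod 2) : H →ₗ[ℝ] H :=
  H.parityProj 0 + sg δ 1 • H.parityProj 1

theorem parOp_of_mem (δ : ZMod 2) {d : ℤ × ZMod 2} {x : H} (hx : x ∈ H.gr d) :
    parOp H δ x = sg δ d.2 • x := by
  simp only [parOp, LinearMap.add_apply, LinearMap.smul_apply, H.parityProj_of_mem _ hx]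
  rcases zmod2_cases d.2 with h | h <;> simp [h]

theorem parOp_mem (δ : ZMod 2) {d : ℤ × ZMod 2} {x : H} (hx : x ∈ H.gr d) :
    parOp H δ x ∈ H.gr d := by
  rw [parOp_of_mem δ hx]; exact Submodule.smul_mem _ _ hx

/-! ### Permutations of `Fin (n + 1)` by the position of `0` -/

/-- The permutation with `j ↦ 0` that is given by `τ` on the other elements. -/
def permOf {n : ℕ} (j : Fin (n + 1)) (τ : Equiv.Perm (Fin n)) : Equiv.Perm (Fin (n + 1)) :=
  (finSuccEquiv' j).trans ((Equiv.optionCongr τ).trans (finSuccEquiv' 0).symm)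

@[simp] theorem permOf_self {n : ℕ} (j : Fin (n + 1)) (τ : Equiv.Perm (Fin n)) :
    permOf j τ j = 0 := by simp [permOf]

@[simp] theorem permOf_succAbove {n : ℕ} (j : Fin (n + 1)) (τ : Equiv.Perm (Fin n)) (i : Fin n) :
    permOf j τ (j.succAbove i) = (τ i).succ := by simp [permOf]

theorem permOf_bijective (n : ℕ) : Function.Bijective
    (fun a : Fin (n + 1) × Equiv.Perm (Fin n) => permOf a.1 a.2) := by
  rw [Fintype.bijective_iff_injective_and_card]
  refine ⟨?_, by simp [Fintype.card_perm, Nat.factorial_succ]⟩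
  rintro ⟨j, τ⟩ ⟨j', τ'⟩ h
  have h1 : j = j' := by
    have h2 := congrArg (fun ρ : Equiv.Perm (Fin (n + 1)) => ρ j) h
    simp only [permOf_self] at h2
    rw [← permOf_self j' τ'] at h2
    exact (Equiv.injective _ h2).symm
  subst h1
  refine Prod.ext rfl (Equiv.ext fun i => ?_)
  have h2 := congrArg (fun ρ : Equiv.Perm (Fin (n + 1)) => ρ (j.succAbove i)) h
  simpa using h2

/-- A permutation of n+1 elements amounts to the position j at which 0 is placed and a permutation
of the others. This peels one argument off a symmetrization. -/
theorem sum_perm_succ {A : Type*} [AddCommMonoid A] {n : ℕ} (F : Equiv.Perm (Fin (n + 1)) → A) :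
    ∑ σ, F σ = ∑ j : Fin (n + 1), ∑ τ : Equiv.Perm (Fin n), F (permOf j τ) := by
  rw [← Fintype.sum_prod_type']
  exact ((permOf_bijective n).sum_comp F).symm

theorem cons_permOf {n : ℕ} {α : Type*} (j : Fin (n + 1)) (τ : Equiv.Perm (Fin n)) (y : α)
    (x : Fin n → α) :
    (fun i => (Fin.cons y x : Fin (n + 1) → α) (permOf j τ i))
      = j.insertNth (α := fun _ => α) y (fun i => x (τ i)) := by
  rw [Fin.eq_insertNth_iff]
  constructor
  · simp
  · funext i
    simp [Fin.removeNth]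

/-- The inverted pairs that involve 0 are those with the elements placed before position j. All
other inversions are inversions of τ. -/
theorem koszul_permOf {n : ℕ} (j : Fin (n + 1)) (τ : Equiv.Perm (Fin n)) (p : Fin (n + 1) → ZMod 2) :
    koszul (permOf j τ) p
      = (∏ i : Fin n, if i.castSucc < j then sg (p 0) (p (τ i).succ) else 1)
        * koszul τ (fun i => p i.succ) := by
  unfold koszul
  rw [Fintype.prod_prod_type, Fintype.prod_prod_type, Fin.prod_univ_succAbove _ j]
  have h1 : ∀ b : Fin (n + 1), (if j < b ∧ permOf j τ b < permOf j τ j ∧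
      p (permOf j τ j) = 1 ∧ p (permOf j τ b) = 1 then (-1 : ℝ) else 1) = 1 := by
    intro b; simp
  simp only [h1, Finset.prod_const_one, one_mul]
  rw [← Finset.prod_mul_distrib]
  refine Finset.prod_congr rfl fun a _ => ?_
  rw [Fin.prod_univ_succAbove _ j]
  congr 1
  · simp only [permOf_self, permOf_succAbove, Fin.succAbove_lt_iff_castSucc_lt, sg, Fin.succ_pos,
      true_and]
    split_ifs <;> grind
  · refine Finset.prod_congr rfl fun b _ => ?_
    simp [Fin.succAbove_lt_succAbove_iff]

theorem koszul_one {n : ℕ} (p : Fin n → ZMod 2) : koszul 1 p = 1 := by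
  unfold koszul
  refine Finset.prod_eq_one fun ij _ => if_neg ?_
  simp only [Equiv.Perm.coe_one, id_eq]
  rintro ⟨h1, h2, -⟩
  exact absurd h1 h2.asymm

theorem HomTuple.cons {n : ℕ} {d : Fin n → ℤ × ZMod 2} {x : Fin n → H} (hx : HomTuple H d x)
    {e : ℤ × ZMod 2} {y : H} (hy : y ∈ H.gr e) :
    HomTuple H (Fin.cons e d : Fin (n + 1) → ℤ × ZMod 2) (Fin.cons y x : Fin (n + 1) → H) := by
  intro i
  refine Fin.cases ?_ (fun j => ?_) i
  · simpa using hy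
  · simpa using hx j

theorem HomTuple.comp {n m : ℕ} {d : Fin n → ℤ × ZMod 2} {x : Fin n → H} (hx : HomTuple H d x)
    (s : Fin m → Fin n) : HomTuple H (fun i => d (s i)) (fun i => x (s i)) := fun i => hx (s i)

theorem IsGradedSymm.insertNth {n : ℕ} {t : MultilinearMap ℝ (fun _ : Fin (n + 1) => (H : Type u)) M}
    (ht : IsGradedSymm H t) {d : Fin n → ℤ × ZMod 2} {x : Fin n → H} (hx : HomTuple H d x)
    {e : ℤ × ZMod 2} {y : H} (hy : y ∈ H.gr e) (j : Fin (n + 1)) :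
    t (j.insertNth (α := fun _ => (H : Type u)) y x)
      = (∏ i : Fin n, if i.castSucc < j then sg e.2 (d i).2 else 1) • t (Fin.cons y x) := by
  have h := ht _ _ (hx.cons hy) (permOf j 1)
  rw [cons_permOf, koszul_permOf, koszul_one] at h
  simpa using h

end QMan

namespace QMan

variable {H : GrSpace.{u}} {M M' M'' : Type*} [AddCommGroup M] [Module ℝ M]
  [AddCommGroup M'] [Module ℝ M'] [AddCommGroup M''] [Module ℝ M'']

/-! ### Vector-valued formal functions -/

/-- Sequences of graded symmetric multilinear maps on `H` with values in `M`. -/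
def vfun (H : GrSpace.{u}) (M : Type*) [AddCommGroup M] [Module ℝ M] :
    Submodule ℝ (∀ n : ℕ, MultilinearMap ℝ (fun _ : Fin n => (H : Type u)) M) where
  carrier := {f | ∀ n, IsGradedSymm H (f n)}
  add_mem' := fun hf hg n d x hx σ => by
    simp [hf n d x hx σ, hg n d x hx σ]
  zero_mem' := fun n d x hx σ => by simp
  smul_mem' := fun c f hf n d x hx σ => by
    simp [hf n d x hx σ, smul_comm c]

/-- Formal functions on `M_H` with values in `M`. -/
abbrev VFun (H : GrSpace.{u}) (M : Type*) [AddCommGroup M] [Module ℝ M] := vfun H M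

/-- The Taylor coefficient of order `n`. -/
def coeff (n : ℕ) : VFun H M →ₗ[ℝ] MultilinearMap ℝ (fun _ : Fin n => (H : Type u)) M where
  toFun f := f.1 n
  map_add' _ _ := rfl
  map_smul' _ _ := rfl

theorem coeff_apply (n : ℕ) (f : VFun H M) : coeff n f = f.1 n := rfl

theorem coeff_symm (n : ℕ) (f : VFun H M) : IsGradedSymm H (coeff n f) := f.2 n

theorem vfun_ext {f g : VFun H M} (h : ∀ n, coeff n f = coeff n g) : f = g :=
  Subtype.ext (funext h)

theorem isGradedSymm_cons {n : ℕ} {t : MultilinearMap ℝ (fun _ : Fin (n + 1) => (H : Type u)) M}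
    (ht : IsGradedSymm H t) (y : H) : IsGradedSymm H (t.curryLeft y) := by
  intro d x hx σ
  have key : ∀ (e : ℤ × ZMod 2), ∀ z ∈ H.gr e,
      t.curryLeft z (fun i => x (σ i)) = koszul σ (fun i => (d i).2) • t.curryLeft z x := by
    intro e z hz
    have h := ht _ _ (hx.cons hz) (permOf 0 σ)
    rw [cons_permOf, koszul_permOf] at h
    simpa using h
  -- Both sides are linear in the inserted vector, so the homogeneous case `key` settles an
  -- arbitrary `y`.
  have := linear_ext_hom (H := H)
    (f := (LinearMap.mk ⟨fun z => t.curryLeft z (fun i => x (σ i)), by simp⟩ (by simp)))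
    (g := (LinearMap.mk ⟨fun z => koszul σ (fun i => (d i).2) • t.curryLeft z x,
      by simp⟩ (by simp [smul_comm (koszul _ _)]))) key
  exact LinearMap.congr_fun this y

/-- The derivative in the direction of a constant vector. -/
def dd (f : VFun H M) : H →ₗ[ℝ] VFun H M where
  toFun y := ⟨fun n => (coeff (n + 1) f).curryLeft y, fun n => isGradedSymm_cons (f.2 (n + 1)) y⟩
  map_add' y z := vfun_ext fun n => map_add (coeff (n + 1) f).curryLeft y z
  map_smul' c y := vfun_ext fun n => map_smul (coeff (n + 1) f).curryLeft c y

@[simp] theorem coeff_dd (f : VFun H M) (y : H) (n : ℕ) (x : Fin n → H) :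
    coeff n (dd f y) x = coeff (n + 1) f (Fin.cons y x) := rfl

theorem dd_add (f g : VFun H M) (y : H) : dd (f + g) y = dd f y + dd g y := rfl

theorem dd_sub (f g : VFun H M) (y : H) : dd (f - g) y = dd f y - dd g y := rfl

theorem dd_smul (c : ℝ) (f : VFun H M) (y : H) : dd (c • f) y = c • dd f y := rfl

/-- This is the engine of the inductions on the Taylor order: together with a rule for `dd` of each
operation, it replaces the combinatorics of shuffles. -/
theorem coeff_succ_eq {f g : VFun H M} {n : ℕ}
    (h : ∀ (d : ℤ × ZMod 2), ∀ y ∈ H.gr d, coeff n (dd f y) = coeff n (dd g y)) :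
    coeff (n + 1) f = coeff (n + 1) g := by
  refine multilinear_ext_hom fun d x hx => ?_
  have h1 := congrArg (fun t => t (fun i => x i.succ)) (h (d 0) (x 0) (hx 0))
  simp only [coeff_dd] at h1
  have h2 : (Fin.cons (x 0) (fun i => x i.succ) : Fin (n + 1) → H) = x := Fin.cons_self_tail x
  rwa [h2] at h1

/-- Exchanging the first two arguments of a Taylor coefficient costs only the sign of that pair. -/
theorem dd_dd (f : VFun H M) {d e : ℤ × ZMod 2} {y z : H} (hy : y ∈ H.gr d) (hz : z ∈ H.gr e) :
    dd (dd f z) y = sg d.2 e.2 • dd (dd f y) z := by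
  refine vfun_ext fun n => multilinear_ext_hom fun c x hx => ?_
  have h := (coeff_symm (n + 2) f).insertNth (hx.cons hy) hz 1
  have h2 : (Fin.insertNth (α := fun _ => (H : Type u)) 1 z (Fin.cons y x) : Fin (n + 2) → H)
      = Fin.cons y (Fin.cons z x) := by
    rw [eq_comm, Fin.eq_insertNth_iff]
    refine ⟨rfl, funext fun i => ?_⟩
    refine Fin.cases ?_ (fun i => ?_) i <;> simp [Fin.removeNth]
  rw [h2, Fin.prod_univ_succ] at h
  simp only [Fin.castSucc_zero, Fin.zero_lt_one, if_true, Fin.cons_zero] at h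
  rw [Finset.prod_eq_one] at h
  · simp only [coeff_dd, map_smul, smul_apply]
    rw [h, mul_one, smul_smul, sg_comm d.2, sg_mul_self, one_smul]
  · intro i _
    rw [if_neg]
    simp [Fin.lt_def]

/-- Precomposition with a linear map of degree `0`. -/
def precomp {K : GrSpace.{u}} (χ : H →ₗ[ℝ] K) (hχ : ∀ d, ∀ x ∈ H.gr d, χ x ∈ K.gr d) :
    VFun K M →ₗ[ℝ] VFun H M where
  toFun f := ⟨fun n => (coeff n f).compLinearMap (fun _ => χ), fun n d x hx σ =>
    f.2 n d (fun i => χ (x i)) (fun i => hχ _ _ (hx i)) σ⟩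
  map_add' _ _ := rfl
  map_smul' _ _ := rfl

@[simp] theorem coeff_precomp {K : GrSpace.{u}} (χ : H →ₗ[ℝ] K)
    (hχ : ∀ d, ∀ x ∈ H.gr d, χ x ∈ K.gr d) (f : VFun K M) (n : ℕ) (x : Fin n → H) :
    coeff n (precomp χ hχ f) x = coeff n f (fun i => χ (x i)) := rfl

/-- The automorphism induced by `x ↦ (-1)^(δ |x|) x`. -/
noncomputable def twist (δ : ZMod 2) : VFun H M →ₗ[ℝ] VFun H M :=
  precomp (parOp H δ) fun _ _ hx => parOp_mem δ hx

theorem twist_apply (δ : ZMod 2) (f : VFun H M) {n : ℕ} {d : Fin n → ℤ × ZMod 2} {x : Fin n → H}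
    (hx : HomTuple H d x) : coeff n (twist δ f) x = (∏ i, sg δ (d i).2) • coeff n f x := by
  rw [twist, coeff_precomp, ← MultilinearMap.map_smul_univ]
  congr 1
  exact funext fun i => parOp_of_mem δ (hx i)

/-- Composition with a linear map of the values. -/
def postcomp (φ : M →ₗ[ℝ] M') : VFun H M →ₗ[ℝ] VFun H M' where
  toFun f := ⟨fun n => φ.compMultilinearMap (coeff n f), fun n d x hx σ => by
    simp [coeff_apply, f.2 n d x hx σ]⟩
  map_add' f g := vfun_ext fun n => MultilinearMap.ext fun x => map_add φ _ _
  map_smul' c f := vfun_ext fun n => MultilinearMap.ext fun x => map_smul φ _ _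

@[simp] theorem coeff_postcomp (φ : M →ₗ[ℝ] M') (f : VFun H M) (n : ℕ) (x : Fin n → H) :
    coeff n (postcomp φ f) x = φ (coeff n f x) := rfl

theorem dd_twist (δ : ZMod 2) (f : VFun H M) {d : ℤ × ZMod 2} {y : H} (hy : y ∈ H.gr d) :
    dd (twist δ f) y = sg δ d.2 • twist δ (dd f y) := by
  refine vfun_ext fun n => multilinear_ext_hom fun c x hx => ?_
  rw [coeff_dd, twist_apply δ f (hx.cons hy), Fin.prod_univ_succ, map_smul, smul_apply,
    twist_apply δ _ hx, smul_smul]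
  rfl

theorem twist_twist (δ ε : ZMod 2) (f : VFun H M) : twist δ (twist ε f) = twist (δ + ε) f := by
  refine vfun_ext fun n => multilinear_ext_hom fun c x hx => ?_
  rw [twist_apply _ _ hx, twist_apply _ _ hx, twist_apply _ _ hx, smul_smul,
    ← Finset.prod_mul_distrib]
  simp only [sg_add_left]

@[simp] theorem twist_zero (f : VFun H M) : twist 0 f = f := by
  refine vfun_ext fun n => multilinear_ext_hom fun c x hx => ?_
  rw [twist_apply _ _ hx]; simp

@[simp] theorem coeff_zero_twist (δ : ZMod 2) (f : VFun H M) :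
    coeff 0 (twist δ f) = coeff 0 f := by
  refine multilinear_ext_hom fun c x hx => ?_
  rw [twist_apply _ _ hx]; simp

/-! ### The insertion product -/

/-- Graded symmetrization of a vector-valued multilinear map. -/
noncomputable def vsymm {n : ℕ}
    (t : MultilinearMap ℝ (fun _ : Fin n => (H : Type u)) M) :
    MultilinearMap ℝ (fun _ : Fin n => (H : Type u)) M :=
  ∑ σ : Equiv.Perm (Fin n), ∑ p : Fin n → ZMod 2,
    koszul σ p • (t.domDomCongr σ).compLinearMap (fun i => H.parityProj (p i))

theorem vsymm_apply {n : ℕ} (t : MultilinearMap ℝ (fun _ : Fin n => (H : Type u)) M)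
    {d : Fin n → ℤ × ZMod 2} {x : Fin n → H} (hx : HomTuple H d x) :
    vsymm t x = ∑ σ : Equiv.Perm (Fin n), koszul σ (fun i => (d i).2) • t (fun i => x (σ i)) := by
  simp only [vsymm, sum_apply]
  refine Finset.sum_congr rfl fun σ _ => ?_
  rw [Finset.sum_eq_single (fun i => (d i).2)]
  · simp [H.parityProj_of_mem _ (hx _)]
  · intro p _ hp
    obtain ⟨i, hi⟩ : ∃ i, p i ≠ (d i).2 := by
      by_contra! h
      exact hp (funext h)
    simp only [smul_apply, MultilinearMap.compLinearMap_apply,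
      MultilinearMap.domDomCongr_apply]
    rw [MultilinearMap.map_coord_zero t (σ.symm i), smul_zero]
    simp [H.parityProj_of_mem _ (hx _), hi.symm]
  · simp

theorem isGradedSymm_vsymm {n : ℕ} (t : MultilinearMap ℝ (fun _ : Fin n => (H : Type u)) M) :
    IsGradedSymm H (vsymm t) := by
  intro d x hx τ
  rw [vsymm_apply t hx,
    vsymm_apply t (d := fun i => d (τ i)) (x := fun i => x (τ i)) (fun i => hx (τ i)),
    Finset.smul_sum]
  rw [← Equiv.sum_comp (Equiv.mulLeft τ)
    (fun σ => koszul τ (fun i => (d i).2) •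
      (koszul σ (fun i => (d i).2) • t (fun i => x (σ i))))]
  refine Finset.sum_congr rfl fun σ _ => ?_
  simp only [Equiv.coe_mulLeft, Equiv.Perm.mul_apply]
  rw [koszul_mul, smul_smul, ← mul_assoc, koszul_mul_self, one_mul]
  rfl

/-- The identification of two consecutive blocks with `Fin n`. -/
def blocks {a b n : ℕ} (h : a + b = n) : Fin a ⊕ Fin b ≃ Fin n :=
  finSumFinEquiv.trans (finCongr h)

/-- The component of the insertion product in which the first factor has `a` arguments and the
second one `b` arguments. -/
noncomputable def blk {a b n : ℕ} (h : a + b = n) (f : VFun H M) (G : M →ₗ[ℝ] VFun H M') :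
    MultilinearMap ℝ (fun _ : Fin n => (H : Type u)) M' :=
  ((Nat.factorial a : ℝ) * (Nat.factorial b : ℝ))⁻¹ •
    vsymm ((MultilinearMap.uncurrySum (R := ℝ) (N := fun _ => (H : Type u))
      (((coeff b).comp G).compMultilinearMap (coeff a f))).domDomCongr (blocks h))

theorem blk_apply {a b n : ℕ} (h : a + b = n) (f : VFun H M) (G : M →ₗ[ℝ] VFun H M')
    {d : Fin n → ℤ × ZMod 2} {x : Fin n → H} (hx : HomTuple H d x) :
    blk h f G x = ((Nat.factorial a : ℝ) * (Nat.factorial b : ℝ))⁻¹ •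
      ∑ σ : Equiv.Perm (Fin n), koszul σ (fun i => (d i).2) •
        coeff b (G (coeff a f (fun i => x (σ (blocks h (Sum.inl i))))))
          (fun j => x (σ (blocks h (Sum.inr j)))) := by
  rw [blk, smul_apply, vsymm_apply _ hx]
  rfl

/-- The function obtained by inserting the values of `f` into a family `G` of functions that
depends linearly on a parameter. -/
noncomputable def star (f : VFun H M) (G : M →ₗ[ℝ] VFun H M') : VFun H M' :=
  ⟨fun n => ∑ k : Fin (n + 1), blk (a := k) (b := n - k) (by omega) f G, by
    intro n d x hx σ
    simp only [sum_apply, Finset.smul_sum, blk, smul_apply]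
    refine Finset.sum_congr rfl fun k _ => ?_
    rw [isGradedSymm_vsymm _ d x hx σ, smul_comm]⟩

theorem coeff_star (n : ℕ) (f : VFun H M) (G : M →ₗ[ℝ] VFun H M') :
    coeff n (star f G) = ∑ k : Fin (n + 1), blk (a := k) (b := n - k) (by omega) f G := rfl

theorem blk_congr {a b a' b' n : ℕ} (h : a + b = n) (h' : a' + b' = n) (ha : a = a')
    (f : VFun H M) (G : M →ₗ[ℝ] VFun H M') : blk h f G = blk h' f G := by
  subst ha
  obtain rfl : b = b' := by omega
  rfl

/-- A vector inserted at a place of one block changes that block only. This lemma and the next three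
record the four combinations that occur when a symmetrized product of two blocks is differentiated.
-/
theorem insertNth_blocks_left {α : Type*} {a b n : ℕ} (h : a + b = n) (h' : a + 1 + b = n + 1)
    (j : Fin (a + 1)) (y : α) (w : Fin n → α) :
    (fun i => (blocks h' (Sum.inl j)).insertNth (α := fun _ => α) y w (blocks h' (Sum.inl i)))
      = j.insertNth (α := fun _ => α) y (fun i => w (blocks h (Sum.inl i))) := by
  rw [Fin.eq_insertNth_iff]
  refine ⟨by simp, funext fun i => ?_⟩
  have h2 : blocks h' (Sum.inl (j.succAbove i))
      = (blocks h' (Sum.inl j)).succAbove (blocks h (Sum.inl i)) := by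
    ext
    simp [blocks, Fin.succAbove, Fin.lt_def]
    split_ifs <;> simp
  simp only [Fin.removeNth, h2, Fin.insertNth_apply_succAbove]

theorem insertNth_blocks_left_right {α : Type*} {a b n : ℕ} (h : a + b = n)
    (h' : a + 1 + b = n + 1) (j : Fin (a + 1)) (y : α) (w : Fin n → α) :
    (fun i => (blocks h' (Sum.inl j)).insertNth (α := fun _ => α) y w (blocks h' (Sum.inr i)))
      = fun i => w (blocks h (Sum.inr i)) := by
  funext i
  have h2 : blocks h' (Sum.inr i)
      = (blocks h' (Sum.inl j)).succAbove (blocks h (Sum.inr i)) := by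
    ext
    simp [blocks, Fin.succAbove, Fin.lt_def]
    split_ifs <;> simp <;> omega
  simp only [h2, Fin.insertNth_apply_succAbove]

theorem insertNth_blocks_right {α : Type*} {a b n : ℕ} (h : a + b = n) (h' : a + (b + 1) = n + 1)
    (j : Fin (b + 1)) (y : α) (w : Fin n → α) :
    (fun i => (blocks h' (Sum.inr j)).insertNth (α := fun _ => α) y w (blocks h' (Sum.inr i)))
      = j.insertNth (α := fun _ => α) y (fun i => w (blocks h (Sum.inr i))) := by
  rw [Fin.eq_insertNth_iff]
  refine ⟨by simp, funext fun i => ?_⟩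
  have h2 : blocks h' (Sum.inr (j.succAbove i))
      = (blocks h' (Sum.inr j)).succAbove (blocks h (Sum.inr i)) := by
    ext
    simp [blocks, Fin.succAbove, Fin.lt_def]
    split_ifs <;> simp <;> omega
  simp only [Fin.removeNth, h2, Fin.insertNth_apply_succAbove]

theorem insertNth_blocks_right_left {α : Type*} {a b n : ℕ} (h : a + b = n)
    (h' : a + (b + 1) = n + 1) (j : Fin (b + 1)) (y : α) (w : Fin n → α) :
    (fun i => (blocks h' (Sum.inr j)).insertNth (α := fun _ => α) y w (blocks h' (Sum.inl i)))
      = fun i => w (blocks h (Sum.inl i)) := by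
  funext i
  have h2 : blocks h' (Sum.inl i)
      = (blocks h' (Sum.inr j)).succAbove (blocks h (Sum.inl i)) := by
    ext
    simp [blocks, Fin.succAbove, Fin.lt_def]
    split_ifs <;> simp <;> omega
  simp only [h2, Fin.insertNth_apply_succAbove]

theorem prod_blocks {a b n : ℕ} (h : a + b = n) (F : Fin n → ℝ) :
    ∏ i, F i = (∏ i, F (blocks h (Sum.inl i))) * ∏ i, F (blocks h (Sum.inr i)) := by
  rw [← (blocks h).prod_comp, Fintype.prod_sum_type]

theorem sum_blocks {A : Type*} [AddCommMonoid A] {a b n : ℕ} (h : a + b = n) (F : Fin n → A) :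
    ∑ i, F i = (∑ i, F (blocks h (Sum.inl i))) + ∑ i, F (blocks h (Sum.inr i)) := by
  rw [← (blocks h).sum_comp, Fintype.sum_sum_type]

end QMan

/-! ### The derivative of the insertion product. -/

namespace QMan

variable {H : GrSpace.{u}} {M M' M'' : Type*} [AddCommGroup M] [Module ℝ M]
  [AddCommGroup M'] [Module ℝ M'] [AddCommGroup M''] [Module ℝ M'']

/-- The family of derivatives in the direction of `y` of a family of functions. -/
def ddFam (y : H) (G : M →ₗ[ℝ] VFun H M') : M →ₗ[ℝ] VFun H M' where
  toFun a := dd (G a) y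
  map_add' a b := by rw [map_add, dd_add]
  map_smul' c a := by rw [map_smul, dd_smul]; rfl

@[simp] theorem ddFam_apply (y : H) (G : M →ₗ[ℝ] VFun H M') (a : M) :
    ddFam y G a = dd (G a) y := rfl

section DerivativeOfStar

variable {a b n : ℕ} (f : VFun H M) (G : M →ₗ[ℝ] VFun H M')
  {d : Fin n → ℤ × ZMod 2} {x : Fin n → H} (hx : HomTuple H d x)
  {e : ℤ × ZMod 2} {y : H} (hy : y ∈ H.gr e) (τ : Equiv.Perm (Fin n))

/-- The sign for carrying `y` to its place in the first block arises twice, from the Koszul sign of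
the permutation and from the graded symmetry of the coefficient of `f`. It cancels, so the result
does not depend on `j`. -/
theorem blk_summand_left (h : a + b = n) (h' : a + 1 + b = n + 1) (hx : HomTuple H d x)
    (hy : y ∈ H.gr e) (j : Fin (a + 1)) :
    koszul (permOf (blocks h' (Sum.inl j)) τ)
        (fun i => ((Fin.cons e d : Fin (n + 1) → ℤ × ZMod 2) i).2) •
      coeff b (G (coeff (a + 1) f (fun i => (Fin.cons y x : Fin (n + 1) → H)
        (permOf (blocks h' (Sum.inl j)) τ (blocks h' (Sum.inl i))))))
        (fun i => (Fin.cons y x : Fin (n + 1) → H)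
          (permOf (blocks h' (Sum.inl j)) τ (blocks h' (Sum.inr i))))
    = koszul τ (fun i => (d i).2) •
      coeff b (G (coeff a (dd f y) (fun i => x (τ (blocks h (Sum.inl i))))))
        (fun i => x (τ (blocks h (Sum.inr i)))) := by
  have hc := cons_permOf (blocks h' (Sum.inl j)) τ y x
  have hc' := fun i => congrFun hc i
  simp only [hc']
  rw [insertNth_blocks_left h h', insertNth_blocks_left_right h h',
    (coeff_symm (a + 1) f).insertNth (d := fun i => d (τ (blocks h (Sum.inl i))))
      (fun i => hx _) hy j, koszul_permOf, prod_blocks h]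
  simp only [Fin.cons_zero, Fin.cons_succ]
  have h1 : ∀ i : Fin a, ((blocks h (Sum.inl i)).castSucc < blocks h' (Sum.inl j))
      ↔ i.castSucc < j := by
    intro i; simp [blocks, Fin.lt_def]
  have h2 : ∀ i : Fin b, ¬ ((blocks h (Sum.inr i)).castSucc < blocks h' (Sum.inl j)) := by
    intro i; simp [blocks, Fin.lt_def]; omega
  simp only [h1, h2, if_false, Finset.prod_const_one, mul_one, map_smul, smul_apply, coeff_dd]
  rw [smul_smul, mul_right_comm, ← Finset.prod_mul_distrib, Finset.prod_eq_one, one_mul]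
  intro i _
  split_ifs <;> simp

/-- As in the first block, the sign inside the second block cancels. What remains is the sign for
passing all arguments of the first block, and `twist` absorbs it into `f`. -/
theorem blk_summand_right (h : a + b = n) (h' : a + (b + 1) = n + 1) (hx : HomTuple H d x)
    (hy : y ∈ H.gr e) (j : Fin (b + 1)) :
    koszul (permOf (blocks h' (Sum.inr j)) τ)
        (fun i => ((Fin.cons e d : Fin (n + 1) → ℤ × ZMod 2) i).2) •
      coeff (b + 1) (G (coeff a f (fun i => (Fin.cons y x : Fin (n + 1) → H)
        (permOf (blocks h' (Sum.inr j)) τ (blocks h' (Sum.inl i))))))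
        (fun i => (Fin.cons y x : Fin (n + 1) → H)
          (permOf (blocks h' (Sum.inr j)) τ (blocks h' (Sum.inr i))))
    = koszul τ (fun i => (d i).2) •
      coeff b (ddFam y G (coeff a (twist e.2 f) (fun i => x (τ (blocks h (Sum.inl i))))))
        (fun i => x (τ (blocks h (Sum.inr i)))) := by
  have hc := cons_permOf (blocks h' (Sum.inr j)) τ y x
  have hc' := fun i => congrFun hc i
  simp only [hc']
  rw [insertNth_blocks_right h h', insertNth_blocks_right_left h h',
    (coeff_symm (b + 1) _).insertNth (d := fun i => d (τ (blocks h (Sum.inr i))))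
      (fun i => hx _) hy j, koszul_permOf, prod_blocks h,
    twist_apply e.2 f (d := fun i => d (τ (blocks h (Sum.inl i)))) (fun i => hx _)]
  simp only [Fin.cons_zero, Fin.cons_succ]
  have h1 : ∀ i : Fin a, ((blocks h (Sum.inl i)).castSucc < blocks h' (Sum.inr j)) := by
    intro i; simp [blocks, Fin.lt_def]; omega
  have h2 : ∀ i : Fin b, ((blocks h (Sum.inr i)).castSucc < blocks h' (Sum.inr j))
      ↔ i.castSucc < j := by
    intro i; simp [blocks, Fin.lt_def]
  simp only [h1, h2, if_true, map_smul, smul_apply, coeff_dd, ddFam_apply]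
  rw [smul_smul, smul_smul]
  have hA : (∏ i : Fin b, if i.castSucc < j then sg e.2 (d (τ (blocks h (Sum.inr i)))).2 else 1)
      * (∏ i : Fin b, if i.castSucc < j then sg e.2 (d (τ (blocks h (Sum.inr i)))).2 else 1)
      = 1 := by
    rw [← Finset.prod_mul_distrib]
    refine Finset.prod_eq_one fun i _ => ?_
    split_ifs <;> simp
  congr 1
  linear_combination (∏ i : Fin a, sg e.2 (d (τ (blocks h (Sum.inl i)))).2) *
    koszul τ (fun i => (d i).2) * hA

/-- The part of `blk` in which the first argument goes to the first factor. -/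
noncomputable def blkLeft (y : H) : ∀ {a b : ℕ}, a + b = n + 1 →
    MultilinearMap ℝ (fun _ : Fin n => (H : Type u)) M'
  | 0, _, _ => 0
  | a + 1, b, h => blk (a := a) (b := b) (by omega) (dd f y) G

/-- The part of `blk` in which the first argument goes to the second factor. -/
noncomputable def blkRight (e : ZMod 2) (y : H) : ∀ {a b : ℕ}, a + b = n + 1 →
    MultilinearMap ℝ (fun _ : Fin n => (H : Type u)) M'
  | _, 0, _ => 0
  | a, b + 1, h => blk (a := a) (b := b) (by omega) (twist e f) (ddFam y G)

/-- All places of `y` within one block contribute equally. Their number turns the inverse factorial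
of that block's size into the one for a block smaller by one. -/
theorem blk_cons (h : a + b = n + 1) (hx : HomTuple H d x) (hy : y ∈ H.gr e) :
    blk h f G (Fin.cons y x) = blkLeft f G y h x + blkRight f G e.2 y h x := by
  rw [blk_apply h f G (hx.cons hy), sum_perm_succ, sum_blocks h, smul_add]
  congr 1
  · cases a with
    | zero => simp [blkLeft]
    | succ a =>
      rw [blkLeft, blk_apply (by omega : a + b = n) _ _ hx]
      simp only [blk_summand_left f G _ (by omega : a + b = n) h hx hy]
      rw [Finset.sum_const, Finset.card_univ, Fintype.card_fin, ← Nat.cast_smul_eq_nsmul ℝ,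
        smul_smul]
      congr 1
      rw [Nat.factorial_succ]
      have := Nat.cast_add_one_ne_zero (R := ℝ) a
      have := Nat.cast_ne_zero (R := ℝ).2 a.factorial_ne_zero
      have := Nat.cast_ne_zero (R := ℝ).2 b.factorial_ne_zero
      push_cast
      field_simp
  · cases b with
    | zero => simp [blkRight]
    | succ b =>
      rw [blkRight, blk_apply (by omega : a + b = n) _ _ hx]
      simp only [blk_summand_right f G _ (by omega : a + b = n) h hx hy]
      rw [Finset.sum_const, Finset.card_univ, Fintype.card_fin, ← Nat.cast_smul_eq_nsmul ℝ,
        smul_smul]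
      congr 1
      rw [Nat.factorial_succ]
      have := Nat.cast_add_one_ne_zero (R := ℝ) b
      have := Nat.cast_ne_zero (R := ℝ).2 a.factorial_ne_zero
      have := Nat.cast_ne_zero (R := ℝ).2 b.factorial_ne_zero
      push_cast
      field_simp

theorem blkLeft_succ {a' b' : ℕ} (h : a + b = n + 1) (h' : a' + b' = n) (ha : a = a' + 1) :
    blkLeft f G y h = blk h' (dd f y) G := by
  subst ha
  rw [blkLeft]
  exact blk_congr _ _ rfl _ _

theorem blkRight_succ {a' b' : ℕ} {ε : ZMod 2} (h : a + b = n + 1) (h' : a' + b' = n)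
    (ha : a = a') : blkRight f G ε y h = blk h' (twist ε f) (ddFam y G) := by
  subst ha
  obtain rfl : b = b' + 1 := by omega
  rw [blkRight]

theorem blkLeft_zero (h : a + b = n + 1) (ha : a = 0) : blkLeft f G y h = 0 := by
  subst ha
  rw [blkLeft]

theorem blkRight_zero {ε : ZMod 2} (h : a + b = n + 1) (hb : b = 0) :
    blkRight f G ε y h = 0 := by
  subst hb
  rw [blkRight]

end DerivativeOfStar

/-- The Leibniz rule for the derivative in a constant direction. -/
theorem dd_star (f : VFun H M) (G : M →ₗ[ℝ] VFun H M') {e : ℤ × ZMod 2} {y : H}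
    (hy : y ∈ H.gr e) :
    dd (star f G) y = star (dd f y) G + star (twist e.2 f) (ddFam y G) := by
  refine vfun_ext fun n => multilinear_ext_hom fun d x hx => ?_
  rw [coeff_dd, map_add, add_apply, coeff_star, coeff_star, coeff_star]
  simp only [sum_apply]
  rw [Finset.sum_congr rfl fun k _ => blk_cons f G _ hx hy, Finset.sum_add_distrib]
  congr 1
  -- An empty first block has no place for `y`, so the term `k = 0` drops out; in the second sum the
  -- last term does, since there the second block is empty.
  · rw [Fin.sum_univ_succ, blkLeft_zero _ _ _ (by simp), zero_apply, zero_add]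
    refine Finset.sum_congr rfl fun k _ => ?_
    rw [blkLeft_succ f G _ (by omega : (k : ℕ) + (n - k) = n) (by simp)]
  · rw [Fin.sum_univ_castSucc, blkRight_zero _ _ _ (by simp), zero_apply, add_zero]
    refine Finset.sum_congr rfl fun k _ => ?_
    rw [blkRight_succ f G _ (by omega : (k : ℕ) + (n - k) = n) (by simp)]

end QMan

namespace QMan

variable {H : GrSpace.{u}} {M M' M'' : Type*} [AddCommGroup M] [Module ℝ M]
  [AddCommGroup M'] [Module ℝ M'] [AddCommGroup M''] [Module ℝ M'']

theorem coeff_star_apply (f : VFun H M) (G : M →ₗ[ℝ] VFun H M') {n : ℕ}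
    {d : Fin n → ℤ × ZMod 2} {x : Fin n → H} (hx : HomTuple H d x) :
    coeff n (star f G) x = ∑ k : Fin (n + 1),
      ((Nat.factorial k : ℝ) * (Nat.factorial (n - k) : ℝ))⁻¹ •
      ∑ σ : Equiv.Perm (Fin n), koszul σ (fun i => (d i).2) •
        coeff (n - k) (G (coeff k f (fun i => x (σ (split k (Sum.inl i))))))
          (fun j => x (σ (split k (Sum.inr j)))) := by
  rw [coeff_star, sum_apply]
  exact Finset.sum_congr rfl fun k _ => blk_apply _ _ _ hx

theorem star_add_left (f g : VFun H M) (G : M →ₗ[ℝ] VFun H M') :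
    star (f + g) G = star f G + star g G := by
  refine vfun_ext fun n => multilinear_ext_hom fun d x hx => ?_
  simp only [map_add, add_apply, coeff_star_apply _ _ hx, smul_add, Finset.sum_add_distrib]

theorem star_smul_left (c : ℝ) (f : VFun H M) (G : M →ₗ[ℝ] VFun H M') :
    star (c • f) G = c • star f G := by
  refine vfun_ext fun n => multilinear_ext_hom fun d x hx => ?_
  simp only [map_smul, smul_apply, coeff_star_apply _ _ hx, Finset.smul_sum, smul_comm c]

theorem star_add_right (f : VFun H M) (G G' : M →ₗ[ℝ] VFun H M') :
    star f (G + G') = star f G + star f G' := by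
  refine vfun_ext fun n => multilinear_ext_hom fun d x hx => ?_
  simp only [map_add, LinearMap.add_apply, add_apply, coeff_star_apply _ _ hx, smul_add,
    Finset.sum_add_distrib]

theorem star_smul_right (c : ℝ) (f : VFun H M) (G : M →ₗ[ℝ] VFun H M') :
    star f (c • G) = c • star f G := by
  refine vfun_ext fun n => multilinear_ext_hom fun d x hx => ?_
  simp only [map_smul, LinearMap.smul_apply, smul_apply, coeff_star_apply _ _ hx, Finset.smul_sum,
    smul_comm c]

theorem star_postcomp (φ : M →ₗ[ℝ] M') (f : VFun H M) (G : M' →ₗ[ℝ] VFun H M'') :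
    star (postcomp φ f) G = star f (G.comp φ) := by
  refine vfun_ext fun n => multilinear_ext_hom fun d x hx => ?_
  simp only [coeff_star_apply _ _ hx, coeff_postcomp, LinearMap.comp_apply]

theorem postcomp_star (φ : M' →ₗ[ℝ] M'') (f : VFun H M) (G : M →ₗ[ℝ] VFun H M') :
    postcomp φ (star f G) = star f ((postcomp φ).comp G) := by
  refine vfun_ext fun n => multilinear_ext_hom fun d x hx => ?_
  simp only [coeff_star_apply _ _ hx, coeff_postcomp, LinearMap.comp_apply, map_sum, map_smul]

theorem precomp_star {K : GrSpace.{u}} (χ : H →ₗ[ℝ] K) (hχ : ∀ d, ∀ x ∈ H.gr d, χ x ∈ K.gr d)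
    (f : VFun K M) (G : M →ₗ[ℝ] VFun K M') :
    precomp χ hχ (star f G) = star (precomp χ hχ f) ((precomp χ hχ).comp G) := by
  refine vfun_ext fun n => multilinear_ext_hom fun d x hx => ?_
  have hx' : HomTuple K d (fun i => χ (x i)) := fun i => hχ _ _ (hx i)
  simp only [coeff_precomp, coeff_star_apply _ _ hx, coeff_star_apply _ _ hx', LinearMap.comp_apply]

theorem coeff_star_eq_zero {n : ℕ} (f : VFun H M) (G : M →ₗ[ℝ] VFun H M')
    (h : ∀ k ≤ n, coeff k f = 0 ∨ ∀ a, coeff (n - k) (G a) = 0) : coeff n (star f G) = 0 := by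
  refine multilinear_ext_hom fun d x hx => ?_
  rw [coeff_star_apply _ _ hx, zero_apply]
  refine Finset.sum_eq_zero fun k _ => ?_
  rw [Finset.sum_eq_zero, smul_zero]
  intro σ _
  rcases h k (by omega) with h | h <;> simp [h]

theorem coeff_zero_star (f : VFun H M) (G : M →ₗ[ℝ] VFun H M') :
    coeff 0 (star f G) = coeff 0 (G (coeff 0 f Fin.elim0)) := by
  refine multilinear_ext_hom fun d x hx => ?_
  rw [coeff_star_apply _ _ hx]
  rw [Fin.sum_univ_succ, Fin.sum_univ_zero, add_zero, Fintype.sum_unique,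
    show (default : Equiv.Perm (Fin 0)) = 1 from rfl, koszul_one, one_smul]
  have h3 : ((Nat.factorial (0 : Fin (0 + 1)) : ℝ)
      * (Nat.factorial (0 - (0 : Fin (0 + 1))) : ℝ))⁻¹ = 1 := by simp
  rw [h3, one_smul]
  exact congr (congrArg (fun s => ⇑(coeff 0 (G (coeff 0 f s)))) (Subsingleton.elim _ _))
    (@Subsingleton.elim (Fin 0 → H) _ _ _)

/-! ### The product and the insertion operators -/

/-- The product of a scalar function and a vector-valued function. -/
noncomputable def smulStar (f : VFun H ℝ) (g : VFun H M) : VFun H M :=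
  star f (LinearMap.toSpanSingleton ℝ _ g)

theorem coeff_zero_smulStar (f : VFun H ℝ) (g : VFun H M) :
    coeff 0 (smulStar f g) = coeff 0 f Fin.elim0 • coeff 0 g := by
  rw [smulStar, coeff_zero_star]; simp

theorem smulStar_add_left (f g : VFun H ℝ) (k : VFun H M) :
    smulStar (f + g) k = smulStar f k + smulStar g k := star_add_left _ _ _

theorem smulStar_smul_left (c : ℝ) (f : VFun H ℝ) (k : VFun H M) :
    smulStar (c • f) k = c • smulStar f k := star_smul_left _ _ _

theorem smulStar_add_right (f : VFun H ℝ) (g k : VFun H M) :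
    smulStar f (g + k) = smulStar f g + smulStar f k := by
  simp only [smulStar]
  rw [← star_add_right]
  congr 1
  ext; simp

theorem smulStar_smul_right (c : ℝ) (f : VFun H ℝ) (k : VFun H M) :
    smulStar f (c • k) = c • smulStar f k := by
  simp only [smulStar]
  rw [← star_smul_right]
  congr 1
  ext; simp

theorem dd_smulStar (f : VFun H ℝ) (g : VFun H M) {e : ℤ × ZMod 2} {y : H} (hy : y ∈ H.gr e) :
    dd (smulStar f g) y = smulStar (dd f y) g + smulStar (twist e.2 f) (dd g y) := by
  rw [smulStar, dd_star _ _ hy]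
  congr 2

/-- The derivation of formal functions given by a vector field `v`. -/
noncomputable def ins (v : VFun H H) : VFun H M →ₗ[ℝ] VFun H M where
  toFun f := star v (dd f)
  map_add' f g := star_add_right v (dd f) (dd g)
  map_smul' c f := star_smul_right c v (dd f)

theorem ins_apply (v : VFun H H) (f : VFun H M) : ins v f = star v (dd f) := rfl

theorem ins_add (v w : VFun H H) (f : VFun H M) : ins (v + w) f = ins v f + ins w f :=
  star_add_left _ _ _

theorem ins_smul (c : ℝ) (v : VFun H H) (f : VFun H M) : ins (c • v) f = c • ins v f :=
  star_smul_left _ _ _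

@[simp] theorem ins_zero (f : VFun H M) : ins (0 : VFun H H) f = 0 := by
  simpa using ins_smul 0 0 f

theorem ins_neg (v : VFun H H) (f : VFun H M) : ins (-v) f = - ins v f := by
  refine eq_neg_of_add_eq_zero_left ?_
  rw [← ins_add, neg_add_cancel, ins_zero]

theorem ins_sub (v w : VFun H H) (f : VFun H M) : ins (v - w) f = ins v f - ins w f := by
  rw [sub_eq_add_neg, ins_add, ins_neg, sub_eq_add_neg]

theorem postcomp_ins (φ : M →ₗ[ℝ] M') (v : VFun H H) (f : VFun H M) :
    postcomp φ (ins v f) = ins v (postcomp φ f) := by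
  rw [ins_apply, postcomp_star]
  rfl

theorem coeff_ins_eq_zero {n : ℕ} (v : VFun H H) (f : VFun H M)
    (h : ∀ k ≤ n, coeff k v = 0 ∨ coeff (n - k + 1) f = 0) : coeff n (ins v f) = 0 := by
  refine coeff_star_eq_zero _ _ fun k hk => (h k hk).imp id fun h a => ?_
  ext x
  simp [h]

theorem coeff_zero_ins (v : VFun H H) (f : VFun H M) :
    coeff 0 (ins v f) = coeff 0 (dd f (coeff 0 v Fin.elim0)) := coeff_zero_star _ _

/-! ### Degrees of vector fields and their commutation rules. -/

/-- The values of `f` at homogeneous arguments of total degree `s` lie in `𝒟 s`. -/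
def HasDeg (𝒟 : ℤ × ZMod 2 → Submodule ℝ M) (f : VFun H M) : Prop :=
  ∀ (n : ℕ) (d : Fin n → ℤ × ZMod 2) (x : Fin n → H), HomTuple H d x →
    coeff n f x ∈ 𝒟 (∑ i, d i)

/-- The vector field `v` is homogeneous of degree `e`. -/
def IsDeg (e : ℤ × ZMod 2) (v : VFun H H) : Prop := HasDeg (fun s => H.gr (s + e)) v

theorem HasDeg.ins {𝒟 : ℤ × ZMod 2 → Submodule ℝ M} {f : VFun H M} (hf : HasDeg 𝒟 f)
    {e : ℤ × ZMod 2} {v : VFun H H} (hv : IsDeg e v) :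
    HasDeg (fun s => 𝒟 (s + e)) (ins v f) := by
  intro n d x hx
  rw [ins_apply, coeff_star_apply _ _ hx]
  refine Submodule.sum_mem _ fun k _ => Submodule.smul_mem _ _ (Submodule.sum_mem _ fun σ _ =>
    Submodule.smul_mem _ _ ?_)
  rw [coeff_dd]
  have h1 := hf _ _ _ ((hx.comp (fun j => σ (split k (Sum.inr j)))).cons
    (hv _ _ _ (hx.comp (fun j => σ (split k (Sum.inl j))))))
  rw [Fin.sum_cons] at h1
  have h2 : ∑ i, d i = ∑ i, d (σ (split k (Sum.inl i))) + ∑ i, d (σ (split k (Sum.inr i))) := by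
    rw [← Equiv.sum_comp σ, ← (split k).sum_comp, Fintype.sum_sum_type]
  rw [add_right_comm, ← h2] at h1
  exact h1

theorem HasDeg.add {𝒟 : ℤ × ZMod 2 → Submodule ℝ M} {f g : VFun H M} (hf : HasDeg 𝒟 f)
    (hg : HasDeg 𝒟 g) : HasDeg 𝒟 (f + g) :=
  fun n d x hx => Submodule.add_mem _ (hf n d x hx) (hg n d x hx)

theorem HasDeg.smul {𝒟 : ℤ × ZMod 2 → Submodule ℝ M} {f : VFun H M} (hf : HasDeg 𝒟 f)
    (c : ℝ) : HasDeg 𝒟 (c • f) :=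
  fun n d x hx => Submodule.smul_mem _ _ (hf n d x hx)

theorem HasDeg.neg {𝒟 : ℤ × ZMod 2 → Submodule ℝ M} {f : VFun H M} (hf : HasDeg 𝒟 f) :
    HasDeg 𝒟 (-f) :=
  fun n d x hx => Submodule.neg_mem _ (hf n d x hx)

theorem HasDeg.sub {𝒟 : ℤ × ZMod 2 → Submodule ℝ M} {f g : VFun H M} (hf : HasDeg 𝒟 f)
    (hg : HasDeg 𝒟 g) : HasDeg 𝒟 (f - g) :=
  fun n d x hx => Submodule.sub_mem _ (hf n d x hx) (hg n d x hx)

theorem IsDeg.ins {e e' : ℤ × ZMod 2} {v w : VFun H H} (hv : IsDeg e v) (hw : IsDeg e' w) :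
    IsDeg (e + e') (ins v w) := by
  have h := HasDeg.ins hw hv
  intro n d x hx
  simpa only [add_assoc] using h n d x hx

theorem IsDeg.dd {e d : ℤ × ZMod 2} {v : VFun H H} (hv : IsDeg e v) {y : H} (hy : y ∈ H.gr d) :
    IsDeg (d + e) (dd v y) := by
  intro n c x hx
  have h := hv _ _ _ (hx.cons hy)
  rw [Fin.sum_cons, add_comm d] at h
  simpa only [add_assoc, coeff_dd] using h

theorem IsDeg.const_mem {e : ℤ × ZMod 2} {v : VFun H H} (hv : IsDeg e v) :
    coeff 0 v Fin.elim0 ∈ H.gr e := by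
  have h := hv 0 Fin.elim0 Fin.elim0 (fun i => i.elim0)
  simpa using h

/-- The signs of the arguments and of the value multiply to the sign of the degree of `v`. Thus the
twist produced by the Leibniz rule can be traded for a scalar sign. -/
theorem IsDeg.postcomp_parOp_twist {e : ℤ × ZMod 2} {v : VFun H H} (hv : IsDeg e v) (δ : ZMod 2) :
    postcomp (parOp H δ) (twist δ v) = sg δ e.2 • v := by
  refine vfun_ext fun n => multilinear_ext_hom fun d x hx => ?_
  rw [coeff_postcomp, twist_apply _ _ hx, map_smul, parOp_of_mem δ (hv n d x hx), map_smul,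
    smul_apply, smul_smul]
  congr 1
  rw [Prod.snd_add, Prod.snd_sum, sg_add_right, sg_sum, ← mul_assoc, ← Finset.prod_mul_distrib]
  simp

/-- The graded commutator of a constant derivative with `ins v` is insertion of the derivative of
`v`: in the Leibniz rule one term differentiates `v`, the other a further time `f`, and `dd_dd`
reorders the two derivatives. -/
theorem dd_ins {e d : ℤ × ZMod 2} {v : VFun H H} (hv : IsDeg e v) (f : VFun H M) {y : H}
    (hy : y ∈ H.gr d) :
    dd (ins v f) y = ins (dd v y) f + sg d.2 e.2 • ins v (dd f y) := by
  rw [ins_apply, dd_star _ _ hy, ins_apply, ← ins_smul, ← hv.postcomp_parOp_twist, ins_apply,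
    star_postcomp]
  congr 2
  refine linear_ext_hom fun c z hz => ?_
  rw [ddFam_apply, LinearMap.comp_apply, parOp_of_mem _ hz, map_smul, dd_dd f hy hz]

theorem parOp_parOp (δ : ZMod 2) (x : H) : parOp H δ (parOp H δ x) = x := by
  have : (parOp H δ).comp (parOp H δ) = LinearMap.id := by
    refine linear_ext_hom fun d x hx => ?_
    rw [LinearMap.comp_apply, parOp_of_mem δ hx, map_smul, parOp_of_mem δ hx]
    simp
  exact LinearMap.congr_fun this x

theorem twist_ins {e : ℤ × ZMod 2} {v : VFun H H} (hv : IsDeg e v) (f : VFun H M) (δ : ZMod 2) :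
    twist δ (ins v f) = sg δ e.2 • ins v (twist δ f) := by
  rw [← ins_smul, ← hv.postcomp_parOp_twist, ins_apply, ins_apply, star_postcomp, twist,
    precomp_star]
  congr 1
  ext z : 1
  refine vfun_ext fun n => ?_
  ext x
  simp only [LinearMap.comp_apply, coeff_precomp, coeff_dd]
  congr 1
  funext i
  refine Fin.cases ?_ (fun j => ?_) i <;> simp [parOp_parOp]

/-- Differentiating both sides yields instances of the same identity one order lower. One of them
has `dd v y` in place of `v`, so the induction must range over all fields and degrees. -/
theorem coeff_ins_smulStar (n : ℕ) : ∀ {e : ℤ × ZMod 2} {v : VFun H H} (_ : IsDeg e v)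
    (f : VFun H ℝ) (g : VFun H M),
    coeff n (ins v (smulStar f g))
      = coeff n (smulStar (ins v f) g + smulStar (twist e.2 f) (ins v g)) := by
  induction n with
  | zero =>
    intro e v hv f g
    rw [coeff_zero_ins, dd_smulStar _ _ hv.const_mem, map_add, map_add]
    simp only [coeff_zero_smulStar, coeff_zero_ins]
  | succ n ih =>
    intro e v hv f g
    refine coeff_succ_eq fun d y hy => ?_
    rw [dd_ins hv _ hy, dd_smulStar _ _ hy, dd_add, dd_smulStar _ _ hy, dd_smulStar _ _ hy,
      dd_ins hv _ hy, dd_ins hv _ hy, map_add, map_smul, map_add (ins v), map_add (coeff n),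
      ih (hv.dd hy), ih hv, ih hv, twist_ins hv, dd_twist _ _ hy, twist_twist, twist_twist]
    simp only [smulStar_add_left, smulStar_smul_left, smulStar_add_right, smulStar_smul_right,
      map_add, map_smul, smul_add, Prod.snd_add]
    rw [sg_comm e.2 d.2, add_comm e.2 d.2]
    abel

/-- Insertion operators are derivations. -/
theorem ins_smulStar {e : ℤ × ZMod 2} {v : VFun H H} (hv : IsDeg e v) (f : VFun H ℝ)
    (g : VFun H M) :
    ins v (smulStar f g) = smulStar (ins v f) g + smulStar (twist e.2 f) (ins v g) :=
  vfun_ext fun n => coeff_ins_smulStar n hv f g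

/-- As for the product rule, a constant derivative produces instances of lower order, with the
derivative falling on `v`, `w` or `f`. It remains to compare signs, which depend on three parities
only. -/
theorem coeff_ins_ins (n : ℕ) : ∀ {e e' : ℤ × ZMod 2} {v w : VFun H H} (_ : IsDeg e v)
    (_ : IsDeg e' w) (f : VFun H M),
    coeff n (ins v (ins w f)) = coeff n (sg e.2 e'.2 • ins w (ins v f)
      + ins (ins v w - sg e.2 e'.2 • ins w v) f) := by
  induction n with
  | zero =>
    intro e e' v w hv hw f
    -- At order zero the operators see only the constant terms. The second-derivative term is graded
    -- symmetric in `v` and `w`, hence cancels in the commutator.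
    have h1 : ∀ (v w : VFun H H) {e e' : ℤ × ZMod 2} (_ : IsDeg e v) (_ : IsDeg e' w),
        coeff 0 (ins v (ins w f)) = coeff 0 (dd f (coeff 0 (ins v w) Fin.elim0))
          + sg e.2 e'.2 • coeff 0 (dd (dd f (coeff 0 v Fin.elim0)) (coeff 0 w Fin.elim0)) := by
      intro v w e e' hv hw
      rw [coeff_zero_ins, dd_ins hw _ hv.const_mem, map_add, map_smul, coeff_zero_ins,
        coeff_zero_ins, coeff_zero_ins]
    rw [map_add, map_smul, h1 v w hv hw, h1 w v hw hv, coeff_zero_ins _ f, map_sub, map_smul,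
      sub_apply, smul_apply, map_sub, map_smul, map_sub, map_smul,
      dd_dd f hw.const_mem hv.const_mem, map_smul, sg_comm e'.2 e.2]
    simp only [smul_add, sg_smul_sg_smul]
    abel
  | succ n ih =>
    intro e e' v w hv hw f
    refine coeff_succ_eq fun d y hy => ?_
    have hvw := hv.ins hw
    have hwv : IsDeg (e + e') (sg e.2 e'.2 • ins w v) := by
      rw [add_comm]; exact (hw.ins hv).smul _
    rw [dd_ins hv _ hy, dd_ins hw _ hy, dd_add, dd_smul, dd_ins hw _ hy, dd_ins hv _ hy,
      dd_ins (hvw.sub hwv) _ hy, dd_sub, dd_smul, dd_ins hv _ hy, dd_ins hw _ hy]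
    simp only [map_add, map_smul, smul_add, ins_add, ins_sub, ins_smul, map_sub]
    rw [ih (hv.dd hy) hw, ih hv (hw.dd hy), ih hv hw]
    simp only [map_add, map_smul, smul_add, ins_sub, ins_smul, map_sub, Prod.snd_add,
      sg_add_left, sg_add_right, smul_sub, smul_smul]
    rw [sg_comm e.2 d.2]
    rcases zmod2_cases e.2 with h1 | h1 <;> rcases zmod2_cases e'.2 with h2 | h2 <;>
      rcases zmod2_cases d.2 with h3 | h3 <;> simp only [h1, h2, h3, sg_zero_left, sg_zero_right,
        sg_one_one] <;> module

/-- The graded commutator of insertion operators is an insertion operator. -/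
theorem ins_ins {e e' : ℤ × ZMod 2} {v w : VFun H H} (hv : IsDeg e v) (hw : IsDeg e' w)
    (f : VFun H M) :
    ins v (ins w f) = sg e.2 e'.2 • ins w (ins v f)
      + ins (ins v w - sg e.2 e'.2 • ins w v) f :=
  vfun_ext fun n => coeff_ins_ins n hv hw f

end QMan

namespace QMan

variable {H : GrSpace.{u}} {M M' M'' : Type*} [AddCommGroup M] [Module ℝ M]
  [AddCommGroup M'] [Module ℝ M'] [AddCommGroup M''] [Module ℝ M'']

/-! ### The order filtration and exponentials -/

/-- The functions whose Taylor coefficients of order less than `n` vanish. -/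
def ordGE (H : GrSpace.{u}) (M : Type*) [AddCommGroup M] [Module ℝ M] (n : ℕ) :
    Submodule ℝ (VFun H M) where
  carrier := {f | ∀ m < n, coeff m f = 0}
  add_mem' := fun hf hg m hm => by rw [map_add, hf m hm, hg m hm, add_zero]
  zero_mem' := fun m _ => map_zero _
  smul_mem' := fun c f hf m hm => by rw [map_smul, hf m hm, smul_zero]

theorem mem_ordGE_zero (f : VFun H M) : f ∈ ordGE H M 0 := fun _ hm => absurd hm (Nat.not_lt_zero _)

theorem ordGE_mono {m n : ℕ} (h : m ≤ n) : ordGE H M n ≤ ordGE H M m :=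
  fun _ hf k hk => hf k (hk.trans_le h)

/-- The operator `X` raises the order. -/
def Raises (X : VFun H M →ₗ[ℝ] VFun H M) : Prop :=
  ∀ n, ∀ f ∈ ordGE H M n, X f ∈ ordGE H M (n + 1)

theorem Raises.pow {X : VFun H M →ₗ[ℝ] VFun H M} (hX : Raises X) {n : ℕ} {f : VFun H M}
    (hf : f ∈ ordGE H M n) (k : ℕ) : (X ^ k) f ∈ ordGE H M (n + k) := by
  induction k with
  | zero => simpa using hf
  | succ k ih => rw [pow_succ', Module.End.mul_apply]; exact hX _ _ ih

/-- This makes the exponential series a finite sum in each order, so that no convergence question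
arises. -/
theorem Raises.coeff_pow {X : VFun H M →ₗ[ℝ] VFun H M} (hX : Raises X) (f : VFun H M) {n k : ℕ}
    (h : n < k) : coeff n ((X ^ k) f) = 0 :=
  hX.pow (mem_ordGE_zero f) k n (by omega)

theorem Raises.neg {X : VFun H M →ₗ[ℝ] VFun H M} (hX : Raises X) : Raises (-X) :=
  fun n f hf => Submodule.neg_mem _ (hX n f hf)

/-- Partial sums of the exponential series. -/
noncomputable def expPartial (X : VFun H M →ₗ[ℝ] VFun H M) (N : ℕ) : VFun H M →ₗ[ℝ] VFun H M :=
  ∑ k ∈ Finset.range (N + 1), ((Nat.factorial k : ℝ))⁻¹ • X ^ k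

theorem expPartial_apply (X : VFun H M →ₗ[ℝ] VFun H M) (N : ℕ) (f : VFun H M) :
    expPartial X N f = ∑ k ∈ Finset.range (N + 1), ((Nat.factorial k : ℝ))⁻¹ • (X ^ k) f := by
  simp [expPartial]

/-- The exponential of an operator that raises the order. -/
noncomputable def expOp (X : VFun H M →ₗ[ℝ] VFun H M) : VFun H M →ₗ[ℝ] VFun H M where
  toFun f := ⟨fun n => coeff n (expPartial X n f), fun n => coeff_symm n _⟩
  map_add' f g := vfun_ext fun n => by
    change coeff n (expPartial X n (f + g)) = _
    rw [map_add, map_add]; rfl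
  map_smul' c f := vfun_ext fun n => by
    change coeff n (expPartial X n (c • f)) = _
    rw [map_smul, map_smul]; rfl

theorem coeff_expOp_self (X : VFun H M →ₗ[ℝ] VFun H M) (f : VFun H M) (n : ℕ) :
    coeff n (expOp X f) = coeff n (expPartial X n f) := rfl

theorem coeff_expOp {X : VFun H M →ₗ[ℝ] VFun H M} (hX : Raises X) (f : VFun H M) {n N : ℕ}
    (h : n ≤ N) : coeff n (expOp X f) = coeff n (expPartial X N f) := by
  rw [coeff_expOp_self, expPartial_apply, expPartial_apply, map_sum, map_sum]
  refine Finset.sum_subset (Finset.range_mono (by omega)) fun k _ hk => ?_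
  rw [map_smul, hX.coeff_pow f (by simpa using hk), smul_zero]

theorem expOp_sub_expPartial {X : VFun H M →ₗ[ℝ] VFun H M} (hX : Raises X) (f : VFun H M)
    (N : ℕ) : expOp X f - expPartial X N f ∈ ordGE H M (N + 1) := by
  intro m hm
  rw [map_sub, coeff_expOp hX f (by omega : m ≤ N), sub_self]

/-- A product of truncated series runs over a square of index pairs. The pairs beyond the diagonal
contribute nothing, so a triangle is left. -/
theorem sum_range_range_eq {A : Type*} [AddCommMonoid A] (F : ℕ → ℕ → A) (N : ℕ)
    (hF : ∀ i j, N ≤ i + j → F i j = 0) :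
    ∑ i ∈ Finset.range N, ∑ j ∈ Finset.range N, F i j
      = ∑ k ∈ Finset.range N, ∑ p ∈ Finset.HasAntidiagonal.antidiagonal k, F p.1 p.2 := by
  simp only [Finset.Nat.sum_antidiagonal_eq_sum_range_succ_mk]
  rw [Finset.sum_range_diag_flip N F]
  refine Finset.sum_congr rfl fun i _ => ?_
  symm
  refine Finset.sum_subset (Finset.range_mono (by omega)) fun j _ hj => hF _ _ ?_
  simp at hj
  omega

/-- Exponentials turn a Leibniz rule for a bilinear operation into compatibility with it. -/
theorem expOp_bilinear {X : VFun H M →ₗ[ℝ] VFun H M} {Y : VFun H M' →ₗ[ℝ] VFun H M'}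
    {Z : VFun H M'' →ₗ[ℝ] VFun H M''} (hX : Raises X) (hY : Raises Y) (hZ : Raises Z)
    (B : VFun H M →ₗ[ℝ] VFun H M' →ₗ[ℝ] VFun H M'')
    (hB : ∀ n a b, a ∈ ordGE H M (n + 2) → coeff n (B a b) = 0)
    (hB' : ∀ n a b, b ∈ ordGE H M' (n + 2) → coeff n (B a b) = 0)
    (a : VFun H M) (b : VFun H M')
    (hL : ∀ i j, Z (B ((X ^ i) a) ((Y ^ j) b))
      = B ((X ^ (i + 1)) a) ((Y ^ j) b) + B ((X ^ i) a) ((Y ^ (j + 1)) b))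
    (hij : ∀ i j n, n < i + j → coeff n (B ((X ^ i) a) ((Y ^ j) b)) = 0) :
    expOp Z (B a b) = B (expOp X a) (expOp Y b) := by
  set F : ℕ → ℕ → VFun H M'' := fun i j =>
    ((Nat.factorial i : ℝ)⁻¹ * (Nat.factorial j : ℝ)⁻¹) • B ((X ^ i) a) ((Y ^ j) b) with hF
  have hpow : ∀ k, ((Nat.factorial k : ℝ))⁻¹ • (Z ^ k) (B a b)
      = ∑ p ∈ Finset.HasAntidiagonal.antidiagonal k, F p.1 p.2 := by
    intro k
    induction k with
    | zero => simp [hF]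
    | succ k ih =>
      have h1 : ((Nat.factorial (k + 1) : ℝ))⁻¹ • (Z ^ (k + 1)) (B a b)
          = ((k + 1 : ℝ))⁻¹ • Z (((Nat.factorial k : ℝ))⁻¹ • (Z ^ k) (B a b)) := by
        rw [map_smul, smul_smul, pow_succ', Module.End.mul_apply, Nat.factorial_succ]
        push_cast
        rw [mul_inv]
      rw [h1, ih, inv_smul_eq_iff₀ (by positivity), map_sum, Finset.smul_sum]
      -- The weight `k + 1` is the sum of the two indices, and each index cancels one factor of its
      -- factorial. The two parts match the two terms of the Leibniz rule after a shift of one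
      -- index.
      have h2 : ∀ p ∈ Finset.HasAntidiagonal.antidiagonal (k + 1), (k + 1 : ℝ) • F p.1 p.2
          = (p.1 : ℝ) • F p.1 p.2 + (p.2 : ℝ) • F p.1 p.2 := by
        intro p hp
        rw [← add_smul]
        congr 1
        have := Finset.HasAntidiagonal.mem_antidiagonal.1 hp
        exact_mod_cast this.symm
      rw [Finset.sum_congr rfl h2, Finset.sum_add_distrib, Finset.Nat.sum_antidiagonal_succ,
        Finset.Nat.sum_antidiagonal_succ']
      simp only [Nat.cast_zero, zero_smul, zero_add, ← Finset.sum_add_distrib]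
      refine Finset.sum_congr rfl fun p _ => ?_
      simp only [hF, map_smul, hL, smul_add, smul_smul, Nat.factorial_succ]
      push_cast
      congr 2
      · field_simp
      · field_simp
  refine vfun_ext fun n => ?_
  -- The truncation is at `n + 1` instead of `n`, because an insertion of constant terms lets order
  -- `n` of the result see order `n + 1` of a factor.
  have h3 : coeff n (B (expOp X a) (expOp Y b))
      = coeff n (B (expPartial X (n + 1) a) (expPartial Y (n + 1) b)) := by
    have e1 := hB n _ (expOp Y b) (expOp_sub_expPartial hX a (n + 1))
    have e2 := hB' n (expPartial X (n + 1) a) _ (expOp_sub_expPartial hY b (n + 1))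
    rw [map_sub, LinearMap.sub_apply, map_sub, sub_eq_zero] at e1
    rw [map_sub, map_sub, sub_eq_zero] at e2
    rw [e1, e2]
  rw [h3, coeff_expOp hZ _ (by omega : n ≤ n + 1), expPartial_apply, expPartial_apply,
    expPartial_apply, Finset.sum_congr rfl fun k _ => hpow k]
  have h4 := sum_range_range_eq (fun i j => coeff n (F i j)) (n + 1 + 1) (fun i j h => by
    simp only [hF, map_smul, hij i j n (by omega), smul_zero])
  simp only [map_sum]
  rw [← h4]
  simp only [map_sum, LinearMap.sum_apply, map_smul, LinearMap.smul_apply, hF]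
  rw [Finset.sum_comm]
  simp only [Finset.smul_sum, smul_smul, mul_comm]

/-- These are the coefficients of exp(x) exp(-x) = 1. -/
theorem sum_antidiagonal_exp_neg (k : ℕ) :
    ∑ p ∈ Finset.HasAntidiagonal.antidiagonal k,
      (Nat.factorial p.1 : ℝ)⁻¹ * ((-1) ^ p.2 * (Nat.factorial p.2 : ℝ)⁻¹)
      = if k = 0 then 1 else 0 := by
  have h := congrArg (PowerSeries.coeff k) (PowerSeries.exp_mul_exp_neg_eq_one (A := ℝ))
  rw [PowerSeries.coeff_mul, PowerSeries.coeff_one] at h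
  rw [← h]
  refine Finset.sum_congr rfl fun p _ => ?_
  simp [PowerSeries.evalNegHom, PowerSeries.coeff_exp, PowerSeries.coeff_rescale]

theorem Raises.coeff_congr {X : VFun H M →ₗ[ℝ] VFun H M} (hX : Raises X) {f g : VFun H M} {n : ℕ}
    (h : f - g ∈ ordGE H M (n + 1)) (N : ℕ) :
    coeff n (expPartial X N f) = coeff n (expPartial X N g) := by
  rw [← sub_eq_zero, ← map_sub, ← map_sub, expPartial_apply, map_sum]
  refine Finset.sum_eq_zero fun k _ => ?_
  rw [map_smul, hX.pow h k n (by omega), smul_zero]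

theorem neg_pow_apply (X : VFun H M →ₗ[ℝ] VFun H M) (k : ℕ) (f : VFun H M) :
    ((-X) ^ k) f = (-1 : ℝ) ^ k • (X ^ k) f := by
  induction k with
  | zero => simp
  | succ k ih =>
    rw [pow_succ', pow_succ', pow_succ', Module.End.mul_apply, Module.End.mul_apply, ih, map_smul,
      LinearMap.neg_apply]
    module

theorem expOp_expOp_neg {X : VFun H M →ₗ[ℝ] VFun H M} (hX : Raises X) (f : VFun H M) :
    expOp X (expOp (-X) f) = f := by
  refine vfun_ext fun n => ?_
  rw [coeff_expOp_self, hX.coeff_congr (expOp_sub_expPartial hX.neg f n), expPartial_apply,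
    expPartial_apply]
  simp only [map_sum, map_smul, Finset.smul_sum]
  rw [sum_range_range_eq (fun i j => (Nat.factorial i : ℝ)⁻¹ • (Nat.factorial j : ℝ)⁻¹ •
    coeff n ((X ^ i) (((-X) ^ j) f)))]
  · have h1 : ∀ k ∈ Finset.range (n + 1), ∑ p ∈ Finset.HasAntidiagonal.antidiagonal k,
        (Nat.factorial p.1 : ℝ)⁻¹ • (Nat.factorial p.2 : ℝ)⁻¹ •
          coeff n ((X ^ p.1) (((-X) ^ p.2) f))
        = (if k = 0 then (1 : ℝ) else 0) • coeff n ((X ^ k) f) := by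
      intro k _
      rw [← sum_antidiagonal_exp_neg, Finset.sum_smul]
      refine Finset.sum_congr rfl fun p hp => ?_
      rw [← Finset.HasAntidiagonal.mem_antidiagonal.1 hp, pow_add, Module.End.mul_apply,
        neg_pow_apply, map_smul, map_smul, smul_smul, smul_smul]
      congr 1
      ring
    rw [Finset.sum_congr rfl h1, Finset.sum_eq_single 0]
    · simp
    · intro k _ hk; simp [hk]
    · simp
  · intro i j hij
    rw [hX.pow (hX.neg.pow (mem_ordGE_zero f) j) i n (by omega), smul_zero, smul_zero]

theorem expOp_neg_expOp {X : VFun H M →ₗ[ℝ] VFun H M} (hX : Raises X) (f : VFun H M) :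
    expOp (-X) (expOp X f) = f := by
  have h := expOp_expOp_neg hX.neg f
  rwa [show - -X = X from neg_neg X] at h

end QMan

namespace QMan

variable {H : GrSpace.{u}} {M M' M'' : Type*} [AddCommGroup M] [Module ℝ M]
  [AddCommGroup M'] [Module ℝ M'] [AddCommGroup M''] [Module ℝ M'']

/-! ### Linear and constant functions -/

/-- The linear function given by a linear map. -/
def linF (φ : H →ₗ[ℝ] M) : VFun H M :=
  ⟨fun n => match n with
    | 1 => MultilinearMap.ofSubsingleton ℝ (H : Type u) M (0 : Fin 1) φ
    | _ => 0, by
    rintro (_ | _ | n) d x hx σ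
    · simp
    · obtain rfl : σ = 1 := Equiv.ext fun i => Subsingleton.elim (α := Fin 1) _ _
      simp [koszul_one]
    · simp⟩

@[simp] theorem coeff_linF_one (φ : H →ₗ[ℝ] M) (x : Fin 1 → H) : coeff 1 (linF φ) x = φ (x 0) := rfl

theorem coeff_linF_of_ne (φ : H →ₗ[ℝ] M) {n : ℕ} (h : n ≠ 1) : coeff n (linF φ) = 0 := by
  rcases n with _ | _ | n
  · rfl
  · exact absurd rfl h
  · rfl

theorem dd_dd_linF (φ : H →ₗ[ℝ] M) (y z : H) : dd (dd (linF φ) y) z = 0 :=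
  vfun_ext fun n => by
    ext x
    rw [coeff_dd, coeff_dd, coeff_linF_of_ne φ (by omega)]
    rfl

theorem star_zero_right (f : VFun H M) : star f (0 : M →ₗ[ℝ] VFun H M') = 0 := by
  simpa using star_smul_right 0 f (0 : M →ₗ[ℝ] VFun H M')

theorem ins_linF (v : VFun H H) (φ : H →ₗ[ℝ] M) : ins v (linF φ) = postcomp φ v := by
  refine vfun_ext fun n => ?_
  induction n generalizing v with
  | zero =>
    rw [coeff_zero_ins]
    ext x
    rw [coeff_dd, coeff_postcomp, coeff_linF_one, Fin.cons_zero, Subsingleton.elim x Fin.elim0]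
  | succ n ih =>
    refine coeff_succ_eq fun d y hy => ?_
    rw [ins_apply, dd_star _ _ hy, show ddFam y (dd (linF φ)) = 0 from
      LinearMap.ext fun z => dd_dd_linF φ z y, star_zero_right, add_zero]
    exact ih _

/-- A vector field is recovered from its operator by applying it to the identity function. In this
way equations between operators give equations between fields. -/
theorem ins_linF_id (v : VFun H H) : ins v (linF LinearMap.id) = v := by
  rw [ins_linF]; rfl

theorem ins_eq_zero_of_coeff (v : VFun H H) {f : VFun H M} (h : ∀ n, coeff (n + 1) f = 0) :
    ins v f = 0 :=
  vfun_ext fun _ => coeff_ins_eq_zero _ _ fun _ _ => Or.inr (h _)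

/-! ### Exponentials of vector fields -/

/-- The insertion operator as a bilinear map. -/
noncomputable def insL (H : GrSpace.{u}) (M : Type*) [AddCommGroup M] [Module ℝ M] :
    VFun H H →ₗ[ℝ] VFun H M →ₗ[ℝ] VFun H M where
  toFun v := ins v
  map_add' v w := LinearMap.ext fun f => ins_add v w f
  map_smul' c v := LinearMap.ext fun f => ins_smul c v f

@[simp] theorem insL_apply (v : VFun H H) (f : VFun H M) : insL H M v f = ins v f := rfl

/-- The product as a bilinear map. -/
noncomputable def smulStarL (H : GrSpace.{u}) (M : Type*) [AddCommGroup M] [Module ℝ M] :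
    VFun H ℝ →ₗ[ℝ] VFun H M →ₗ[ℝ] VFun H M :=
  LinearMap.mk₂ ℝ smulStar smulStar_add_left smulStar_smul_left smulStar_add_right
    fun c f g => smulStar_smul_right c f g

@[simp] theorem smulStarL_apply (f : VFun H ℝ) (g : VFun H M) :
    smulStarL H M f g = smulStar f g := rfl

theorem coeff_smulStar_eq_zero {n : ℕ} (f : VFun H ℝ) (g : VFun H M)
    (h : ∀ k ≤ n, coeff k f = 0 ∨ coeff (n - k) g = 0) : coeff n (smulStar f g) = 0 :=
  coeff_star_eq_zero _ _ fun k hk => (h k hk).imp id fun h a => by simp [h]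

/-- The commutator with an even vector field. -/
noncomputable def adOp (v : VFun H H) : VFun H H →ₗ[ℝ] VFun H H :=
  ins v - (insL H H).flip v

theorem adOp_apply (v w : VFun H H) : adOp v w = ins v w - ins w v := rfl

/-- A field of order at least two replaces one argument by at least two. -/
theorem raises_ins {v : VFun H H} (hv : v ∈ ordGE H H 2) :
    Raises (ins v : VFun H M →ₗ[ℝ] VFun H M) := by
  intro n f hf m hm
  refine coeff_ins_eq_zero _ _ fun k hk => ?_
  by_cases h : k < 2
  · exact Or.inl (hv k h)
  · exact Or.inr (hf _ (by omega))

theorem raises_adOp {v : VFun H H} (hv : v ∈ ordGE H H 2) : Raises (adOp v) := by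
  intro n f hf
  have h1 := raises_ins hv n f hf
  have h2 : ins f v ∈ ordGE H H (n + 1) := by
    intro m hm
    refine coeff_ins_eq_zero _ _ fun k hk => ?_
    by_cases h : k < n
    · exact Or.inl (hf k h)
    · exact Or.inr (hv _ (by omega))
  rw [adOp_apply]
  exact Submodule.sub_mem _ h1 h2

theorem IsDeg.adOp {e : ℤ × ZMod 2} {v w : VFun H H} (hv : IsDeg 0 v) (hw : IsDeg e w) :
    IsDeg e (adOp v w) := by
  have h1 := hv.ins hw
  have h2 := hw.ins hv
  rw [zero_add] at h1
  rw [add_zero] at h2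
  exact h1.sub h2

theorem IsDeg.adOp_pow {e : ℤ × ZMod 2} {v w : VFun H H} (hv : IsDeg 0 v) (hw : IsDeg e w)
    (k : ℕ) : IsDeg e ((QMan.adOp v ^ k) w) := by
  induction k with
  | zero => simpa using hw
  | succ k ih => rw [pow_succ', Module.End.mul_apply]; exact hv.adOp ih

theorem ins_ins_even {e : ℤ × ZMod 2} {v w : VFun H H} (hv : IsDeg 0 v) (hw : IsDeg e w)
    (f : VFun H M) : ins v (ins w f) = ins (adOp v w) f + ins w (ins v f) := by
  rw [ins_ins hv hw f, adOp_apply]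
  simp [add_comm]

/-- The exponential of an even vector field is multiplicative. -/
theorem expOp_smulStar {v : VFun H H} (hv : IsDeg 0 v) (hv2 : v ∈ ordGE H H 2) (f : VFun H ℝ)
    (g : VFun H M) :
    expOp (ins v) (smulStar f g) = smulStar (expOp (ins v) f) (expOp (ins v) g) := by
  refine expOp_bilinear (raises_ins hv2) (raises_ins hv2) (raises_ins hv2) (smulStarL H M)
    ?_ ?_ f g ?_ ?_
  · intro n a b ha
    exact coeff_smulStar_eq_zero _ _ fun k hk => Or.inl (ha k (by omega))
  · intro n a b hb
    exact coeff_smulStar_eq_zero _ _ fun k hk => Or.inr (hb _ (by omega))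
  · intro i j
    simp only [smulStarL_apply, ins_smulStar hv, Prod.snd_zero, twist_zero, pow_succ',
      Module.End.mul_apply]
  · intro i j n hn
    refine coeff_smulStar_eq_zero _ _ fun k hk => ?_
    by_cases h : k < i
    · exact Or.inl ((raises_ins hv2).coeff_pow f h)
    · exact Or.inr ((raises_ins hv2).coeff_pow g (by omega))

/-- Conjugation of a vector field with the exponential of an even vector field. -/
theorem expOp_ins {e : ℤ × ZMod 2} {v q : VFun H H} (hv : IsDeg 0 v) (hv2 : v ∈ ordGE H H 2)
    (hq : IsDeg e q) (hq1 : q ∈ ordGE H H 1) (f : VFun H M) :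
    expOp (ins v) (ins q f) = ins (expOp (adOp v) q) (expOp (ins v) f) := by
  refine expOp_bilinear (raises_adOp hv2) (raises_ins hv2) (raises_ins hv2) (insL H M)
    ?_ ?_ q f ?_ ?_
  · intro n a b ha
    exact coeff_ins_eq_zero _ _ fun k hk => Or.inl (ha k (by omega))
  · intro n a b hb
    exact coeff_ins_eq_zero _ _ fun k hk => Or.inr (hb _ (by omega))
  · intro i j
    simp only [insL_apply, ins_ins_even hv (hv.adOp_pow hq i), pow_succ', Module.End.mul_apply]
  · intro i j n hn
    refine coeff_ins_eq_zero _ _ fun k hk => ?_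
    by_cases h : k < 1 + i
    · exact Or.inl ((raises_adOp hv2).pow hq1 i k h)
    · exact Or.inr ((raises_ins hv2).coeff_pow f (by omega))

theorem coeff_ins_of_lt {v : VFun H H} {N n : ℕ} (hv : v ∈ ordGE H H N) (h : n < N)
    (f : VFun H M) : coeff n (ins v f) = 0 :=
  coeff_ins_eq_zero _ _ fun k hk => Or.inl (hv k (by omega))

/-- Every term of the series after the zeroth lies in the image of `ins v`, hence begins at order
`N`. Later gauge transformations therefore leave low orders untouched. -/
theorem coeff_expOp_ins {v : VFun H H} {N n : ℕ} (hv : v ∈ ordGE H H N) (h : n < N)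
    (f : VFun H M) : coeff n (expOp (ins v) f) = coeff n f := by
  rw [coeff_expOp_self, expPartial_apply, map_sum, Finset.sum_eq_single 0]
  · simp
  · intro k _ hk
    obtain ⟨k, rfl⟩ := Nat.exists_eq_succ_of_ne_zero hk
    rw [map_smul, pow_succ', Module.End.mul_apply, coeff_ins_of_lt hv h, smul_zero]
  · simp

theorem adOp_mem_ordGE {v w : VFun H H} {N : ℕ} (hv : v ∈ ordGE H H N) (hw : w ∈ ordGE H H 1) :
    adOp v w ∈ ordGE H H N := by
  have h1 : ins v w ∈ ordGE H H N := fun m hm => coeff_ins_of_lt hv hm w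
  have h2 : ins w v ∈ ordGE H H N := by
    intro m hm
    refine coeff_ins_eq_zero _ _ fun k hk => ?_
    by_cases h : k < 1
    · exact Or.inl (hw k h)
    · exact Or.inr (hv _ (by omega))
  rw [adOp_apply]
  exact Submodule.sub_mem _ h1 h2

/-- One commutator with `v` reaches order `N`; a second one raises the order again, because `v`
begins at order two or higher. Up to order `N` only the part linear in `v` survives. -/
theorem coeff_expOp_adOp {v q : VFun H H} {N n : ℕ} (hv : v ∈ ordGE H H N) (hN : 2 ≤ N)
    (hq : q ∈ ordGE H H 1) (h : n ≤ N) :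
    coeff n (expOp (adOp v) q) = coeff n q + coeff n (adOp v q) := by
  have hR := raises_adOp (ordGE_mono hN hv)
  rw [coeff_expOp hR q (by omega : n ≤ N + 1), expPartial_apply, map_sum, Finset.sum_range_succ',
    Finset.sum_range_succ', Finset.sum_eq_zero, zero_add, add_comm]
  · simp
  · intro k _
    have h1 : (adOp v ^ k) q ∈ ordGE H H 1 := ordGE_mono (by omega) (hR.pow hq k)
    have h2 := adOp_mem_ordGE hv h1
    rw [map_smul, pow_succ', pow_succ', Module.End.mul_apply, Module.End.mul_apply]
    rw [hR N _ h2 n (by omega), smul_zero]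

theorem HasDeg.ins_even {𝒟 : ℤ × ZMod 2 → Submodule ℝ M} {f : VFun H M} (hf : HasDeg 𝒟 f)
    {v : VFun H H} (hv : IsDeg 0 v) : HasDeg 𝒟 (QMan.ins v f) := by
  have h := hf.ins hv
  simpa only [add_zero] using h

theorem HasDeg.expOp {𝒟 : ℤ × ZMod 2 → Submodule ℝ M} {X : VFun H M →ₗ[ℝ] VFun H M}
    (hX : ∀ f, HasDeg 𝒟 f → HasDeg 𝒟 (X f)) {f : VFun H M} (hf : HasDeg 𝒟 f) :
    HasDeg 𝒟 (QMan.expOp X f) := by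
  have hpow : ∀ k, HasDeg 𝒟 ((X ^ k) f) := by
    intro k
    induction k with
    | zero => simpa using hf
    | succ k ih => rw [pow_succ', Module.End.mul_apply]; exact hX _ ih
  intro n d x hx
  rw [coeff_expOp_self, expPartial_apply, map_sum, sum_apply]
  exact Submodule.sum_mem _ fun k _ => (hpow k).smul _ n d x hx

theorem expOp_of_eq_zero {X : VFun H M →ₗ[ℝ] VFun H M} {f : VFun H M} (h : X f = 0) :
    expOp X f = f := by
  refine vfun_ext fun n => ?_
  rw [coeff_expOp_self, expPartial_apply, map_sum, Finset.sum_eq_single 0]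
  · simp
  · intro k _ hk
    obtain ⟨k, rfl⟩ := Nat.exists_eq_succ_of_ne_zero hk
    rw [pow_succ, Module.End.mul_apply, h, map_zero, smul_zero, map_zero]
  · simp

/-- The square of an odd vector field. -/
theorem ins_ins_odd {q : VFun H H} (hq : IsDeg (1, 1) q) (h : ins q q = 0) (f : VFun H M) :
    ins q (ins q f) = 0 := by
  have h1 := ins_ins hq hq f
  rw [h] at h1
  simp only [sg_one_one, smul_zero, sub_zero, ins_zero, add_zero] at h1
  -- For an odd field with `ins q q = 0` the commutator formula says that the square of the operator
  -- equals its own negative.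
  calc ins q (ins q f) = (2⁻¹ : ℝ) • (ins q (ins q f) - (-1 : ℝ) • ins q (ins q f)) := by module
    _ = 0 := by rw [← h1, sub_self, smul_zero]

/-- The exponential of an even vector field preserves homological vector fields. -/
theorem ins_expOp_adOp_self {v q : VFun H H} (hv : IsDeg 0 v) (hv2 : v ∈ ordGE H H 2)
    (hq : IsDeg (1, 1) q) (hq1 : q ∈ ordGE H H 1) (h : ins q q = 0) :
    ins (expOp (adOp v) q) (expOp (adOp v) q) = 0 := by
  set q' := expOp (adOp v) q
  have h1 : ins q' (ins q' (linF LinearMap.id)) = 0 := by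
    -- The exponential is onto, so the identity function is the image of some `g`. Conjugation then
    -- moves the square of the new field to the square of `q` acting on `g`.
    obtain ⟨g, hg⟩ : ∃ g, linF LinearMap.id = expOp (ins v) g :=
      ⟨_, (expOp_expOp_neg (raises_ins hv2) _).symm⟩
    rw [hg, ← expOp_ins hv hv2 hq hq1, ← expOp_ins hv hv2 hq hq1, ins_ins_odd hq h, map_zero]
  rwa [ins_linF_id] at h1

end QMan

namespace QMan

variable {H : GrSpace.{u}} {M M' M'' : Type*} [AddCommGroup M] [Module ℝ M]
  [AddCommGroup M'] [Module ℝ M'] [AddCommGroup M''] [Module ℝ M'']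

/-! ### Linear vector fields -/

theorem coeff_dd_linF_succ (φ : H →ₗ[ℝ] M) (y : H) (n : ℕ) :
    coeff (n + 1) (dd (linF φ) y) = 0 := by
  ext x
  rw [coeff_dd, coeff_linF_of_ne φ (by omega)]
  rfl

theorem twist_dd_linF (δ : ZMod 2) (φ : H →ₗ[ℝ] M) (y : H) :
    twist δ (dd (linF φ) y) = dd (linF φ) y := by
  refine vfun_ext fun n => ?_
  cases n with
  | zero => exact coeff_zero_twist _ _
  | succ n =>
    rw [coeff_dd_linF_succ]
    refine multilinear_ext_hom fun d x hx => ?_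
    rw [twist_apply _ _ hx, coeff_dd_linF_succ]
    simp

theorem star_zero_left (G : M →ₗ[ℝ] VFun H M') : star (0 : VFun H M) G = 0 := by
  simpa using star_smul_left 0 (0 : VFun H M) G

theorem star_dd_linF (φ : H →ₗ[ℝ] M) (y : H) (G : M →ₗ[ℝ] VFun H M') :
    star (dd (linF φ) y) G = G (φ y) := by
  refine vfun_ext fun n => ?_
  induction n generalizing G with
  | zero => rw [coeff_zero_star, coeff_dd, coeff_linF_one, Fin.cons_zero]
  | succ n ih =>
    refine coeff_succ_eq fun d z hz => ?_
    rw [dd_star _ _ hz, dd_dd_linF, star_zero_left, zero_add, twist_dd_linF, ih]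
    rfl

theorem isDeg_linF {φ : H →ₗ[ℝ] H} {e : ℤ × ZMod 2} (hφ : ∀ d, ∀ x ∈ H.gr d, φ x ∈ H.gr (d + e)) :
    IsDeg e (linF φ) := by
  rintro (_ | _ | n) d x hx
  · exact Submodule.zero_mem _
  · simpa using hφ _ _ (hx 0)
  · exact Submodule.zero_mem _

/-- For an even linear field the commutation rule carries no sign, so it is linear in the direction
and holds for inhomogeneous vectors too. The decompositions into P- and N-parts below need this
generality. -/
theorem dd_ins_linF {φ : H →ₗ[ℝ] H} (hφ : ∀ d, ∀ x ∈ H.gr d, φ x ∈ H.gr d) (f : VFun H M)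
    (y : H) : dd (ins (linF φ) f) y = dd f (φ y) + ins (linF φ) (dd f y) := by
  have h : dd (ins (linF φ) f) = (dd f).comp φ + (ins (linF φ)).comp (dd f) := by
    refine linear_ext_hom fun d z hz => ?_
    rw [dd_ins (e := 0) (isDeg_linF fun d x hx => by simpa using hφ d x hx) _ hz, ins_apply,
      star_dd_linF]
    simp
  rw [h]
  rfl

theorem coeff_ins_linF_congr {φ ψ : H →ₗ[ℝ] H} (hφ : ∀ d, ∀ x ∈ H.gr d, φ x ∈ H.gr d)
    (hψ : ∀ d, ∀ x ∈ H.gr d, ψ x ∈ H.gr d) {n : ℕ} {x : Fin n → H}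
    (h : ∀ i, φ (x i) = ψ (x i)) (f : VFun H M) :
    coeff n (ins (linF φ) f) x = coeff n (ins (linF ψ) f) x := by
  induction n generalizing f with
  | zero => rw [coeff_zero_ins, coeff_zero_ins, coeff_linF_of_ne _ (by omega),
      coeff_linF_of_ne _ (by omega)]
  | succ n ih =>
    obtain ⟨y, z, rfl⟩ : ∃ y z, x = Fin.cons y z := ⟨x 0, Fin.tail x, (Fin.cons_self_tail x).symm⟩
    rw [← coeff_dd, ← coeff_dd, dd_ins_linF hφ, dd_ins_linF hψ, map_add, map_add, add_apply,
      add_apply, ih (fun i => by simpa using h i.succ)]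
    congr 3
    have := h 0
    simp only [Fin.cons_zero] at this
    rw [this]

/-- A linear field acts as a derivation on the arguments, so eigenvalues add up. For `C.N` the sum
counts the arguments in the complement of the image of `C.P`. -/
theorem coeff_ins_linF_eigen {φ : H →ₗ[ℝ] H} (hφ : ∀ d, ∀ x ∈ H.gr d, φ x ∈ H.gr d) {n : ℕ}
    {x : Fin n → H} {s : Fin n → ℝ} (h : ∀ i, φ (x i) = s i • x i) (f : VFun H M) :
    coeff n (ins (linF φ) f) x = (∑ i, s i) • coeff n f x := by
  induction n generalizing f with
  | zero => rw [coeff_zero_ins, coeff_linF_of_ne _ (by omega)]; simp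
  | succ n ih =>
    obtain ⟨y, z, rfl⟩ : ∃ y z, x = Fin.cons y z := ⟨x 0, Fin.tail x, (Fin.cons_self_tail x).symm⟩
    have h0 := h 0
    rw [Fin.cons_zero] at h0
    rw [← coeff_dd, dd_ins_linF hφ, map_add, add_apply, ih (s := fun i => s i.succ)
      (fun i => by simpa using h i.succ), h0, map_smul, map_smul, smul_apply, Fin.sum_univ_succ,
      add_smul]
    rfl

theorem precomp_ins_linF {χ : H →ₗ[ℝ] H} (hχ : ∀ d, ∀ x ∈ H.gr d, χ x ∈ H.gr d) {φ : H →ₗ[ℝ] H}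
    (h : φ.comp χ = 0) (f : VFun H M) : precomp χ hχ (ins (linF φ) f) = 0 := by
  rw [ins_apply, precomp_star]
  have : precomp χ hχ (linF φ) = 0 := by
    refine vfun_ext fun n => ?_
    ext x
    rw [coeff_precomp]
    by_cases hn : n = 1
    · subst hn
      rw [coeff_linF_one]
      exact LinearMap.congr_fun h (x 0)
    · rw [coeff_linF_of_ne _ hn]
      rfl
  rw [this, star_zero_left]

/-! ### Contractions -/

/-- A homotopy equivalence of a complex with its cohomology, realised by a projection `P` and a
homotopy `h`. -/
structure Contraction (H : GrSpace.{u}) where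
  D : H →ₗ[ℝ] H
  h : H →ₗ[ℝ] H
  P : H →ₗ[ℝ] H
  deg_D : ∀ d, ∀ x ∈ H.gr d, D x ∈ H.gr (d + (1, 1))
  deg_h : ∀ d, ∀ x ∈ H.gr d, h x ∈ H.gr (d + (-1, -1))
  deg_P : ∀ d, ∀ x ∈ H.gr d, P x ∈ H.gr d
  homotopy : ∀ x, D (h x) + h (D x) = x - P x
  DD : ∀ x, D (D x) = 0
  hh : ∀ x, h (h x) = 0
  PD : ∀ x, P (D x) = 0
  DP : ∀ x, D (P x) = 0
  hP : ∀ x, h (P x) = 0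
  PP : ∀ x, P (P x) = P x

namespace Contraction

variable (C : Contraction H)

/-- The projection complementary to `P`. -/
def N : H →ₗ[ℝ] H := LinearMap.id - C.P

theorem N_apply (x : H) : C.N x = x - C.P x := rfl

theorem deg_N (d : ℤ × ZMod 2) (x : H) (hx : x ∈ H.gr d) : C.N x ∈ H.gr d :=
  Submodule.sub_mem _ hx (C.deg_P d x hx)

/-- Successive removal of the parts of `f` that depend on `k` arguments outside the image
of `P`. -/
noncomputable def red (f : VFun H M) : ℕ → VFun H M
  | 0 => f
  | k + 1 => red f k - ((k : ℝ) + 1)⁻¹ • ins (linF C.N) (red f k)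

theorem red_succ (f : VFun H M) (k : ℕ) :
    C.red f (k + 1) = C.red f k - ((k : ℝ) + 1)⁻¹ • ins (linF C.N) (C.red f k) := rfl

theorem coeff_red_eigen {n : ℕ} {x : Fin n → H} {s : Fin n → ℝ}
    (h : ∀ i, C.N (x i) = s i • x i) (f : VFun H M) (k : ℕ) :
    coeff n (C.red f k) x
      = (∏ j ∈ Finset.range k, (1 - ((j : ℝ) + 1)⁻¹ * ∑ i, s i)) • coeff n f x := by
  induction k with
  | zero => simp [red]
  | succ k ih =>
    rw [red_succ, map_sub, map_smul, sub_apply, smul_apply, coeff_ins_linF_eigen C.deg_N h, ih,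
      Finset.prod_range_succ]
    module

/-- Each argument is split into its P-part and its N-part. On a term with s arguments of the second
kind the operator multiplies by ∏_{j<n} (1 - s/(j+1)), which is 1 for s = 0 and contains a zero
factor for 1 ≤ s ≤ n. -/
theorem coeff_red (f : VFun H M) (n : ℕ) (x : Fin n → H) :
    coeff n (C.red f n) x = coeff n f (fun i => C.P (x i)) := by
  classical
  have hsum : x = (fun i => C.P (x i)) + fun i => C.N (x i) := by
    funext i
    simp [N_apply]
  have hP : (fun i => C.P (x i)) = (fun i => C.P (C.P (x i))) + fun i => C.P (C.N (x i)) := by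
    funext i
    simp [N_apply, C.PP]
  rw [hP, MultilinearMap.map_add_univ]
  conv_lhs => rw [hsum]
  rw [MultilinearMap.map_add_univ]
  refine Finset.sum_congr rfl fun S _ => ?_
  have hs : ∀ i, C.N (S.piecewise (fun i => C.P (x i)) (fun i => C.N (x i)) i)
      = (if i ∈ S then (0 : ℝ) else 1) • S.piecewise (fun i => C.P (x i)) (fun i => C.N (x i)) i := by
    intro i
    by_cases hi : i ∈ S <;> simp [hi, N_apply, C.PP]
  rw [C.coeff_red_eigen hs]
  by_cases hS : S = Finset.univ
  · subst hS
    simp [C.PP]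
  · obtain ⟨a, ha⟩ : ∃ a, a ∉ S := by
      by_contra! h
      exact hS (Finset.eq_univ_iff_forall.2 h)
    have h1 : (∑ i, if i ∈ S then (0 : ℝ) else 1) = ((Finset.univ.filter (· ∉ S)).card : ℝ) := by
      rw [Finset.card_filter]
      push_cast
      exact Finset.sum_congr rfl fun i _ => by by_cases hi : i ∈ S <;> simp [hi]
    have h2 : 0 < (Finset.univ.filter (· ∉ S)).card :=
      Finset.card_pos.2 ⟨a, by simpa using ha⟩
    have h3 : (Finset.univ.filter (· ∉ S)).card ≤ n := by
      simpa using Finset.card_le_univ (Finset.univ.filter (· ∉ S))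
    -- The vanishing factor is the one with index j = s - 1, where s is the number of arguments
    -- taken from the N-part.
    rw [h1, Finset.prod_eq_zero (i := (Finset.univ.filter (· ∉ S)).card - 1), zero_smul,
      MultilinearMap.map_coord_zero _ a]
    · simp [ha, N_apply, C.PP]
    · simp only [Finset.mem_range]; omega
    · have h4 : (((Finset.univ.filter (· ∉ S)).card - 1 : ℕ) : ℝ) + 1
          = ((Finset.univ.filter (· ∉ S)).card : ℝ) := by
        exact_mod_cast Nat.sub_add_cancel h2
      rw [h4, inv_mul_cancel₀ (Nat.cast_ne_zero.2 h2.ne'), sub_self]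

theorem postcomp_red (φ : M →ₗ[ℝ] M') (f : VFun H M) (k : ℕ) :
    postcomp φ (C.red f k) = C.red (postcomp φ f) k := by
  induction k with
  | zero => rfl
  | succ k ih => rw [red_succ, red_succ, map_sub, map_smul, postcomp_ins, ih]

theorem red_zero (k : ℕ) : C.red (0 : VFun H M) k = 0 := by
  induction k with
  | zero => rfl
  | succ k ih => rw [red_succ, ih, map_zero, smul_zero, sub_zero]

theorem isDeg_D : IsDeg (1, 1) (linF C.D) := isDeg_linF C.deg_D

theorem isDeg_h : IsDeg (-1, -1) (linF C.h) := isDeg_linF C.deg_h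

theorem isDeg_N : IsDeg 0 (linF C.N) := isDeg_linF fun d x hx => by simpa using C.deg_N d x hx

theorem ins_D_D : ins (linF C.D) (linF C.D) = 0 := by
  rw [ins_linF]
  refine vfun_ext fun n => ?_
  ext x
  rw [coeff_postcomp]
  by_cases hn : n = 1
  · subst hn
    rw [coeff_linF_one, C.DD]
    rfl
  · rw [coeff_linF_of_ne _ hn]
    simp

theorem ins_D_ins_D (f : VFun H M) : ins (linF C.D) (ins (linF C.D) f) = 0 :=
  ins_ins_odd C.isDeg_D C.ins_D_D f

/-- The homotopy identity of the complex lifts to functions: for the two odd linear fields the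
graded commutator is the field of D h + h D = N. -/
theorem ins_D_ins_h (f : VFun H M) : ins (linF C.D) (ins (linF C.h) f)
    = ins (linF C.N) f - ins (linF C.h) (ins (linF C.D) f) := by
  rw [ins_ins C.isDeg_D C.isDeg_h f]
  have h1 : sg (1, 1).2 (-1, -1).2 = -1 := by
    change sg 1 (-1) = -1
    rw [show (-1 : ZMod 2) = 1 from rfl, sg_one_one]
  have h2 : ins (linF C.D) (linF C.h) - (-1 : ℝ) • ins (linF C.h) (linF C.D) = linF C.N := by
    rw [ins_linF, ins_linF]
    refine vfun_ext fun n => ?_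
    ext x
    rw [map_sub, map_smul, sub_apply, smul_apply, coeff_postcomp, coeff_postcomp]
    by_cases hn : n = 1
    · subst hn
      rw [coeff_linF_one, coeff_linF_one, coeff_linF_one, N_apply, ← C.homotopy]
      module
    · rw [coeff_linF_of_ne _ hn, coeff_linF_of_ne _ hn, coeff_linF_of_ne _ hn]
      simp
  rw [h1, h2]
  module

theorem ins_D_red {f : VFun H M} (hf : ins (linF C.D) f = 0) (k : ℕ) :
    ins (linF C.D) (C.red f k) = 0 := by
  induction k with
  | zero => exact hf
  | succ k ih =>
    have h1 := C.ins_D_ins_h (C.red f k)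
    rw [ih, map_zero, sub_zero] at h1
    rw [red_succ, ← h1, map_sub, map_smul, C.ins_D_ins_D, ih, smul_zero, sub_zero]

/-- The primitive of `f - red f k`. -/
noncomputable def prim (f : VFun H M) (k : ℕ) : VFun H M :=
  ∑ j ∈ Finset.range k, ((j : ℝ) + 1)⁻¹ • ins (linF C.h) (C.red f j)

/-- On closed functions D after h acts as N, so the image of each summand is the difference of two
consecutive reductions, and the sum telescopes. -/
theorem ins_D_prim {f : VFun H M} (hf : ins (linF C.D) f = 0) (k : ℕ) :
    ins (linF C.D) (C.prim f k) = f - C.red f k := by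
  induction k with
  | zero => simp [prim, red]
  | succ k ih =>
    rw [prim, Finset.sum_range_succ, map_add, ← prim, ih, map_smul, C.ins_D_ins_h,
      C.ins_D_red hf, map_zero, sub_zero, red_succ]
    abel

theorem postcomp_prim (φ : M →ₗ[ℝ] M') (f : VFun H M) (k : ℕ) :
    postcomp φ (C.prim f k) = C.prim (postcomp φ f) k := by
  simp only [prim, map_sum, map_smul, postcomp_ins, postcomp_red]

theorem prim_zero (k : ℕ) : C.prim (0 : VFun H M) k = 0 := by
  simp [prim, red_zero]

theorem ins_linF_mem_ordGE (φ : H →ₗ[ℝ] H) {f : VFun H M} {n : ℕ} (hf : f ∈ ordGE H M n) :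
    ins (linF φ) f ∈ ordGE H M n := by
  intro m hm
  refine coeff_ins_eq_zero _ _ fun k hk => ?_
  by_cases h : k = 1
  · exact Or.inr (hf _ (by omega))
  · exact Or.inl (coeff_linF_of_ne _ h)

theorem red_mem_ordGE {f : VFun H M} {n : ℕ} (hf : f ∈ ordGE H M n) (k : ℕ) :
    C.red f k ∈ ordGE H M n := by
  induction k with
  | zero => exact hf
  | succ k ih =>
    rw [red_succ]
    exact Submodule.sub_mem _ ih (Submodule.smul_mem _ _ (ins_linF_mem_ordGE _ ih))

theorem prim_mem_ordGE {f : VFun H M} {n : ℕ} (hf : f ∈ ordGE H M n) (k : ℕ) :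
    C.prim f k ∈ ordGE H M n :=
  Submodule.sum_mem _ fun j _ =>
    Submodule.smul_mem _ _ (ins_linF_mem_ordGE _ (C.red_mem_ordGE hf j))

theorem isDeg_red {f : VFun H H} {e : ℤ × ZMod 2} (hf : IsDeg e f) (k : ℕ) :
    IsDeg e (C.red f k) := by
  induction k with
  | zero => exact hf
  | succ k ih =>
    have h := C.isDeg_N.ins ih
    rw [zero_add] at h
    exact ih.sub (h.smul _)

theorem isDeg_prim {f : VFun H H} (hf : IsDeg (1, 1) f) (k : ℕ) : IsDeg 0 (C.prim f k) := by
  induction k with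
  | zero =>
    intro n d x hx
    simp [prim]
  | succ k ih =>
    rw [prim, Finset.sum_range_succ, ← prim]
    exact ih.add ((C.isDeg_h.ins (C.isDeg_red hf k)).smul _)

end Contraction

end QMan

/-! ### The induction step: normalizing one further order. -/

namespace QMan

variable {H : GrSpace.{u}} {M M' M'' : Type*} [AddCommGroup M] [Module ℝ M]
  [AddCommGroup M'] [Module ℝ M'] [AddCommGroup M''] [Module ℝ M'']

/-- The homogeneous component of order `m` of a formal function. -/
noncomputable def hcomp (m : ℕ) (f : VFun H M) : VFun H M :=
  ⟨fun n => if n = m then coeff n f else 0, fun n => by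
    dsimp only
    split_ifs
    · exact coeff_symm n f
    · intro d x hx σ; simp⟩

theorem coeff_hcomp_self (m : ℕ) (f : VFun H M) : coeff m (hcomp m f) = coeff m f := if_pos rfl

theorem coeff_hcomp_of_ne {m n : ℕ} (f : VFun H M) (h : n ≠ m) : coeff n (hcomp m f) = 0 :=
  if_neg h

theorem HasDeg.hcomp {𝒟 : ℤ × ZMod 2 → Submodule ℝ M} {f : VFun H M} (hf : HasDeg 𝒟 f) (m : ℕ) :
    HasDeg 𝒟 (QMan.hcomp m f) := by
  intro n d x hx
  by_cases h : n = m
  · subst h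
    rw [coeff_hcomp_self]
    exact hf n d x hx
  · rw [coeff_hcomp_of_ne f h]
    exact Submodule.zero_mem _

theorem ins_self_sub_ins_self (s t : VFun H H) :
    ins s s - ins t t = ins (s - t) s + ins t (s - t) := by
  rw [ins_sub, map_sub]; abel

theorem ins_commutator_sub (v q t : VFun H H) :
    ins v q - ins q v - (ins v t - ins t v) = ins v (q - t) - ins (q - t) v := by
  rw [map_sub, ins_sub]; abel

theorem hcomp_mem_ordGE (m : ℕ) (f : VFun H M) : hcomp m f ∈ ordGE H M m :=
  fun _ hk => coeff_hcomp_of_ne f hk.ne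

theorem coeff_ins_linF_of_coeff_eq_zero (φ : H →ₗ[ℝ] H) {f : VFun H M} {n : ℕ}
    (hf : coeff n f = 0) : coeff n (ins (linF φ) f) = 0 := by
  refine coeff_ins_eq_zero _ _ fun k hk => ?_
  by_cases h : k = 1
  · subst h
    rw [show n - 1 + 1 = n by omega]
    exact Or.inr hf
  · exact Or.inl (coeff_linF_of_ne _ h)

namespace Contraction

variable (C : Contraction H)

/-- The homological vector field `q` has linear part `D`, and up to order `n` its nonlinear part
is a vector field on the image of `P`. -/
structure Good (n : ℕ) (q : VFun H H) : Prop where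
  deg : IsDeg (1, 1) q
  zero : coeff 0 q = 0
  one : coeff 1 q = coeff 1 (linF C.D)
  sq : ins q q = 0
  normal : ∀ m, 2 ≤ m → m ≤ n → ∀ x, coeff m q x = C.P (coeff m q (fun i => C.P (x i)))

/-- Even vector fields of order greater than `n` with values in the kernel of `h`. -/
structure Gauge (n : ℕ) (v : VFun H H) : Prop where
  deg : IsDeg 0 v
  ord : v ∈ ordGE H H (n + 1)
  h_comp : postcomp C.h v = 0

variable {C}

theorem Good.mem_ordGE_one {n : ℕ} {q : VFun H H} (hq : C.Good n q) : q ∈ ordGE H H 1 := by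
  intro m hm
  obtain rfl : m = 0 := by omega
  exact hq.zero

/-- The first component that is not in normal form is a cocycle. -/
theorem Good.cocycle {n : ℕ} {q : VFun H H} (hq : C.Good n q) (hn : 1 ≤ n) :
    ins (linF C.D) (hcomp (n + 1) q) = - postcomp C.D (hcomp (n + 1) q) := by
  set u := hcomp (n + 1) q with hu
  set s := q - linF C.D with hs
  set s' := postcomp C.P (precomp C.P C.deg_P s) with hs'
  have hqs : q = linF C.D + s := by rw [hs]; abel
  have hs2 : s ∈ ordGE H H 2 := by
    intro m hm
    rw [hs, map_sub]
    rcases (by omega : m = 0 ∨ m = 1) with rfl | rfl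
    · rw [hq.zero, coeff_linF_of_ne _ (by omega), sub_zero]
    · rw [hq.one, sub_self]
  have hsq : ∀ m, 2 ≤ m → coeff m s = coeff m q := by
    intro m hm
    rw [hs, map_sub, coeff_linF_of_ne _ (by omega), sub_zero]
  have hs'2 : s' ∈ ordGE H H 2 := by
    intro m hm
    ext x
    rw [hs', coeff_postcomp, coeff_precomp, hs2 m hm]
    simp
  have hss : s - s' ∈ ordGE H H (n + 1) := by
    intro m hm
    rw [map_sub]
    by_cases h : m < 2
    · rw [hs2 m h, hs'2 m h, sub_zero]
    · ext x
      rw [sub_apply, hs', coeff_postcomp, coeff_precomp, hsq m (by omega),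
        hq.normal m (by omega) (by omega) x, sub_self]
      rfl
  -- In the quadratic term of order `n + 1` the orders of the two factors add up to `n + 2`. Both
  -- are at least two, hence at most `n`, where the nonlinear part `s` agrees with its projection
  -- `s'`.
  have hR : coeff (n + 1) (ins s s) = coeff (n + 1) (ins s' s') := by
    rw [← sub_eq_zero, ← map_sub, ins_self_sub_ins_self, map_add, coeff_ins_eq_zero (s - s') s, coeff_ins_eq_zero,
      add_zero]
    · intro k hk
      by_cases h : k < 2
      · exact Or.inl (hs'2 k h)
      · exact Or.inr (hss _ (by omega))
    · intro k hk
      by_cases h : k < n + 1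
      · exact Or.inl (hss k h)
      · exact Or.inr (hs2 _ (by omega))
  have hP1 : postcomp C.P s' = s' := by
    refine vfun_ext fun m => ?_
    ext x
    simp [hs', C.PP]
  have hP2 : precomp C.P C.deg_P s' = s' := by
    refine vfun_ext fun m => ?_
    ext x
    simp [hs', C.PP]
  have hP3 : precomp C.P C.deg_P (ins s' s') = ins s' s' := by
    rw [ins_apply, precomp_star, hP2]
    congr 1
    refine LinearMap.ext fun y => vfun_ext fun m => ?_
    ext x
    rw [LinearMap.comp_apply, coeff_precomp, coeff_dd, coeff_dd, hs']
    simp only [coeff_postcomp, coeff_precomp]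
    congr 2
    funext i
    refine Fin.cases ?_ (fun j => ?_) i <;> simp [C.PP]
  have hP4 : postcomp C.P (precomp C.P C.deg_P (ins s' s')) = ins s' s' := by
    rw [hP3, postcomp_ins, hP1]
  have hmain : ins (linF C.D) s + postcomp C.D s + ins s s = 0 := by
    have h1 := hq.sq
    rw [hqs, ins_add, map_add, map_add, C.ins_D_D, ins_linF, zero_add, ← add_assoc] at h1
    exact h1
  have hsu : coeff (n + 1) (ins (linF C.D) s) = coeff (n + 1) (ins (linF C.D) u) := by
    rw [← sub_eq_zero, ← map_sub, ← map_sub]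
    refine coeff_ins_linF_of_coeff_eq_zero _ ?_
    rw [map_sub, hu, coeff_hcomp_self, hsq _ (by omega), sub_self]
  -- Projecting arguments and values with `C.P` kills both terms containing D, by D P = 0 and P D =
  -- 0, and leaves the quadratic term of `s'` unchanged.
  have hR0 : coeff (n + 1) (ins s' s') = 0 := by
    have h1 := congrArg (fun f => coeff (n + 1) (postcomp C.P (precomp C.P C.deg_P f))) hmain
    simp only [map_add, map_zero] at h1
    have h2 : postcomp C.P (precomp C.P C.deg_P (postcomp C.D s)) = 0 := by
      refine vfun_ext fun m => ?_
      ext x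
      simp [C.PD]
    rw [precomp_ins_linF C.deg_P (LinearMap.ext fun x => C.DP x), h2, map_zero, map_zero, zero_add,
      zero_add] at h1
    rw [← hP4]
    ext x
    have h3 := congrArg (fun t => t x) h1
    have h4 := congrArg (fun t => C.P (t (fun i => C.P (x i)))) hR
    simp only [coeff_postcomp, coeff_precomp] at h3 h4 ⊢
    rw [← h4, h3]
  refine vfun_ext fun m => ?_
  by_cases hm : m = n + 1
  · subst hm
    have h1 := congrArg (coeff (n + 1)) hmain
    rw [map_add, map_add, hR, hR0, add_zero, hsu, map_zero] at h1
    rw [map_neg, eq_neg_iff_add_eq_zero, ← h1]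
    congr 1
    ext x
    rw [coeff_postcomp, coeff_postcomp, hu, coeff_hcomp_self, hsq _ (by omega)]
  · rw [coeff_ins_linF_of_coeff_eq_zero _ (coeff_hcomp_of_ne q hm)]
    ext x
    rw [map_neg, neg_apply, coeff_postcomp, hu, coeff_hcomp_of_ne q hm]
    simp

theorem isDeg_postcomp {e e' : ℤ × ZMod 2} {φ : H →ₗ[ℝ] H}
    (hφ : ∀ d, ∀ x ∈ H.gr d, φ x ∈ H.gr (d + e')) {v : VFun H H} (hv : IsDeg e v) :
    IsDeg (e + e') (postcomp φ v) := by
  intro n d x hx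
  have h := hφ _ _ (hv n d x hx)
  rw [coeff_postcomp]
  simpa only [add_assoc] using h

/-- At order n+1 conjugation with exp(v) adds D v - `ins D` v to the component u. The part -h u of v
replaces u by r = P u through the homotopy identity and the cocycle equation; the part `prim r` then
replaces r by its restriction to arguments in the image of P. Both parts have values in the kernel
of h, by h h = 0 and h P = 0. -/
theorem Good.exists_gauge {n : ℕ} {q : VFun H H} (hq : C.Good n q) (hn : 1 ≤ n) :
    ∃ v, C.Gauge n v ∧ C.Good (n + 1) (expOp (adOp v) q) := by
  set u := hcomp (n + 1) q with hu
  have hcoc := hq.cocycle hn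
  rw [← hu] at hcoc
  have hudeg : IsDeg (1, 1) u := HasDeg.hcomp hq.deg _
  have huord : u ∈ ordGE H H (n + 1) := hcomp_mem_ordGE _ _
  set r := postcomp C.P u with hr
  have hrdeg : IsDeg (1, 1) r := by
    have h := isDeg_postcomp (e' := 0) (fun d x hx => by simpa using C.deg_P d x hx) hudeg
    simpa using h
  have hpc : ∀ (φ : H →ₗ[ℝ] H) (w : VFun H H), w ∈ ordGE H H (n + 1) →
      postcomp φ w ∈ ordGE H H (n + 1) := by
    intro φ w hw m hm
    ext x
    rw [coeff_postcomp, hw m hm]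
    simp
  have hDr : postcomp C.D r = 0 := vfun_ext fun m => by
    ext x; simp [hr, C.DP]
  have hhr : postcomp C.h r = 0 := vfun_ext fun m => by
    ext x; simp [hr, C.hP]
  have hrcl : ins (linF C.D) r = 0 := by
    rw [hr, ← postcomp_ins, hcoc]
    exact vfun_ext fun m => by ext x; simp [C.PD]
  set v := C.prim r (n + 1) - postcomp C.h u with hv
  have hvord : v ∈ ordGE H H (n + 1) :=
    Submodule.sub_mem _ (C.prim_mem_ordGE (hpc _ _ huord) _) (hpc _ _ huord)
  have hvdeg : IsDeg 0 v := by
    have h := isDeg_postcomp C.deg_h hudeg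
    rw [show ((1, 1) + (-1, -1) : ℤ × ZMod 2) = 0 from rfl] at h
    exact (C.isDeg_prim hrdeg _).sub h
  have hvh : postcomp C.h v = 0 := by
    rw [hv, map_sub, C.postcomp_prim, hhr, prim_zero, zero_sub, neg_eq_zero]
    exact vfun_ext fun m => by ext x; simp [C.hh]
  have hq1 := hq.mem_ordGE_one
  have hv2 : v ∈ ordGE H H 2 := ordGE_mono (by omega) hvord
  have hlow : ∀ m ≤ n, coeff m (expOp (adOp v) q) = coeff m q := by
    intro m hm
    rw [coeff_expOp_adOp hvord (by omega) hq1 (by omega), adOp_mem_ordGE hvord hq1 m (by omega),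
      add_zero]
  -- Since `v` begins at order `n + 1`, the nonlinear part of `q` enters its commutator with `v`
  -- only in higher orders.
  have hqD : coeff (n + 1) (adOp v q) = coeff (n + 1) (postcomp C.D v - ins (linF C.D) v) := by
    rw [adOp_apply, ← ins_linF v C.D, ← sub_eq_zero, ← map_sub]
    rw [ins_commutator_sub, map_sub, coeff_ins_eq_zero v, coeff_ins_eq_zero _ v, sub_zero]
    · intro k hk
      by_cases h : k < 2
      · left
        rw [map_sub]
        rcases (by omega : k = 0 ∨ k = 1) with rfl | rfl
        · rw [hq.zero, coeff_linF_of_ne _ (by omega), sub_zero]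
        · rw [hq.one, sub_self]
      · exact Or.inr (hvord _ (by omega))
    · intro k hk
      by_cases h : k < n + 1
      · exact Or.inl (hvord k h)
      · right
        obtain rfl : k = n + 1 := by omega
        rw [map_sub, Nat.sub_self, hq.one, sub_self]
  have hnew : coeff (n + 1) (expOp (adOp v) q) = coeff (n + 1) (C.red r (n + 1)) := by
    have h1 : postcomp C.D v - ins (linF C.D) v = C.red r (n + 1) - u := by
      rw [hv, map_sub, C.postcomp_prim, hDr, prim_zero, map_sub, C.ins_D_prim hrcl, ← postcomp_ins,
        hcoc, map_neg]
      have h2 : postcomp C.D (postcomp C.h u) + postcomp C.h (postcomp C.D u) = u - r :=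
        vfun_ext fun m => by ext x; simp [hr, C.homotopy]
      rw [zero_sub, ← sub_eq_zero]
      rw [← sub_eq_zero] at h2
      rw [← neg_eq_zero, ← h2]
      abel
    rw [coeff_expOp_adOp hvord (by omega) hq1 le_rfl, hqD, h1, map_sub, hu, coeff_hcomp_self]
    abel
  refine ⟨v, ⟨hvdeg, hvord, hvh⟩, ?_⟩
  refine ⟨HasDeg.expOp (fun f hf => hvdeg.adOp hf) hq.deg, ?_, ?_,
    ins_expOp_adOp_self hvdeg hv2 hq.deg hq1 hq.sq, ?_⟩
  · rw [hlow 0 (by omega), hq.zero]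
  · rw [hlow 1 (by omega), hq.one]
  · intro m hm2 hmn x
    by_cases h : m ≤ n
    · rw [hlow m h]
      exact hq.normal m hm2 h x
    · obtain rfl : m = n + 1 := by omega
      rw [hnew, C.coeff_red, C.coeff_red, hr]
      simp only [coeff_postcomp, C.PP]

end Contraction

end QMan

namespace QMan

variable {H : GrSpace.{u}} {M M' M'' : Type*} [AddCommGroup M] [Module ℝ M]
  [AddCommGroup M'] [Module ℝ M'] [AddCommGroup M''] [Module ℝ M'']

/-! ### Automorphisms of the algebra of functions -/

instance : TopologicalSpace (VFun H ℝ) :=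
  TopologicalSpace.induced
    (fun (f : VFun H ℝ) (a : Σ n : ℕ, (Fin n → H)) => f.1 a.1 a.2) inferInstance

theorem continuous_coeff (n : ℕ) (x : Fin n → H) :
    Continuous fun f : VFun H ℝ => coeff n f x :=
  (continuous_apply (A := fun _ => ℝ) (⟨n, x⟩ : Σ n : ℕ, (Fin n → H))).comp
    (continuous_induced_dom (f := fun (f : VFun H ℝ) (a : Σ n : ℕ, (Fin n → H)) => f.1 a.1 a.2))

theorem continuous_of_coeff {A : Type*} [TopologicalSpace A] {T : A → VFun H ℝ}
    (h : ∀ n x, Continuous fun a => coeff n (T a) x) : Continuous T :=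
  continuous_induced_rng.2 (continuous_pi fun a => h a.1 a.2)

theorem continuous_ins (v : VFun H H) : Continuous (ins v : VFun H ℝ →ₗ[ℝ] VFun H ℝ) := by
  refine continuous_of_coeff fun n x => ?_
  simp only [ins_apply, coeff_star, sum_apply]
  refine continuous_finsetSum _ fun k _ => ?_
  simp only [blk, vsymm, smul_apply, sum_apply, smul_eq_mul]
  refine continuous_const.mul (continuous_finsetSum _ fun σ _ => continuous_finsetSum _
    fun p _ => continuous_const.mul ?_)
  change Continuous fun f : VFun H ℝ => coeff (n - k + 1) f _
  exact continuous_coeff _ _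

theorem continuous_precomp {K : GrSpace.{u}} (χ : H →ₗ[ℝ] K)
    (hχ : ∀ d, ∀ x ∈ H.gr d, χ x ∈ K.gr d) :
    Continuous (precomp χ hχ : VFun K ℝ →ₗ[ℝ] VFun H ℝ) :=
  continuous_of_coeff fun _ _ => continuous_coeff _ _

theorem continuous_expOp {X : VFun H ℝ →ₗ[ℝ] VFun H ℝ} (hX : Continuous X) :
    Continuous (expOp X) := by
  have hpow : ∀ k : ℕ, Continuous fun f => (X ^ k) f := by
    intro k
    induction k with
    | zero => exact continuous_id
    | succ k ih => rw [pow_succ']; exact hX.comp ih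
  refine continuous_of_coeff fun n x => ?_
  simp only [coeff_expOp_self, expPartial_apply, map_sum, map_smul, sum_apply, smul_apply,
    smul_eq_mul]
  exact continuous_finsetSum _ fun k _ =>
    continuous_const.mul ((continuous_coeff n x).comp (hpow k))

theorem coeff_smulStar_congr {n : ℕ} {f f' : VFun H ℝ} {g g' : VFun H M}
    (hf : f - f' ∈ ordGE H ℝ (n + 1)) (hg : g - g' ∈ ordGE H M (n + 1)) :
    coeff n (smulStar f g) = coeff n (smulStar f' g') := by
  have h : smulStar f g = smulStar f' g' + smulStar f' (g - g') + smulStar (f - f') g := by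
    simp only [← smulStarL_apply, map_sub, LinearMap.sub_apply]
    abel
  rw [h, map_add, map_add, coeff_smulStar_eq_zero f' (g - g'), coeff_smulStar_eq_zero (f - f') g,
    add_zero, add_zero]
  · exact fun k hk => Or.inl (hf k (by omega))
  · exact fun k hk => Or.inr (hg _ (by omega))

/-- A field without constant term does not lower orders, so order `n` of the result depends only on
orders up to `n` of the field and of the function. -/
theorem coeff_ins_congr {n : ℕ} {v v' : VFun H H} {f f' : VFun H M} (hv0 : coeff 0 v' = 0)
    (hv : v - v' ∈ ordGE H H (n + 1)) (hf : f - f' ∈ ordGE H M (n + 1)) :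
    coeff n (ins v f) = coeff n (ins v' f') := by
  have h : ins v f = ins v' f' + ins v' (f - f') + ins (v - v') f := by
    rw [ins_sub, map_sub]
    abel
  rw [h, map_add, map_add, coeff_ins_eq_zero v' (f - f'), coeff_ins_eq_zero (v - v') f,
    add_zero, add_zero]
  · exact fun k hk => Or.inl (hv k (by omega))
  · intro k hk
    by_cases h : k = 0
    · subst h
      exact Or.inl hv0
    · exact Or.inr (hf _ (by omega))

namespace Contraction

variable (C : Contraction H)

/-- Continuous endomorphisms of the algebra of functions that are tangent to the identity and fix
the linear functions vanishing on the kernel of `h`. -/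
structure IsAuto (T : VFun H ℝ →ₗ[ℝ] VFun H ℝ) : Prop where
  cont : Continuous T
  mul : ∀ f g, T (smulStar f g) = smulStar (T f) (T g)
  deg : ∀ (𝒟 : ℤ × ZMod 2 → Submodule ℝ ℝ) f, HasDeg 𝒟 f → HasDeg 𝒟 (T f)
  ord : ∀ n, ∀ f ∈ ordGE H ℝ n, T f ∈ ordGE H ℝ n
  low : ∀ n < 2, ∀ f, coeff n (T f) = coeff n f
  fix : ∀ φ : H →ₗ[ℝ] ℝ, (∀ x, C.h x = 0 → φ x = 0) → T (linF φ) = linF φ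
  const : ∀ f, (∀ n, coeff (n + 1) f = 0) → T f = f

variable {C}

theorem IsAuto.id : C.IsAuto LinearMap.id :=
  ⟨continuous_id, fun _ _ => rfl, fun _ _ h => h, fun _ _ h => h, fun _ _ _ => rfl,
    fun _ _ => rfl, fun _ _ => rfl⟩

theorem IsAuto.comp {S T : VFun H ℝ →ₗ[ℝ] VFun H ℝ} (hS : C.IsAuto S) (hT : C.IsAuto T) :
    C.IsAuto (S.comp T) where
  cont := hS.cont.comp hT.cont
  mul f g := by simp only [LinearMap.comp_apply, hT.mul, hS.mul]
  deg 𝒟 f hf := hS.deg 𝒟 _ (hT.deg 𝒟 _ hf)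
  ord n f hf := hS.ord n _ (hT.ord n _ hf)
  low n hn f := by rw [LinearMap.comp_apply, hS.low n hn, hT.low n hn]
  fix φ hφ := by rw [LinearMap.comp_apply, hT.fix φ hφ, hS.fix φ hφ]
  const f hf := by rw [LinearMap.comp_apply, hT.const f hf, hS.const f hf]

theorem Gauge.neg {n : ℕ} {v : VFun H H} (hv : C.Gauge n v) : C.Gauge n (-v) :=
  ⟨hv.deg.neg, Submodule.neg_mem _ hv.ord, by rw [map_neg, hv.h_comp, neg_zero]⟩

theorem Gauge.mem_ordGE_two {n : ℕ} {v : VFun H H} (hv : C.Gauge n v) (hn : 1 ≤ n) :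
    v ∈ ordGE H H 2 := ordGE_mono (by omega) hv.ord

theorem Gauge.isAuto {n : ℕ} {v : VFun H H} (hv : C.Gauge n v) (hn : 1 ≤ n) :
    C.IsAuto (expOp (ins v)) where
  cont := continuous_expOp (continuous_ins v)
  mul f g := expOp_smulStar hv.deg (hv.mem_ordGE_two hn) f g
  deg 𝒟 f hf := HasDeg.expOp (fun f hf => hf.ins_even hv.deg) hf
  ord m f hf := by
    intro k hk
    rw [coeff_expOp_self, expPartial_apply, map_sum]
    refine Finset.sum_eq_zero fun j _ => ?_
    rw [map_smul, (raises_ins (hv.mem_ordGE_two hn)).pow hf j k (by omega), smul_zero]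
  low m hm f := coeff_expOp_ins (hv.mem_ordGE_two hn) hm f
  fix φ hφ := by
    -- The field acts on the linear function of φ by composing φ with its values, and these lie in
    -- the kernel of `C.h`.
    refine expOp_of_eq_zero ?_
    rw [ins_linF]
    refine vfun_ext fun m => ?_
    ext x
    refine hφ _ ?_
    have h := congrArg (fun f => coeff m f x) hv.h_comp
    simpa using h
  const f hf := expOp_of_eq_zero (ins_eq_zero_of_coeff v hf)

theorem Gauge.expOp_expOp_neg {n : ℕ} {v : VFun H H} (hv : C.Gauge n v) (hn : 1 ≤ n)
    (f : VFun H ℝ) : expOp (ins v) (expOp (ins (-v)) f) = f := by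
  rw [show (ins (-v) : VFun H ℝ →ₗ[ℝ] VFun H ℝ) = -ins v from LinearMap.ext fun f => ins_neg v f]
  exact QMan.expOp_expOp_neg (raises_ins (hv.mem_ordGE_two hn)) f

theorem Gauge.expOp_neg_expOp {n : ℕ} {v : VFun H H} (hv : C.Gauge n v) (hn : 1 ≤ n)
    (f : VFun H ℝ) : expOp (ins (-v)) (expOp (ins v) f) = f := by
  rw [show (ins (-v) : VFun H ℝ →ₗ[ℝ] VFun H ℝ) = -ins v from LinearMap.ext fun f => ins_neg v f]
  exact QMan.expOp_neg_expOp (raises_ins (hv.mem_ordGE_two hn)) f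

end Contraction

/-! ### Limits of stabilizing sequences -/

/-- The operator whose coefficients are those of a sequence of operators at sufficiently large
index. -/
noncomputable def limOp (T : ℕ → VFun H M →ₗ[ℝ] VFun H M) : VFun H M →ₗ[ℝ] VFun H M where
  toFun f := ⟨fun n => coeff n (T n f), fun n => coeff_symm n _⟩
  map_add' f g := vfun_ext fun n => by
    change coeff n (T n (f + g)) = _
    rw [map_add, map_add]; rfl
  map_smul' c f := vfun_ext fun n => by
    change coeff n (T n (c • f)) = _
    rw [map_smul, map_smul]; rfl

theorem coeff_limOp_self (T : ℕ → VFun H M →ₗ[ℝ] VFun H M) (f : VFun H M) (n : ℕ) :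
    coeff n (limOp T f) = coeff n (T n f) := rfl

theorem coeff_limOp {T : ℕ → VFun H M →ₗ[ℝ] VFun H M}
    (hT : ∀ n f, ∀ m ≤ n, coeff m (T (n + 1) f) = coeff m (T n f)) (f : VFun H M) {m n : ℕ}
    (h : m ≤ n) : coeff m (limOp T f) = coeff m (T n f) := by
  induction n, h using Nat.le_induction with
  | base => rfl
  | succ n hmn ih => rw [ih, hT n f m hmn]

theorem limOp_sub_mem {T : ℕ → VFun H M →ₗ[ℝ] VFun H M}
    (hT : ∀ n f, ∀ m ≤ n, coeff m (T (n + 1) f) = coeff m (T n f)) (f : VFun H M) (n : ℕ) :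
    limOp T f - T n f ∈ ordGE H M (n + 1) := by
  intro m hm
  rw [map_sub, coeff_limOp hT f (by omega : m ≤ n), sub_self]

namespace Contraction

variable {C : Contraction H}

theorem IsAuto.limOp {T : ℕ → VFun H ℝ →ₗ[ℝ] VFun H ℝ}
    (hT : ∀ n f, ∀ m ≤ n, coeff m (T (n + 1) f) = coeff m (T n f)) (hA : ∀ n, C.IsAuto (T n)) :
    C.IsAuto (QMan.limOp T) where
  cont := continuous_of_coeff fun n x => by
    change Continuous fun f => coeff n (T n f) x
    exact (continuous_coeff n x).comp (hA n).cont
  mul f g := by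
    refine vfun_ext fun n => ?_
    rw [coeff_limOp_self, (hA n).mul]
    exact (coeff_smulStar_congr (limOp_sub_mem hT f n) (limOp_sub_mem hT g n)).symm
  deg 𝒟 f hf n := (hA n).deg 𝒟 f hf n
  ord n f hf m hm := (hA m).ord n f hf m hm
  low n hn f := (hA n).low n hn f
  fix φ hφ := vfun_ext fun n => by rw [coeff_limOp_self, (hA n).fix φ hφ]
  const f hf := vfun_ext fun n => by rw [coeff_limOp_self, (hA n).const f hf]

/-- At order n the outer limit is `T n`. It preserves the order filtration, so the inner limit may
be replaced by `T' n`. -/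
theorem limOp_limOp {T T' : ℕ → VFun H ℝ →ₗ[ℝ] VFun H ℝ}
    (hT' : ∀ n f, ∀ m ≤ n, coeff m (T' (n + 1) f) = coeff m (T' n f))
    (hA : ∀ n, C.IsAuto (T n)) (hi : ∀ n f, T n (T' n f) = f) (f : VFun H ℝ) :
    QMan.limOp T (QMan.limOp T' f) = f := by
  refine vfun_ext fun n => ?_
  have h := (hA n).ord _ _ (limOp_sub_mem hT' f n) n (by omega)
  rw [map_sub, map_sub, sub_eq_zero] at h
  rw [coeff_limOp_self, h, hi]

/-! ### The infinite composite of gauge transformations. -/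

section NormalForm

variable (q : {q // C.Good 1 q})

/-- The successive partial normal forms of a homological vector field. -/
noncomputable def stage : ∀ n, {q // C.Good (n + 1) q}
  | 0 => q
  | n + 1 => ⟨_, ((stage n).2.exists_gauge (by omega)).choose_spec.2⟩

/-- The gauge transformations leading to the partial normal forms. -/
noncomputable def gauge (n : ℕ) : VFun H H := ((stage q n).2.exists_gauge (by omega)).choose

theorem gauge_spec (n : ℕ) : C.Gauge (n + 1) (gauge q n) :=
  ((stage q n).2.exists_gauge (by omega)).choose_spec.1

theorem stage_succ (n : ℕ) : (stage q (n + 1)).1 = expOp (adOp (gauge q n)) (stage q n).1 := rfl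

/-- The composite of the first `n` gauge transformations. -/
noncomputable def gaugeComp : ℕ → VFun H ℝ →ₗ[ℝ] VFun H ℝ
  | 0 => LinearMap.id
  | n + 1 => (expOp (ins (gauge q n))).comp (gaugeComp n)

/-- The inverse of the composite of the first `n` gauge transformations. -/
noncomputable def gaugeCompInv : ℕ → VFun H ℝ →ₗ[ℝ] VFun H ℝ
  | 0 => LinearMap.id
  | n + 1 => (gaugeCompInv n).comp (expOp (ins (-gauge q n)))

theorem isAuto_gaugeComp (n : ℕ) : C.IsAuto (gaugeComp q n) := by
  induction n with
  | zero => exact IsAuto.id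
  | succ n ih => exact ((gauge_spec q n).isAuto (by omega)).comp ih

theorem isAuto_gaugeCompInv (n : ℕ) : C.IsAuto (gaugeCompInv q n) := by
  induction n with
  | zero => exact IsAuto.id
  | succ n ih => exact ih.comp ((gauge_spec q n).neg.isAuto (by omega))

theorem gaugeComp_inv (n : ℕ) (f : VFun H ℝ) : gaugeComp q n (gaugeCompInv q n f) = f := by
  induction n generalizing f with
  | zero => rfl
  | succ n ih =>
    rw [gaugeComp, gaugeCompInv, LinearMap.comp_apply, LinearMap.comp_apply, ih,
      (gauge_spec q n).expOp_expOp_neg (by omega)]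

theorem gaugeCompInv_gaugeComp (n : ℕ) (f : VFun H ℝ) :
    gaugeCompInv q n (gaugeComp q n f) = f := by
  induction n generalizing f with
  | zero => rfl
  | succ n ih =>
    rw [gaugeComp, gaugeCompInv, LinearMap.comp_apply, LinearMap.comp_apply,
      (gauge_spec q n).expOp_neg_expOp (by omega), ih]

theorem gaugeComp_stable (n : ℕ) (f : VFun H ℝ) (m : ℕ) (h : m ≤ n) :
    coeff m (gaugeComp q (n + 1) f) = coeff m (gaugeComp q n f) :=
  coeff_expOp_ins (gauge_spec q n).ord (by omega) _

/-- Here the new factor is applied first. Its triviality in low orders survives the remaining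
factors because they preserve the order filtration. -/
theorem gaugeCompInv_stable (n : ℕ) (f : VFun H ℝ) (m : ℕ) (h : m ≤ n) :
    coeff m (gaugeCompInv q (n + 1) f) = coeff m (gaugeCompInv q n f) := by
  rw [gaugeCompInv, LinearMap.comp_apply, ← sub_eq_zero, ← map_sub, ← map_sub]
  refine (isAuto_gaugeCompInv q n).ord (n + 1) _ (fun k hk => ?_) m (by omega)
  rw [map_sub, coeff_expOp_ins (gauge_spec q n).neg.ord (by omega), sub_self]

theorem gaugeComp_ins (n : ℕ) (f : VFun H ℝ) :
    gaugeComp q n (ins q.1 f) = ins (stage q n).1 (gaugeComp q n f) := by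
  induction n with
  | zero => rfl
  | succ n ih =>
    rw [gaugeComp, LinearMap.comp_apply, ih, expOp_ins (gauge_spec q n).deg
      ((gauge_spec q n).mem_ordGE_two (by omega)) (stage q n).2.deg (stage q n).2.mem_ordGE_one]
    rfl

theorem coeff_stage_succ {m n : ℕ} (h : m ≤ n + 1) :
    coeff m (stage q (n + 1)).1 = coeff m (stage q n).1 := by
  rw [stage_succ, coeff_expOp_adOp (gauge_spec q n).ord (by omega) (stage q n).2.mem_ordGE_one
    (by omega), adOp_mem_ordGE (gauge_spec q n).ord (stage q n).2.mem_ordGE_one m (by omega),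
    add_zero]

/-- The normal form of a homological vector field. -/
noncomputable def normalForm : VFun H H :=
  ⟨fun n => coeff n (stage q n).1, fun n => coeff_symm n _⟩

theorem coeff_normalForm {m n : ℕ} (h : m ≤ n) :
    coeff m (normalForm q) = coeff m (stage q n).1 := by
  induction n, h using Nat.le_induction with
  | base => rfl
  | succ n hmn ih => rw [ih, coeff_stage_succ q (by omega)]

theorem normalForm_sub_mem (n : ℕ) : normalForm q - (stage q n).1 ∈ ordGE H H (n + 1) := by
  intro m hm
  rw [map_sub, coeff_normalForm q (by omega : m ≤ n), sub_self]

theorem good_normalForm (N : ℕ) : C.Good N (normalForm q) where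
  deg n := (stage q n).2.deg n
  zero := (stage q 0).2.zero
  one := (stage q 1).2.one
  -- Order `n` of the square involves only orders up to `n` of the field, where the limit coincides
  -- with the stage of index `n`.
  sq := vfun_ext fun n => by
    have h := congrArg (coeff n) (stage q n).2.sq
    rw [← h]
    exact coeff_ins_congr (stage q n).2.zero (normalForm_sub_mem q n)
      (normalForm_sub_mem q n)
  normal m hm _ x := (stage q m).2.normal m hm (by omega) x

end NormalForm

/-- A homological vector field with linear part `D` can be brought into normal form. -/
theorem exists_normalForm {q : VFun H H} (hq : C.Good 1 q) :
    ∃ (q' : VFun H H) (T T' : VFun H ℝ →ₗ[ℝ] VFun H ℝ), (∀ n, C.Good n q') ∧ C.IsAuto T ∧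
      C.IsAuto T' ∧ (∀ f, T (T' f) = f) ∧ (∀ f, T' (T f) = f) ∧
      ∀ f, T (ins q f) = ins q' (T f) := by
  have hs := gaugeComp_stable ⟨q, hq⟩
  have hs' := gaugeCompInv_stable ⟨q, hq⟩
  have hA := isAuto_gaugeComp ⟨q, hq⟩
  have hA' := isAuto_gaugeCompInv ⟨q, hq⟩
  refine ⟨normalForm ⟨q, hq⟩, QMan.limOp (gaugeComp ⟨q, hq⟩), QMan.limOp (gaugeCompInv ⟨q, hq⟩),
    good_normalForm _, IsAuto.limOp hs hA, IsAuto.limOp hs' hA',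
    limOp_limOp hs' hA (gaugeComp_inv _), limOp_limOp hs hA' (gaugeCompInv_gaugeComp _), ?_⟩
  intro f
  refine vfun_ext fun n => ?_
  rw [coeff_limOp_self, gaugeComp_ins]
  exact (coeff_ins_congr (stage ⟨q, hq⟩ n).2.zero
    (normalForm_sub_mem _ n) (limOp_sub_mem hs f n)).symm

end Contraction

end QMan

namespace QMan

variable {H K : GrSpace.{u}}

/-! ### Comparison with functions, `L_∞`-structures and formal maps -/

/-- Functions on `M_H` as real-valued formal functions. -/
def toV (H : GrSpace.{u}) : FormalFun H ≃ₗ[ℝ] VFun H ℝ where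
  toFun f := ⟨f.1, f.2⟩
  invFun f := ⟨f.1, f.2⟩
  map_add' _ _ := rfl
  map_smul' _ _ := rfl
  left_inv _ := rfl
  right_inv _ := rfl

@[simp] theorem coeff_toV (n : ℕ) (f : FormalFun H) : coeff n (toV H f) = f.1 n := rfl

theorem continuous_toV : Continuous (toV H) := continuous_induced_rng.2 continuous_induced_dom

theorem continuous_toV_symm : Continuous (toV H).symm :=
  continuous_induced_rng.2 continuous_induced_dom

theorem toV_mul (f g : FormalFun H) : toV H (f * g) = smulStar (toV H f) (toV H g) := by
  refine vfun_ext fun n => multilinear_ext_hom fun d x hx => ?_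
  rw [smulStar, coeff_star_apply _ _ hx]
  change (∑ k : Fin (n + 1), ((Nat.factorial k : ℝ) * (Nat.factorial (n - k) : ℝ))⁻¹ •
      symmetrize (((LinearMap.mul' ℝ ℝ).compMultilinearMap
        ((f.1 k).domCoprod (g.1 (n - k)))).domDomCongr (split k))) x = _
  rw [sum_apply]
  refine Finset.sum_congr rfl fun k _ => ?_
  rw [smul_apply, symmetrize_apply _ hx]
  rfl

/-- The vector field of an `L_∞`-structure. -/
def LInfty.vf (L : LInfty H) : VFun H H := ⟨L.l, L.symm⟩

theorem LInfty.coeff_vf (L : LInfty H) (n : ℕ) : coeff n L.vf = L.l n := rfl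

theorem LInfty.toV_Q (L : LInfty H) (f : FormalFun H) : toV H (L.Q f) = ins L.vf (toV H f) := by
  refine vfun_ext fun n => multilinear_ext_hom fun d x hx => ?_
  rw [ins_apply, coeff_star_apply _ _ hx]
  change (∑ k : Fin (n + 1), ((Nat.factorial k : ℝ) * (Nat.factorial (n - k) : ℝ))⁻¹ •
      symmetrize ((MultilinearMap.uncurrySum (R := ℝ) (N := fun _ => (H : Type u))
        ((f.1 (n - k + 1)).curryLeft.compMultilinearMap (L.l k))).domDomCongr (split k))) x = _
  rw [sum_apply]
  refine Finset.sum_congr rfl fun k _ => ?_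
  rw [smul_apply, symmetrize_apply _ hx]
  rfl

theorem LInfty.isDeg_vf (L : LInfty H) : IsDeg (1, 1) L.vf := L.degree

theorem coeff_ins_self_apply (q : VFun H H) {n : ℕ} {d : Fin n → ℤ × ZMod 2} {x : Fin n → H}
    (hx : HomTuple H d x) : coeff n (ins q q) x
    = ∑ k : Fin (n + 1), ((Nat.factorial k : ℝ) * (Nat.factorial (n - k) : ℝ))⁻¹ •
      ∑ σ : Equiv.Perm (Fin n), koszul σ (fun i => (d i).2) •
        coeff (n - k + 1) q (Fin.cons (coeff k q (fun i => x (σ (split k (Sum.inl i)))))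
          (fun j => x (σ (split k (Sum.inr j))))) := by
  rw [ins_apply, coeff_star_apply _ _ hx]
  rfl

theorem LInfty.ins_vf_vf (L : LInfty H) : ins L.vf L.vf = 0 := by
  refine vfun_ext fun n => multilinear_ext_hom fun d x hx => ?_
  rw [coeff_ins_self_apply _ hx]
  exact L.jacobi n d x hx

/-- The `L_∞`-structure of a homological vector field. -/
def LInfty.ofVF (q : VFun H H) (h0 : coeff 0 q = 0) (hq : IsDeg (1, 1) q) (hsq : ins q q = 0) :
    LInfty H where
  l := q.1
  l_zero := h0
  degree := hq
  symm := q.2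
  jacobi n d x hx := by
    have h := coeff_ins_self_apply q hx
    rw [hsq] at h
    exact h.symm

/-- The possible values of a homogeneous function of degree `d` at arguments of total
degree `s`. -/
def homSub (d s : ℤ × ZMod 2) : Submodule ℝ ℝ := if d = -s then ⊤ else ⊥

theorem isHomogeneous_iff (f : FormalFun H) (d : ℤ × ZMod 2) :
    f.IsHomogeneous d ↔ HasDeg (homSub d) (toV H f) := by
  refine forall₃_congr fun n e x => forall_congr' fun hx => ?_
  unfold homSub
  split_ifs with h
  · simp [h]
  · simp only [h, imp_false, not_not, Submodule.mem_bot, coeff_toV]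

/-- The formal map given by its action on real-valued formal functions. -/
def FormalMap.ofV (T : VFun K ℝ →ₗ[ℝ] VFun H ℝ) (h1 : T (toV K 1) = toV H 1)
    (hm : ∀ f g, T (smulStar f g) = smulStar (T f) (T g)) (hc : Continuous T)
    (hd : ∀ f d, HasDeg (homSub d) f → HasDeg (homSub d) (T f))
    (h0 : ∀ f, coeff 0 (T f) Fin.elim0 = coeff 0 f Fin.elim0) : FormalMap H K where
  pullback := (toV H).symm.toLinearMap.comp (T.comp (toV K).toLinearMap)
  map_one := by
    rw [LinearMap.comp_apply, LinearMap.comp_apply, LinearEquiv.coe_coe, LinearEquiv.coe_coe, h1,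
      LinearEquiv.symm_apply_apply]
  map_mul f g := by
    rw [← (toV H).injective.eq_iff, toV_mul]
    simp only [LinearMap.comp_apply, LinearEquiv.coe_coe, LinearEquiv.apply_symm_apply, toV_mul, hm]
  continuous := continuous_toV_symm.comp (hc.comp continuous_toV)
  degree f d hf := by
    rw [isHomogeneous_iff] at hf ⊢
    simpa using hd _ d hf
  basePoint f := h0 _

/-- The formal map given by an endomorphism of the algebra of functions tangent to the
identity. -/
def Contraction.IsAuto.toFormalMap {C : Contraction H} {T : VFun H ℝ →ₗ[ℝ] VFun H ℝ}
    (hT : C.IsAuto T) : FormalMap H H :=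
  FormalMap.ofV T (hT.const _ fun _ => rfl) hT.mul hT.cont (fun _ _ hf => hT.deg _ _ hf)
    fun f => by rw [hT.low 0 (by omega)]

@[simp] theorem Contraction.IsAuto.toV_pullback {C : Contraction H}
    {T : VFun H ℝ →ₗ[ℝ] VFun H ℝ} (hT : C.IsAuto T) (f : FormalFun H) :
    toV H (hT.toFormalMap.pullback f) = T (toV H f) := rfl

theorem one_val_zero (x : Fin 0 → H) : (1 : FormalFun H).1 0 x = 1 := by
  change (if 0 = 0 then (MultilinearMap.mkPiAlgebra ℝ (Fin 0) ℝ).compLinearMap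
    (fun _ => (0 : H →ₗ[ℝ] ℝ)) else 0) x = 1
  simp

/-- The formal map given by a linear map of degree `0`. -/
def linearMap (χ : H →ₗ[ℝ] K) (hχ : ∀ d, ∀ x ∈ H.gr d, χ x ∈ K.gr d) : FormalMap H K :=
  FormalMap.ofV (precomp χ hχ)
    (by
      refine vfun_ext fun n => ?_
      cases n with
      | zero =>
        ext x
        rw [coeff_precomp, coeff_toV, coeff_toV, one_val_zero, one_val_zero]
      | succ n => rfl)
    (fun f g => by rw [smulStar, precomp_star, smulStar]; rfl)
    (continuous_precomp χ hχ)
    (fun f d hf n e x hx => hf n e (fun i => χ (x i)) fun i => hχ _ _ (hx i))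
    (fun f => by rw [coeff_precomp, Subsingleton.elim (fun i => χ (Fin.elim0 i)) Fin.elim0])

@[simp] theorem toV_linearMap_pullback (χ : H →ₗ[ℝ] K) (hχ : ∀ d, ∀ x ∈ H.gr d, χ x ∈ K.gr d)
    (f : FormalFun K) : toV H ((linearMap χ hχ).pullback f) = precomp χ hχ (toV K f) := rfl

/-- Composition of formal maps. -/
def FormalMap.comp {J : GrSpace.{u}} (ψ : FormalMap K J) (φ : FormalMap H K) : FormalMap H J where
  pullback := φ.pullback.comp ψ.pullback
  map_one := by rw [LinearMap.comp_apply, ψ.map_one, φ.map_one]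
  map_mul f g := by simp only [LinearMap.comp_apply, ψ.map_mul, φ.map_mul]
  continuous := φ.continuous.comp ψ.continuous
  degree f d hf := φ.degree _ d (ψ.degree f d hf)
  basePoint f := by rw [LinearMap.comp_apply, φ.basePoint, ψ.basePoint]

theorem FormalMap.comp_pullback {J : GrSpace.{u}} (ψ : FormalMap K J) (φ : FormalMap H K)
    (f : FormalFun J) : (ψ.comp φ).pullback f = φ.pullback (ψ.pullback f) := rfl

theorem isQMap_comp {J : GrSpace.{u}} {L : LInfty H} {L' : LInfty K} {L'' : LInfty J}
    {ψ : FormalMap K J} {φ : FormalMap H K} (hψ : LInfty.IsQMap L' L'' ψ)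
    (hφ : LInfty.IsQMap L L' φ) : LInfty.IsQMap L L'' (ψ.comp φ) := by
  intro f
  rw [FormalMap.comp_pullback, FormalMap.comp_pullback, hψ f, hφ]

/-- Vector fields that are related by a linear map. -/
theorem precomp_ins {M : Type*} [AddCommGroup M] [Module ℝ M] {χ : H →ₗ[ℝ] K}
    {hχ : ∀ d, ∀ x ∈ H.gr d, χ x ∈ K.gr d} {v : VFun H H} {w : VFun K K}
    (h : precomp χ hχ w = postcomp χ v) (f : VFun K M) :
    precomp χ hχ (ins w f) = ins v (precomp χ hχ f) := by
  rw [ins_apply, precomp_star, ins_apply, h, star_postcomp]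
  congr 1
  refine LinearMap.ext fun y => vfun_ext fun n => ?_
  ext x
  simp only [LinearMap.comp_apply, coeff_precomp, coeff_dd]
  congr 1
  funext i
  refine Fin.cases ?_ (fun j => ?_) i <;> simp

/-- A linear map that commutes with the structure maps is a `Q`-map. -/
theorem isQMap_linearMap {L : LInfty H} {L' : LInfty K} {χ : H →ₗ[ℝ] K}
    {hχ : ∀ d, ∀ x ∈ H.gr d, χ x ∈ K.gr d}
    (h : ∀ n x, χ (L.l n x) = L'.l n (fun i => χ (x i))) :
    LInfty.IsQMap L L' (linearMap χ hχ) := by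
  intro f
  rw [← (toV H).injective.eq_iff, LInfty.toV_Q, toV_linearMap_pullback, toV_linearMap_pullback,
    LInfty.toV_Q]
  exact precomp_ins (vfun_ext fun n => MultilinearMap.ext fun x => (h n x).symm) _

end QMan

namespace QMan

variable {H : GrSpace.{u}}

/-! ### Graded subspaces -/

/-- The projection onto the homogeneous part of degree `d`. -/
noncomputable def degProj (H : GrSpace.{u}) (d : ℤ × ZMod 2) : H →ₗ[ℝ] H :=
  (H.gr d).subtype.comp ((DirectSum.component ℝ (ℤ × ZMod 2) (fun d => H.gr d) d).comp
    (LinearEquiv.ofBijective (DirectSum.coeLinearMap H.gr) H.bijective_coe).symm.toLinearMap)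

theorem degProj_mem (d : ℤ × ZMod 2) (x : H) : degProj H d x ∈ H.gr d := Subtype.property _

theorem degProj_of_mem {d : ℤ × ZMod 2} {x : H} (hx : x ∈ H.gr d) (e : ℤ × ZMod 2) :
    degProj H e x = if d = e then x else 0 := by
  have h : (LinearEquiv.ofBijective (DirectSum.coeLinearMap H.gr) H.bijective_coe).symm x
      = DirectSum.lof ℝ (ℤ × ZMod 2) (fun d => H.gr d) d ⟨x, hx⟩ := by
    rw [LinearEquiv.symm_apply_eq]
    simp [LinearEquiv.ofBijective_apply]
  simp only [degProj, LinearMap.comp_apply, LinearEquiv.coe_coe]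
  rw [h]
  split_ifs with he
  · subst he
    simp [DirectSum.component.lof_self]
  · rw [DirectSum.component.of, dif_neg he]
    simp

theorem degProj_self {d : ℤ × ZMod 2} {x : H} (hx : x ∈ H.gr d) : degProj H d x = x := by
  rw [degProj_of_mem hx, if_pos rfl]

theorem mem_of_degProj_mem {E : Submodule ℝ H} {x : H} (h : ∀ d, degProj H d x ∈ E) :
    x ∈ ⨆ d, E ⊓ H.gr d := by
  classical
  set y := (LinearEquiv.ofBijective (DirectSum.coeLinearMap H.gr) H.bijective_coe).symm x with hy
  have hx : x = DirectSum.coeLinearMap H.gr y := by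
    have := LinearEquiv.apply_symm_apply
      (LinearEquiv.ofBijective (DirectSum.coeLinearMap H.gr) H.bijective_coe) x
    exact this.symm
  rw [hx, DirectSum.coeLinearMap_eq_dfinsuppSum]
  refine Submodule.sum_mem _ fun d _ => ?_
  refine Submodule.mem_iSup_of_mem d ⟨?_, (y d).2⟩
  exact h d

theorem eq_zero_of_degProj {x : H} (h : ∀ d, degProj H d x = 0) : x = 0 := by
  have h1 := mem_of_degProj_mem (E := ⊥) (x := x) fun d => by simp [h d]
  simpa using h1

theorem isGraded_of_degProj {E : Submodule ℝ H} (h : ∀ x ∈ E, ∀ d, degProj H d x ∈ E) :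
    H.IsGraded E :=
  le_antisymm (fun x hx => mem_of_degProj_mem (h x hx)) (iSup_le fun _ => inf_le_left)

theorem degProj_mem_of_iSup {A : ℤ × ZMod 2 → Submodule ℝ H} (hA : ∀ d, A d ≤ H.gr d) {x : H}
    (hx : x ∈ ⨆ d, A d) (d : ℤ × ZMod 2) : degProj H d x ∈ A d := by
  induction hx using Submodule.iSup_induction' with
  | mem e y hy =>
    rw [degProj_of_mem (hA e hy)]
    split_ifs with h
    · exact h ▸ hy
    · exact Submodule.zero_mem _
  | zero => rw [map_zero]; exact Submodule.zero_mem _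
  | add y z _ _ ihy ihz => rw [map_add]; exact Submodule.add_mem _ ihy ihz

theorem degProj_mem_of_isGraded {E : Submodule ℝ H} (hE : H.IsGraded E) {x : H} (hx : x ∈ E)
    (d : ℤ × ZMod 2) : degProj H d x ∈ E := by
  rw [hE] at hx
  exact (degProj_mem_of_iSup (fun _ => inf_le_right) hx d).1

/-- Graded subspaces have graded complements. -/
theorem exists_graded_compl {A B : Submodule ℝ H} (hAB : A ≤ B) (hA : H.IsGraded A)
    (hB : H.IsGraded B) :
    ∃ E : Submodule ℝ H, H.IsGraded E ∧ Disjoint E A ∧ E ⊔ A = B := by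
  -- Complements are chosen degree by degree; intersecting them with `B` keeps the sum inside `B`,
  -- and the modular law shows that nothing is lost.
  choose c hc using fun d => Submodule.exists_isCompl (A ⊓ H.gr d)
  set e : ℤ × ZMod 2 → Submodule ℝ H := fun d => c d ⊓ (B ⊓ H.gr d) with he
  have hegr : ∀ d, e d ≤ H.gr d := fun d => inf_le_right.trans inf_le_right
  have hsup : ∀ d, A ⊓ H.gr d ⊔ e d = B ⊓ H.gr d := by
    intro d
    rw [he, ← sup_inf_assoc_of_le _ (inf_le_inf_right _ hAB), (hc d).sup_eq_top, top_inf_eq]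
  refine ⟨⨆ d, e d, ?_, ?_, ?_⟩
  · refine isGraded_of_degProj fun x hx d => ?_
    exact Submodule.mem_iSup_of_mem d (degProj_mem_of_iSup hegr hx d)
  · rw [Submodule.disjoint_def]
    intro x hx hxA
    refine eq_zero_of_degProj fun d => ?_
    have h1 := degProj_mem_of_iSup hegr hx d
    have h2 := degProj_mem_of_isGraded hA hxA d
    exact Submodule.disjoint_def.1 (hc d).disjoint _ ⟨h2, degProj_mem d x⟩ h1.1
  · refine le_antisymm (sup_le (iSup_le fun d => inf_le_right.trans inf_le_left) hAB) ?_
    conv_lhs => rw [hB]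
    refine iSup_le fun d => ?_
    rw [← hsup d]
    exact sup_le (inf_le_left.trans le_sup_right) ((le_iSup e d).trans le_sup_left)

/-- Projections along graded subspaces have degree `0`. -/
theorem mem_gr_of_add {E F : Submodule ℝ H} (hE : H.IsGraded E) (hF : H.IsGraded F)
    (hd : Disjoint E F) {x y : H} (hx : x ∈ E) (hy : y ∈ F) {d : ℤ × ZMod 2}
    (h : x + y ∈ H.gr d) : x ∈ H.gr d := by
  have h1 : (degProj H d x - x) + (degProj H d y - y) = 0 := by
    have := degProj_self h
    rw [map_add] at this
    rw [← sub_eq_zero] at this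
    rw [← this]; abel
  have h2 : degProj H d x - x = 0 := by
    refine Submodule.disjoint_def.1 hd _
      (Submodule.sub_mem _ (degProj_mem_of_isGraded hE hx d) hx) ?_
    rw [eq_neg_of_add_eq_zero_left h1]
    exact Submodule.neg_mem _ (Submodule.sub_mem _ (degProj_mem_of_isGraded hF hy d) hy)
  rw [← sub_eq_zero.1 h2]
  exact degProj_mem d x

/-! ### Splittings of the complex and the resulting contraction. -/

namespace LInfty

variable (L : LInfty H)

theorem D_apply (x : H) : L.D x = L.l 1 (fun _ => x) := rfl

theorem deg_D (d : ℤ × ZMod 2) (x : H) (hx : x ∈ H.gr d) : L.D x ∈ H.gr (d + (1, 1)) := by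
  have h := L.degree 1 (fun _ => d) (fun _ => x) fun _ => hx
  simpa [D_apply] using h

theorem D_D (x : H) : L.D (L.D x) = 0 := by
  have h : L.D.comp L.D = 0 := by
    refine linear_ext_hom fun d x hx => ?_
    have h := L.jacobi 1 (fun _ => d) (fun _ => x) fun _ => hx
    rw [Fin.sum_univ_two] at h
    -- In the Jacobi identity for one argument, the term with `k = 0` inserts the value of `l 0`,
    -- which vanishes. The term left over is D applied twice.
    rw [Finset.sum_eq_zero (f := fun σ : Equiv.Perm (Fin 1) => _ • L.l (1 - (0 : Fin 2) + 1) _),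
      smul_zero, zero_add] at h
    · rw [Fintype.sum_unique, show (default : Equiv.Perm (Fin 1)) = 1 from rfl, koszul_one,
        one_smul] at h
      have h1 : (((Nat.factorial (1 : Fin 2) : ℝ) * (Nat.factorial (1 - (1 : Fin 2)) : ℝ))⁻¹)
          = 1 := by simp
      rw [h1, one_smul] at h
      rw [LinearMap.zero_apply, ← h, LinearMap.comp_apply, D_apply, D_apply]
      refine congrArg (L.l 1) (funext fun i => ?_)
      obtain rfl : i = 0 := Subsingleton.elim _ _
      rfl
    · intro σ _
      rw [MultilinearMap.map_coord_zero _ 0, smul_zero]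
      rw [Fin.cons_zero]
      change L.l 0 _ = 0
      rw [L.l_zero]
      rfl
  exact LinearMap.congr_fun h x

theorem D_degProj (d : ℤ × ZMod 2) (x : H) :
    L.D (degProj H d x) = degProj H (d + (1, 1)) (L.D x) := by
  have h : L.D.comp (degProj H d) = (degProj H (d + (1, 1))).comp L.D := by
    refine linear_ext_hom fun e x hx => ?_
    rw [LinearMap.comp_apply, LinearMap.comp_apply, degProj_of_mem hx,
      degProj_of_mem (L.deg_D e x hx)]
    by_cases h : e = d <;> simp [h]
  exact LinearMap.congr_fun h x

theorem isGraded_ker : H.IsGraded (LinearMap.ker L.D) := by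
  refine isGraded_of_degProj fun x hx d => ?_
  rw [LinearMap.mem_ker] at hx ⊢
  rw [D_degProj, hx, map_zero]

theorem isGraded_range : H.IsGraded (LinearMap.range L.D) := by
  refine isGraded_of_degProj fun x hx d => ?_
  obtain ⟨y, rfl⟩ := hx
  refine ⟨degProj H (d - (1, 1)) y, ?_⟩
  rw [D_degProj, sub_add_cancel]

theorem range_le_ker : LinearMap.range L.D ≤ LinearMap.ker L.D := by
  rintro _ ⟨y, rfl⟩
  exact L.D_D y

theorem exists_isSplitting : ∃ E F : Submodule ℝ H, L.IsSplitting E F := by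
  obtain ⟨E, hE1, hE2, hE3⟩ := exists_graded_compl L.range_le_ker L.isGraded_range L.isGraded_ker
  obtain ⟨F, hF1, hF2, hF3⟩ := exists_graded_compl (H := H) (le_top (a := LinearMap.ker L.D))
    L.isGraded_ker (isGraded_of_degProj fun _ _ _ => trivial)
  exact ⟨E, F, hE1, hF1, hE2, hE3, hF2, codisjoint_iff.2 hF3⟩

namespace IsSplitting

variable {L} {E F : Submodule ℝ H}

theorem mem_ker (h : L.IsSplitting E F) {x : H} (hx : x ∈ E) : L.D x = 0 := by
  have : x ∈ LinearMap.ker L.D := h.sup_eq ▸ Submodule.mem_sup_left hx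
  exact this

theorem eq_zero_of_mem_F (h : L.IsSplitting E F) {x : H} (hx : x ∈ F) (hD : L.D x = 0) : x = 0 :=
  Submodule.disjoint_def.1 h.isCompl.disjoint x hx hD

/-- Every vector has the form `e + D f + f'` with `e ∈ E` and `f, f' ∈ F`. -/
theorem exists_decomp (h : L.IsSplitting E F) (x : H) : ∃ e ∈ E, ∃ f ∈ F, ∃ f' ∈ F, x = e + L.D f + f' := by
  obtain ⟨f', hf', k, hk, rfl⟩ := Submodule.mem_sup.1
    (h.isCompl.sup_eq_top ▸ Submodule.mem_top : x ∈ F ⊔ LinearMap.ker L.D)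
  rw [← h.sup_eq] at hk
  obtain ⟨e, he, _, ⟨y, rfl⟩, rfl⟩ := Submodule.mem_sup.1 hk
  obtain ⟨f, hf, k', hk', rfl⟩ := Submodule.mem_sup.1
    (h.isCompl.sup_eq_top ▸ Submodule.mem_top : y ∈ F ⊔ LinearMap.ker L.D)
  refine ⟨e, he, f, hf, f', hf', ?_⟩
  rw [map_add, LinearMap.mem_ker.1 hk']
  abel

theorem D_decomp (h : L.IsSplitting E F) {e : H} (he : e ∈ E) (f f' : H) :
    L.D (e + L.D f + f') = L.D f' := by
  rw [map_add, map_add, h.mem_ker he, L.D_D, zero_add, zero_add]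

theorem decomp_unique (h : L.IsSplitting E F) {e f f' : H} (he : e ∈ E) (hf : f ∈ F) (hf' : f' ∈ F)
    (h0 : e + L.D f + f' = 0) : e = 0 ∧ f = 0 ∧ f' = 0 := by
  have h1 : f' = 0 := by
    refine h.eq_zero_of_mem_F hf' ?_
    have := congrArg L.D h0
    rwa [map_add, map_add, h.mem_ker he, L.D_D, map_zero, zero_add, zero_add] at this
  rw [h1, add_zero] at h0
  have h2 : e = 0 := by
    refine Submodule.disjoint_def.1 h.disjoint e he ?_
    rw [eq_neg_of_add_eq_zero_left h0]
    exact Submodule.neg_mem _ ⟨f, rfl⟩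
  rw [h2, zero_add] at h0
  exact ⟨h2, h.eq_zero_of_mem_F hf h0, h1⟩

/-- The linear isomorphism `E × F × F → H`, `(e, f, f') ↦ e + D f + f'`. -/
theorem bijective_decomp (h : L.IsSplitting E F) : Function.Bijective
    ((E.subtype.coprod ((L.D.comp F.subtype).coprod F.subtype) : E × F × F →ₗ[ℝ] H)) := by
  constructor
  · rw [injective_iff_map_eq_zero]
    rintro ⟨⟨e, he⟩, ⟨f, hf⟩, ⟨f', hf'⟩⟩ h0
    have h1 := h.decomp_unique he hf hf' (by simpa [add_assoc] using h0)
    simp [h1]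
  · intro x
    obtain ⟨e, he, f, hf, f', hf', rfl⟩ := h.exists_decomp x
    exact ⟨(⟨e, he⟩, ⟨f, hf⟩, ⟨f', hf'⟩), by simp [add_assoc]⟩

/-- These are two components of the inverse of the isomorphism E × F × F → H. The second inverts D :
F → Im D and vanishes on E and F; it becomes the homotopy. -/
theorem exists_projections (h : L.IsSplitting E F) : ∃ P k : H →ₗ[ℝ] H, (∀ x, P x ∈ E) ∧ (∀ x, k x ∈ F) ∧
    (∀ x, x - P x - L.D (k x) ∈ F) ∧
    ∀ e ∈ E, ∀ f ∈ F, ∀ f' ∈ F, P (e + L.D f + f') = e ∧ k (e + L.D f + f') = f := by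
  set Φ := LinearEquiv.ofBijective _ h.bijective_decomp with hΦ
  have hs : ∀ e (he : e ∈ E) f (hf : f ∈ F) f' (hf' : f' ∈ F),
      Φ.symm (e + L.D f + f') = (⟨e, he⟩, ⟨f, hf⟩, ⟨f', hf'⟩) := by
    intro e he f hf f' hf'
    rw [LinearEquiv.symm_apply_eq, hΦ, LinearEquiv.ofBijective_apply]
    simp [add_assoc]
  refine ⟨E.subtype.comp ((LinearMap.fst ℝ E (F × F)).comp Φ.symm.toLinearMap),
    F.subtype.comp ((LinearMap.fst ℝ F F).comp ((LinearMap.snd ℝ E (F × F)).comp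
      Φ.symm.toLinearMap)), fun x => Subtype.property _, fun x => Subtype.property _, ?_, ?_⟩
  · intro x
    obtain ⟨e, he, f, hf, f', hf', rfl⟩ := h.exists_decomp x
    simp only [LinearMap.comp_apply, LinearEquiv.coe_coe, hs e he f hf f' hf']
    change e + L.D f + f' - e - L.D f ∈ F
    rwa [show e + L.D f + f' - e - L.D f = f' by abel]
  · intro e he f hf f' hf'
    simp only [LinearMap.comp_apply, LinearEquiv.coe_coe, hs e he f hf f' hf']
    exact ⟨rfl, rfl⟩

/-- The contraction of `(H, D)` onto `E` given by a splitting. -/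
theorem exists_contraction (h : L.IsSplitting E F) : ∃ C : Contraction H, C.D = L.D ∧ (∀ x, C.P x ∈ E) ∧
    (∀ x ∈ E, C.P x = x) ∧ ∀ x, C.h x = 0 ↔ x ∈ E ⊔ F := by
  obtain ⟨P, k, hP, hk, hF, hPk⟩ := h.exists_projections
  have hE0 : ∀ e ∈ E, P e = e ∧ k e = 0 := fun e he => by
    simpa using hPk e he 0 F.zero_mem 0 F.zero_mem
  have hF0 : ∀ f ∈ F, P f = 0 ∧ k f = 0 := fun f hf => by
    simpa using hPk 0 E.zero_mem 0 F.zero_mem f hf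
  have hD0 : ∀ f ∈ F, P (L.D f) = 0 ∧ k (L.D f) = f := fun f hf => by
    simpa using hPk 0 E.zero_mem f hf 0 F.zero_mem
  -- The components of a homogeneous vector are homogeneous: f' by projection along Ker D, then e by
  -- projection along Im D, and finally f because D is homogeneous and injective on F.
  have hgr : ∀ e ∈ E, ∀ f ∈ F, ∀ f' ∈ F, ∀ d, e + L.D f + f' ∈ H.gr d →
      e ∈ H.gr d ∧ f ∈ H.gr (d + (-1, -1)) := by
    intro e he f hf f' hf' d hx
    have h1 : f' ∈ H.gr d := by
      refine mem_gr_of_add h.gradedF L.isGraded_ker h.isCompl.disjoint hf'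
        (y := e + L.D f) ?_ (by rwa [add_comm])
      rw [LinearMap.mem_ker, map_add, h.mem_ker he, L.D_D, add_zero]
    have h2 : e + L.D f ∈ H.gr d := by simpa using Submodule.sub_mem _ hx h1
    have h3 : e ∈ H.gr d := mem_gr_of_add h.gradedE L.isGraded_range h.disjoint he ⟨f, rfl⟩ h2
    have h4 : L.D f ∈ H.gr d := by simpa using Submodule.sub_mem _ h2 h3
    refine ⟨h3, ?_⟩
    have h5 : degProj H (d + (-1, -1)) f - f = 0 := by
      refine h.eq_zero_of_mem_F
        (Submodule.sub_mem _ (degProj_mem_of_isGraded h.gradedF hf _) hf) ?_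
      rw [map_sub, L.D_degProj, add_assoc, show ((-1, -1) + (1, 1) : ℤ × ZMod 2) = 0 from rfl,
        add_zero, degProj_self h4, sub_self]
    rw [← sub_eq_zero.1 h5]
    exact degProj_mem _ _
  have deg_k : ∀ d, ∀ x ∈ H.gr d, k x ∈ H.gr (d + (-1, -1)) := by
    intro d x hx
    obtain ⟨e, he, f, hf, f', hf', rfl⟩ := h.exists_decomp x
    rw [(hPk e he f hf f' hf').2]
    exact (hgr e he f hf f' hf' d hx).2
  have deg_P : ∀ d, ∀ x ∈ H.gr d, P x ∈ H.gr d := by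
    intro d x hx
    obtain ⟨e, he, f, hf, f', hf', rfl⟩ := h.exists_decomp x
    rw [(hPk e he f hf f' hf').1]
    exact (hgr e he f hf f' hf' d hx).1
  have homotopy : ∀ x, L.D (k x) + k (L.D x) = x - P x := by
    intro x
    obtain ⟨e, he, f, hf, f', hf', rfl⟩ := h.exists_decomp x
    rw [(hPk e he f hf f' hf').1, (hPk e he f hf f' hf').2, h.D_decomp he,
      (hD0 f' hf').2]
    abel
  have hPD : ∀ x, P (L.D x) = 0 := by
    intro x
    obtain ⟨e, he, f, hf, f', hf', rfl⟩ := h.exists_decomp x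
    rw [h.D_decomp he, (hD0 f' hf').1]
  let C : Contraction H :=
    { D := L.D
      h := k
      P := P
      deg_D := L.deg_D
      deg_h := deg_k
      deg_P := deg_P
      homotopy := homotopy
      DD := L.D_D
      hh := fun x => (hF0 _ (hk x)).2
      PD := hPD
      DP := fun x => h.mem_ker (hP x)
      hP := fun x => (hE0 _ (hP x)).2
      PP := fun x => (hE0 _ (hP x)).1 }
  refine ⟨C, rfl, hP, fun x hx => (hE0 x hx).1, ?_⟩
  · intro x
    constructor
    · intro hx
      have h1 := hF x
      change k x = 0 at hx
      rw [hx, map_zero, sub_zero] at h1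
      have h2 := Submodule.add_mem_sup (hP x) h1
      simpa using h2
    · intro hx
      obtain ⟨e, he, f, hf, rfl⟩ := Submodule.mem_sup.1 hx
      change k (e + f) = 0
      rw [map_add, (hE0 e he).2, (hF0 f hf).2, add_zero]

/-- The subspace `E` represents the cohomology. -/
theorem exists_cohomology_equiv (h : L.IsSplitting E F) : ∃ e : E ≃ₗ[ℝ] L.Cohomology, ∀ x : E,
    ∃ hx : (x : H) ∈ LinearMap.ker L.D, e x = Submodule.Quotient.mk ⟨(x : H), hx⟩ := by
  set φ : E →ₗ[ℝ] L.Cohomology := (Submodule.mkQ _).comp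
    (LinearMap.codRestrict (LinearMap.ker L.D) E.subtype fun x => h.mem_ker x.2) with hφ
  have hφa : ∀ x : E, φ x = Submodule.Quotient.mk ⟨(x : H), h.mem_ker x.2⟩ := fun x => rfl
  refine ⟨LinearEquiv.ofBijective φ ⟨?_, ?_⟩, fun x => ⟨h.mem_ker x.2, rfl⟩⟩
  · rw [injective_iff_map_eq_zero]
    intro x hx
    rw [hφa, Submodule.Quotient.mk_eq_zero] at hx
    change (x : H) ∈ LinearMap.range L.D at hx
    exact Subtype.ext (Submodule.disjoint_def.1 h.disjoint _ x.2 hx)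
  · intro y
    obtain ⟨⟨y, hy⟩, rfl⟩ := Submodule.Quotient.mk_surjective _ y
    have hy' := hy
    rw [← h.sup_eq] at hy'
    obtain ⟨e, he, z, hz, rfl⟩ := Submodule.mem_sup.1 hy'
    refine ⟨⟨e, he⟩, ?_⟩
    rw [hφa, Submodule.Quotient.eq]
    change e - (e + z) ∈ LinearMap.range L.D
    have : -z ∈ LinearMap.range L.D := Submodule.neg_mem _ hz
    simpa using this

end IsSplitting

end LInfty

end QMan

/-! ### The product structure of a vector field in normal form. -/

namespace QMan

variable {H : GrSpace.{u}}

namespace Contraction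

variable (C : Contraction H) {E : Submodule ℝ H}

/-- The homotopy identity at h x gives h D h x = h x - P h x. Applying h to the identity at x gives
h D h x = h x. -/
theorem P_h (x : H) : C.P (C.h x) = 0 := by
  have h1 := C.homotopy (C.h x)
  have h2 := congrArg C.h (C.homotopy x)
  rw [C.hh, map_zero, zero_add] at h1
  rw [map_add, C.hh, add_zero, map_sub, C.hP, sub_zero] at h2
  rw [h2] at h1
  exact (sub_eq_self.1 h1.symm)

theorem D_h_D (x : H) : C.D (C.h (C.D x)) = C.D x := by
  have h1 := C.homotopy (C.D x)
  rwa [C.DD, map_zero, add_zero, C.PD, sub_zero] at h1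

theorem D_linF_P {n : ℕ} (x : Fin n → H) : coeff n (linF C.D) (fun i => C.P (x i)) = 0 := by
  by_cases hn : n = 1
  · subst hn
    rw [coeff_linF_one, C.DP]
  · rw [coeff_linF_of_ne _ hn]
    rfl

theorem linF_D_apply_of_comp {M : Type*} [AddCommGroup M] [Module ℝ M] {φ : H →ₗ[ℝ] M}
    (hφ : ∀ x, φ (C.D x) = 0) {n : ℕ} (x : Fin n → H) : φ (coeff n (linF C.D) x) = 0 := by
  by_cases hn : n = 1
  · subst hn
    rw [coeff_linF_one, hφ]
  · rw [coeff_linF_of_ne _ hn, zero_apply, map_zero]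

/-- In normal form the nonlinear part only depends on the projections of the arguments and takes
values in the image of `P`. -/
theorem coeff_normal {q : VFun H H} (hq : ∀ n, C.Good n q) {n : ℕ} (x : Fin n → H) :
    coeff n q x = coeff n (linF C.D) x + C.P (coeff n q (fun i => C.P (x i))) := by
  rcases n with _ | _ | n
  · rw [(hq 0).zero, coeff_linF_of_ne _ (by omega)]
    simp
  · rw [(hq 0).one, D_linF_P, map_zero, add_zero]
  · rw [coeff_linF_of_ne _ (by omega), zero_apply, zero_add]
    exact (hq (n + 2)).normal _ (by omega) le_rfl x

theorem P_coeff_normal {q : VFun H H} (hq : ∀ n, C.Good n q) {n : ℕ} (x : Fin n → H) :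
    C.P (coeff n q x) = C.P (coeff n q (fun i => C.P (x i))) := by
  rw [C.coeff_normal hq, map_add, C.linF_D_apply_of_comp C.PD, zero_add, C.PP]

/-- The nonlinear part of the normal form has values in the image of P, so a linear map vanishing
there sees only D. Both the triviality of the fibre and the action on W come from this. -/
theorem apply_coeff_normal {M : Type*} [AddCommGroup M] [Module ℝ M] {φ : H →ₗ[ℝ] M}
    (hφ : ∀ x, φ (C.P x) = 0) {q : VFun H H} (hq : ∀ n, C.Good n q) {n : ℕ} (x : Fin n → H) :
    φ (coeff n q x) = φ (coeff n (linF C.D) x) := by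
  rw [C.coeff_normal hq, map_add, hφ, add_zero]

/-- A subspace onto which `P` projects. -/
structure IsImage (E : Submodule ℝ H) : Prop where
  graded : H.IsGraded E
  mem : ∀ x, C.P x ∈ E
  eq_self : ∀ x ∈ E, C.P x = x

variable {C}

namespace IsImage

variable (hE : C.IsImage E)

/-- The projection `P` as a map onto its image. -/
def proj : H →ₗ[ℝ] H.sub E hE.graded := LinearMap.codRestrict E C.P hE.mem

theorem coe_proj (x : H) : ((hE.proj x : E) : H) = C.P x := rfl

theorem proj_coe (x : E) : hE.proj (x : H) = x := Subtype.ext (hE.eq_self x x.2)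

theorem deg_proj (d : ℤ × ZMod 2) (x : H) (hx : x ∈ H.gr d) :
    hE.proj x ∈ (H.sub E hE.graded).gr d := C.deg_P d x hx

/-- The inclusion of the image of `P`. -/
def incl : H.sub E hE.graded →ₗ[ℝ] H := E.subtype

theorem deg_incl (d : ℤ × ZMod 2) (x : H.sub E hE.graded) (hx : x ∈ (H.sub E hE.graded).gr d) :
    hE.incl x ∈ H.gr d := hx

/-- The reduction of a vector field to the image of `P`. -/
def reduce (q : VFun H H) : VFun (H.sub E hE.graded) (H.sub E hE.graded) :=
  postcomp hE.proj (precomp hE.incl hE.deg_incl q)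

theorem coeff_reduce (q : VFun H H) (n : ℕ) (x : Fin n → H.sub E hE.graded) :
    coeff n (hE.reduce q) x = hE.proj (coeff n q (fun i => hE.incl (x i))) := rfl

theorem P_incl (x : H.sub E hE.graded) : C.P (hE.incl x) = hE.incl x := hE.eq_self _ x.2

theorem incl_proj (x : H) : hE.incl (hE.proj x) = C.P x := rfl

theorem incl_coeff_reduce {q : VFun H H} (hq : ∀ n, C.Good n q) {n : ℕ}
    (x : Fin n → H.sub E hE.graded) :
    hE.incl (coeff n (hE.reduce q) x) = coeff n q (fun i => hE.incl (x i)) := by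
  rw [coeff_reduce, incl_proj]
  have h1 : (fun i => hE.incl (x i)) = fun i => C.P (hE.incl (x i)) :=
    funext fun i => (hE.P_incl (x i)).symm
  rw [C.coeff_normal hq (fun i => hE.incl (x i)), ← h1]
  conv_rhs => rw [h1]
  conv_lhs => rw [h1]
  rw [C.D_linF_P, zero_add, C.PP]

theorem proj_coeff {q : VFun H H} (hq : ∀ n, C.Good n q) {n : ℕ} (x : Fin n → H) :
    hE.proj (coeff n q x) = coeff n (hE.reduce q) (fun i => hE.proj (x i)) := by
  refine Subtype.ext ?_
  rw [coe_proj, C.P_coeff_normal hq]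
  rfl

/-- The `L_∞`-structure on the image of `P` given by a vector field in normal form. -/
def reducedLInfty {q : VFun H H} (hq : ∀ n, C.Good n q) : LInfty (H.sub E hE.graded) :=
  LInfty.ofVF (hE.reduce q)
    (MultilinearMap.ext fun x => by rw [coeff_reduce, (hq 0).zero]; simp)
    (fun n d x hx => hE.deg_proj _ _ ((hq 0).deg n d _ hx))
    (by
      have hinj : ∀ f : VFun (H.sub E hE.graded) (H.sub E hE.graded),
          postcomp hE.incl f = 0 → f = 0 := fun f hf => vfun_ext fun n =>
        MultilinearMap.ext fun x => Subtype.ext (congrArg (fun g => coeff n g x) hf)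
      -- The inclusion is injective and relates the reduced field to `q`, so the square of the
      -- reduced field vanishes with that of `q`.
      have h1 : precomp hE.incl hE.deg_incl q = postcomp hE.incl (hE.reduce q) :=
        vfun_ext fun n => MultilinearMap.ext fun x => (hE.incl_coeff_reduce hq x).symm
      refine hinj _ ?_
      rw [postcomp_ins, ← h1, ← precomp_ins h1, (hq 0).sq, map_zero])

theorem reducedLInfty_l {q : VFun H H} (hq : ∀ n, C.Good n q) (n : ℕ) :
    (hE.reducedLInfty hq).l n = coeff n (hE.reduce q) := rfl

theorem reducedLInfty_l_one {q : VFun H H} (hq : ∀ n, C.Good n q) :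
    (hE.reducedLInfty hq).l 1 = 0 := by
  ext x : 1
  rw [reducedLInfty_l, coeff_reduce, (hq 0).one]
  refine Subtype.ext ?_
  rw [coe_proj, coeff_linF_one, C.PD]
  rfl

end IsImage

variable (C)

/-- The `L_∞`-structure of a vector field in normal form. -/
def normalLInfty {q : VFun H H} (hq : ∀ n, C.Good n q) : LInfty H :=
  LInfty.ofVF q (hq 0).zero (hq 0).deg (hq 0).sq

theorem normalLInfty_vf {q : VFun H H} (hq : ∀ n, C.Good n q) : (C.normalLInfty hq).vf = q := rfl

variable {C}

namespace IsImage

variable (hE : C.IsImage E)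

theorem isQMap_incl {q : VFun H H} (hq : ∀ n, C.Good n q) :
    LInfty.IsQMap (hE.reducedLInfty hq) (C.normalLInfty hq) (linearMap hE.incl hE.deg_incl) :=
  isQMap_linearMap fun _ x => hE.incl_coeff_reduce hq x

theorem isQMap_proj {q : VFun H H} (hq : ∀ n, C.Good n q) :
    LInfty.IsQMap (C.normalLInfty hq) (hE.reducedLInfty hq) (linearMap hE.proj hE.deg_proj) :=
  isQMap_linearMap fun _ x => hE.proj_coeff hq x

variable (hV : H.IsGraded (LinearMap.range C.D))

/-- The splitting of `H` into the image of `P` and a contractible complex. -/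
def toSplit : H →ₗ[ℝ] (H.sub E hE.graded).prod
    ((H.sub (LinearMap.range C.D) hV).prod (H.sub (LinearMap.range C.D) hV).shift) :=
  hE.proj.prod ((C.D.rangeRestrict.comp C.h).prod C.D.rangeRestrict)

theorem deg_toSplit (d : ℤ × ZMod 2) (x : H) (hx : x ∈ H.gr d) :
    hE.toSplit hV x ∈ ((H.sub E hE.graded).prod ((H.sub (LinearMap.range C.D) hV).prod
      (H.sub (LinearMap.range C.D) hV).shift)).gr d := by
  refine ⟨hE.deg_proj d x hx, ?_, C.deg_D d x hx⟩
  have h1 := C.deg_D _ _ (C.deg_h d x hx)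
  rwa [add_assoc, show ((-1, -1) + (1, 1) : ℤ × ZMod 2) = 0 from rfl, add_zero] at h1

/-- The inverse of `toSplit`. -/
def ofSplit : (H.sub E hE.graded).prod
    ((H.sub (LinearMap.range C.D) hV).prod (H.sub (LinearMap.range C.D) hV).shift) →ₗ[ℝ] H :=
  hE.incl.coprod ((LinearMap.range C.D).subtype.coprod
    (C.h.comp (LinearMap.range C.D).subtype))

theorem ofSplit_apply (y : (H.sub E hE.graded).prod
    ((H.sub (LinearMap.range C.D) hV).prod (H.sub (LinearMap.range C.D) hV).shift)) :
    hE.ofSplit hV y = (y.1 : H) + ((y.2.1 : H) + C.h (y.2.2 : H)) := rfl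

theorem deg_ofSplit (d : ℤ × ZMod 2) (y) (hy : y ∈ ((H.sub E hE.graded).prod
    ((H.sub (LinearMap.range C.D) hV).prod (H.sub (LinearMap.range C.D) hV).shift)).gr d) :
    hE.ofSplit hV y ∈ H.gr d := by
  have h1 := C.deg_h _ _ hy.2.2
  rw [add_assoc, show ((1, 1) + (-1, -1) : ℤ × ZMod 2) = 0 from rfl, add_zero] at h1
  exact Submodule.add_mem _ hy.1 (Submodule.add_mem _ hy.2.1 h1)

theorem ofSplit_toSplit (x : H) : hE.ofSplit hV (hE.toSplit hV x) = x := by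
  rw [ofSplit_apply]
  change C.P x + (C.D (C.h x) + C.h (C.D x)) = x
  rw [C.homotopy, add_sub_cancel]

theorem toSplit_ofSplit (y) : hE.toSplit hV (hE.ofSplit hV y) = y := by
  obtain ⟨⟨e, he⟩, ⟨_, v, rfl⟩, ⟨_, w, rfl⟩⟩ := y
  rw [ofSplit_apply]
  have hPe : C.P e = e := hE.eq_self e he
  have hhe : C.h e = 0 := by rw [← hPe, C.hP]
  have hDe : C.D e = 0 := by rw [← hPe, C.DP]
  refine Prod.ext (Subtype.ext ?_) (Prod.ext (Subtype.ext ?_) (Subtype.ext ?_))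
  · change C.P (e + (C.D v + C.h (C.D w))) = e
    rw [map_add, map_add, C.PD, C.P_h, hPe, add_zero, add_zero]
  · change C.D (C.h (e + (C.D v + C.h (C.D w)))) = C.D v
    rw [map_add, map_add C.h (C.D v), C.hh, hhe, zero_add, add_zero, C.D_h_D]
  · change C.D (e + (C.D v + C.h (C.D w))) = C.D w
    rw [map_add, map_add, C.DD, hDe, C.D_h_D, zero_add, zero_add]

/-- The nonlinear values lie in the image of P, where both D h and D vanish, so the fibre
coordinates feel D alone. Since D h D = D and D D = 0, they change by (D h x, D x) ↦ (D x, 0), which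
is the differential of the shifted tangent space. -/
theorem toSplit_coeff {q : VFun H H} (hq : ∀ n, C.Good n q) (n : ℕ) (x : Fin n → H) :
    hE.toSplit hV (coeff n q x) = ((hE.reducedLInfty hq).prod
      (LInfty.shiftedTangent (H.sub (LinearMap.range C.D) hV))).l n
        (fun i => hE.toSplit hV (x i)) := by
  refine Prod.ext (hE.proj_coeff hq x) ?_
  have h1 : (C.D.rangeRestrict.comp C.h) (coeff n q x)
      = (C.D.rangeRestrict.comp C.h) (coeff n (linF C.D) x) :=
    C.apply_coeff_normal (fun x => by rw [LinearMap.comp_apply, C.hP, map_zero]) hq x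
  have h2 : C.D.rangeRestrict (coeff n q x) = C.D.rangeRestrict (coeff n (linF C.D) x) :=
    C.apply_coeff_normal (fun x => Subtype.ext (C.DP x)) hq x
  refine (Prod.ext h1 h2 : (_ : LinearMap.range C.D × LinearMap.range C.D) = (_, _)).trans ?_
  rcases n with _ | _ | n
  · rw [coeff_linF_of_ne _ (by omega)]
    exact Prod.ext (map_zero _) (map_zero _)
  · refine Prod.ext (Subtype.ext ?_) (Subtype.ext ?_)
    · exact C.D_h_D (x 0)
    · exact C.DD (x 0)
  · rw [coeff_linF_of_ne _ (by omega)]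
    exact Prod.ext (map_zero _) (map_zero _)

theorem isQMap_toSplit {q : VFun H H} (hq : ∀ n, C.Good n q) :
    LInfty.IsQMap (C.normalLInfty hq) ((hE.reducedLInfty hq).prod
      (LInfty.shiftedTangent (H.sub (LinearMap.range C.D) hV)))
      (linearMap (hE.toSplit hV) (hE.deg_toSplit hV)) :=
  isQMap_linearMap fun n x => hE.toSplit_coeff hV hq n x

theorem isQMap_ofSplit {q : VFun H H} (hq : ∀ n, C.Good n q) :
    LInfty.IsQMap ((hE.reducedLInfty hq).prod
      (LInfty.shiftedTangent (H.sub (LinearMap.range C.D) hV))) (C.normalLInfty hq)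
      (linearMap (hE.ofSplit hV) (hE.deg_ofSplit hV)) := by
  refine isQMap_linearMap fun n y => ?_
  have hy : y = fun i => hE.toSplit hV (hE.ofSplit hV (y i)) :=
    funext fun i => (hE.toSplit_ofSplit hV (y i)).symm
  have h1 := hE.toSplit_coeff hV hq n (fun i => hE.ofSplit hV (y i))
  exact (congrArg (hE.ofSplit hV) ((congrArg _ hy).trans h1.symm)).trans
    (hE.ofSplit_toSplit hV _)

end IsImage

end Contraction

end QMan

namespace QMan

variable {H : GrSpace.{u}} {M : Type*} [AddCommGroup M] [Module ℝ M]

/-! ### Ideals of functions that vanish on a linear submanifold -/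

theorem linF_add (φ ψ : H →ₗ[ℝ] M) : linF (φ + ψ) = linF φ + linF ψ := by
  refine vfun_ext fun n => ?_
  ext x
  rw [map_add, add_apply]
  by_cases hn : n = 1
  · subst hn
    rfl
  · rw [coeff_linF_of_ne _ hn, coeff_linF_of_ne _ hn, coeff_linF_of_ne _ hn]
    simp

theorem linF_zero : linF (0 : H →ₗ[ℝ] M) = 0 := by
  simpa using linF_add (0 : H →ₗ[ℝ] M) 0

/-- The linear field φ ⊗ y acts as φ times the derivative along y. Its values therefore lie in every
ideal that contains φ. -/
theorem ins_linF_smulRight (φ : H →ₗ[ℝ] ℝ) (y : H) (f : VFun H M) :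
    ins (linF (φ.smulRight y)) f = smulStar (linF φ) (dd f y) := by
  have h : linF (φ.smulRight y) = postcomp (LinearMap.toSpanSingleton ℝ H y) (linF φ) := by
    refine vfun_ext fun n => ?_
    ext x
    rw [coeff_postcomp]
    by_cases hn : n = 1
    · subst hn
      rfl
    · rw [coeff_linF_of_ne _ hn, coeff_linF_of_ne _ hn]
      simp
  rw [h, ins_apply, star_postcomp, smulStar]
  congr 1
  ext
  simp

theorem ins_linF_sum_smulRight {J : Type*} (S : Finset J) (φ : J → H →ₗ[ℝ] ℝ) (y : J → H)
    (f : VFun H M) : ins (linF (∑ j ∈ S, (φ j).smulRight (y j))) f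
      = ∑ j ∈ S, smulStar (linF (φ j)) (dd f (y j)) := by
  classical
  induction S using Finset.induction_on with
  | empty => rw [Finset.sum_empty, Finset.sum_empty, linF_zero, ins_zero]
  | insert j S hj ih =>
    rw [Finset.sum_insert hj, Finset.sum_insert hj, linF_add, ins_add, ih, ins_linF_smulRight]

theorem coord_degProj {J : Type*} (b : Module.Basis J ℝ H) {deg : J → ℤ × ZMod 2}
    (hb : ∀ j, b j ∈ H.gr (deg j)) (j : J) (d : ℤ × ZMod 2) (hd : deg j ≠ d) :
    (b.coord j).comp (degProj H d) = 0 := by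
  refine b.ext fun k => ?_
  rw [LinearMap.comp_apply, degProj_of_mem (hb k), LinearMap.zero_apply]
  split_ifs with h
  · have hkj : k ≠ j := fun e => hd (e ▸ h)
    rw [Module.Basis.coord_apply, Module.Basis.repr_self, Finsupp.single_eq_of_ne' hkj]
  · rw [map_zero]

theorem coord_smul_mem {J : Type*} (b : Module.Basis J ℝ H) {deg : J → ℤ × ZMod 2}
    (hb : ∀ j, b j ∈ H.gr (deg j)) (j : J) {d : ℤ × ZMod 2} {x : H} (hx : x ∈ H.gr d) :
    b.coord j x • b j ∈ H.gr d := by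
  by_cases hd : deg j = d
  · exact Submodule.smul_mem _ _ (hd ▸ hb j)
  · have h := LinearMap.congr_fun (coord_degProj b hb j d hd) x
    rw [LinearMap.comp_apply, degProj_self hx, LinearMap.zero_apply] at h
    rw [h, zero_smul]
    exact Submodule.zero_mem _

namespace Contraction

variable (C : Contraction H)

/-- The inverse of the derivation `ins (linF C.N)` on functions that vanish on the image
of `P`. -/
noncomputable def numPrim (g : VFun H M) : VFun H M :=
  ⟨fun n => coeff n (∑ k ∈ Finset.range n, ((k : ℝ) + 1)⁻¹ • C.red g k), fun n => coeff_symm n _⟩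

theorem ins_N_sum_red (g : VFun H M) (n : ℕ) :
    ins (linF C.N) (∑ k ∈ Finset.range n, ((k : ℝ) + 1)⁻¹ • C.red g k) = g - C.red g n := by
  induction n with
  | zero => rw [Finset.sum_range_zero, map_zero, red, sub_self]
  | succ n ih =>
    rw [Finset.sum_range_succ, map_add, ih, map_smul, red_succ]
    abel

/-- The image of the partial sum telescopes to the difference of `g` and its n-th reduction. At
order `n` this reduction is the restriction of `g` to the image of P, which vanishes by assumption.
-/
theorem ins_N_numPrim {g : VFun H M} (hg : ∀ n (x : Fin n → H), coeff n g (fun i => C.P (x i)) = 0) :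
    ins (linF C.N) (C.numPrim g) = g := by
  refine vfun_ext fun n => ?_
  have h1 := coeff_ins_linF_of_coeff_eq_zero C.N (n := n)
    (f := C.numPrim g - ∑ k ∈ Finset.range n, ((k : ℝ) + 1)⁻¹ • C.red g k)
    (by rw [map_sub]; exact sub_self _)
  rw [map_sub, map_sub, sub_eq_zero] at h1
  rw [h1, C.ins_N_sum_red, map_sub]
  ext x
  rw [sub_apply, C.coeff_red, hg, sub_zero]

/-- The restriction of `N` to finitely many coordinates. -/
noncomputable def truncN {J : Type*} (b : Module.Basis J ℝ H) (S : Finset J) : H →ₗ[ℝ] H :=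
  ∑ j ∈ S, ((b.coord j).comp C.N).smulRight (b j)

theorem truncN_apply {J : Type*} (b : Module.Basis J ℝ H) (S : Finset J) (x : H) :
    C.truncN b S x = ∑ j ∈ S, b.coord j (C.N x) • b j := by
  simp [truncN]

theorem deg_truncN {J : Type*} (b : Module.Basis J ℝ H) {deg : J → ℤ × ZMod 2}
    (hb : ∀ j, b j ∈ H.gr (deg j)) (S : Finset J) (d : ℤ × ZMod 2) (x : H) (hx : x ∈ H.gr d) :
    C.truncN b S x ∈ H.gr d := by
  rw [truncN_apply]
  exact Submodule.sum_mem _ fun j _ => coord_smul_mem b hb j (C.deg_N d x hx)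

theorem truncN_eq {J : Type*} (b : Module.Basis J ℝ H) {S : Finset J} {x : H}
    (hS : (b.repr (C.N x)).support ⊆ S) : C.truncN b S x = C.N x := by
  rw [truncN_apply]
  conv_rhs => rw [← b.linearCombination_repr (C.N x), Finsupp.linearCombination_apply]
  rw [Finsupp.sum_of_support_subset _ hS (fun i a => a • b i) fun _ _ => zero_smul _ _]
  rfl

variable {J : Submodule ℝ (VFun H ℝ)}

/-- The truncation is a finite sum of fields φ ⊗ y whose functionals φ are coordinates composed with
N, and N vanishes on the image of P. -/
theorem ins_truncN_mem (hJ : ∀ f, ∀ g ∈ J, smulStar g f ∈ J)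
    (hlin : ∀ φ : H →ₗ[ℝ] ℝ, (∀ x, φ (C.P x) = 0) → linF φ ∈ J) {I : Type*}
    (b : Module.Basis I ℝ H) (S : Finset I) (f : VFun H ℝ) :
    ins (linF (C.truncN b S)) f ∈ J := by
  rw [truncN, ins_linF_sum_smulRight]
  refine Submodule.sum_mem _ fun j _ => hJ _ _ (hlin _ fun x => ?_)
  rw [LinearMap.comp_apply, N_apply, C.PP, sub_self, map_zero]

/-- In finite dimension, an ideal that contains the linear functions vanishing on the image of `P`
contains all functions vanishing there. -/
theorem mem_ideal_of_finite [FiniteDimensional ℝ H] (hJ : ∀ f, ∀ g ∈ J, smulStar g f ∈ J)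
    (hlin : ∀ φ : H →ₗ[ℝ] ℝ, (∀ x, φ (C.P x) = 0) → linF φ ∈ J) {g : VFun H ℝ}
    (hg : ∀ n (x : Fin n → H), coeff n g (fun i => C.P (x i)) = 0) : g ∈ J := by
  have := Fintype.ofFinite (Module.Basis.ofVectorSpaceIndex ℝ H)
  have h1 := C.ins_truncN_mem hJ hlin (Module.Basis.ofVectorSpace ℝ H) Finset.univ (C.numPrim g)
  have h2 : C.truncN (Module.Basis.ofVectorSpace ℝ H) Finset.univ = C.N :=
    LinearMap.ext fun x => C.truncN_eq _ (Finset.subset_univ _)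
  rwa [h2, C.ins_N_numPrim hg] at h1

/-- A closed ideal that contains the linear functions vanishing on the image of `P` contains all
functions vanishing there. -/
theorem mem_ideal_of_isClosed (hc : IsClosed (J : Set (VFun H ℝ)))
    (hJ : ∀ f, ∀ g ∈ J, smulStar g f ∈ J)
    (hlin : ∀ φ : H →ₗ[ℝ] ℝ, (∀ x, φ (C.P x) = 0) → linF φ ∈ J) {g : VFun H ℝ}
    (hg : ∀ n (x : Fin n → H), coeff n g (fun i => C.P (x i)) = 0) : g ∈ J := by
  classical
  obtain ⟨I, b, deg, hb⟩ := H.exists_homogeneous_basis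
  have hlim : Filter.Tendsto (fun S : Finset I => ins (linF (C.truncN b S)) (C.numPrim g))
      Filter.atTop (nhds g) := by
    rw [nhds_induced, Filter.tendsto_comap_iff, tendsto_pi_nhds]
    rintro ⟨n, x⟩
    -- For fixed arguments the vectors N x_i involve finitely many basis vectors. Once `S` contains
    -- these, truncation changes nothing, so each evaluated coefficient is eventually constant.
    refine tendsto_const_nhds.congr' ?_
    filter_upwards [Filter.eventually_ge_atTop
      (Finset.univ.biUnion fun i => (b.repr (C.N (x i))).support)] with S hS
    change coeff n g x = coeff n (ins (linF (C.truncN b S)) (C.numPrim g)) x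
    conv_lhs => rw [← C.ins_N_numPrim hg]
    refine coeff_ins_linF_congr C.deg_N (C.deg_truncN b hb S) (fun i => ?_) _
    rw [C.truncN_eq b]
    exact (Finset.subset_biUnion_of_mem (fun i => (b.repr (C.N (x i))).support)
      (Finset.mem_univ i)).trans hS
  exact hc.mem_of_tendsto hlim
    (Filter.Eventually.of_forall fun S => C.ins_truncN_mem hJ hlin b S _)

end Contraction

end QMan

namespace QMan

variable {H K : GrSpace.{u}}

/-! ### The reduction -/

instance : T2Space (FormalFun H) := by
  have h : Topology.IsEmbedding
      (fun (f : FormalFun H) (a : Σ n : ℕ, (Fin n → H)) => f.1 a.1 a.2) :=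
    ⟨⟨rfl⟩, fun f g hfg => Subtype.ext (funext fun n => MultilinearMap.ext fun x =>
      congrFun hfg ⟨n, x⟩)⟩
  exact h.t2Space

theorem LInfty.Q_zero (L : LInfty H) : L.Q 0 = 0 := by
  rw [← (toV H).injective.eq_iff, L.toV_Q, map_zero, map_zero]

theorem FormalMap.isClosed_ker (φ : FormalMap H K) :
    IsClosed (LinearMap.ker φ.pullback : Set (FormalFun K)) :=
  isClosed_singleton.preimage φ.continuous

theorem FormalFun.zero_mul (f : FormalFun H) : 0 * f = 0 := by
  rw [← (toV H).injective.eq_iff, toV_mul, map_zero, smulStar, star_zero_left]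

theorem FormalFun.mul_zero (f : FormalFun H) : f * 0 = 0 := by
  rw [← (toV H).injective.eq_iff, toV_mul, map_zero, smulStar]
  have h : LinearMap.toSpanSingleton ℝ _ (0 : VFun H ℝ) = 0 := by ext; simp
  rw [h, star_zero_right]

theorem FormalMap.isIdeal_ker (φ : FormalMap H K) :
    FormalFun.IsIdeal (LinearMap.ker φ.pullback) := by
  intro f g hg
  rw [LinearMap.mem_ker] at hg
  constructor
  · rw [LinearMap.mem_ker, φ.map_mul, hg, FormalFun.mul_zero]
  · rw [LinearMap.mem_ker, φ.map_mul, hg, FormalFun.zero_mul]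

theorem exists_of_mem_linearVanishing {E F : Submodule ℝ H} {w : FormalFun H}
    (hw : w ∈ linearVanishing H E F) :
    ∃ φ : H →ₗ[ℝ] ℝ, toV H w = linF φ ∧ ∀ x ∈ E ⊔ F, φ x = 0 := by
  refine ⟨(MultilinearMap.ofSubsingleton ℝ (H : Type u) ℝ (0 : Fin 1)).symm (w.1 1), ?_, hw.2⟩
  refine vfun_ext fun n => ?_
  by_cases hn : n = 1
  · subst hn
    exact ((MultilinearMap.ofSubsingleton ℝ (H : Type u) ℝ (0 : Fin 1)).apply_symm_apply _).symm
  · rw [coeff_linF_of_ne _ hn]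
    exact hw.1 n hn

theorem linF_mem_linearVanishing {E F : Submodule ℝ H} {φ : H →ₗ[ℝ] ℝ}
    (hφ : ∀ x ∈ E ⊔ F, φ x = 0) : (toV H).symm (linF φ) ∈ linearVanishing H E F :=
  ⟨fun _ hn => coeff_linF_of_ne φ hn, hφ⟩

/-- Data that bring an `L_∞`-structure with a splitting into normal form. -/
structure NormalForm (L : LInfty H) (E F : Submodule ℝ H) where
  C : Contraction H
  isImage : C.IsImage E
  D_eq : C.D = L.D
  h_eq_zero : ∀ x, C.h x = 0 ↔ x ∈ E ⊔ F
  q : VFun H H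
  good : ∀ n, C.Good n q
  T : VFun H ℝ →ₗ[ℝ] VFun H ℝ
  T' : VFun H ℝ →ₗ[ℝ] VFun H ℝ
  autT : C.IsAuto T
  autT' : C.IsAuto T'
  T_T' : ∀ f, T (T' f) = f
  T'_T : ∀ f, T' (T f) = f
  T_ins : ∀ f, T (ins L.vf f) = ins q (T f)

theorem LInfty.IsSplitting.nonempty_normalForm {L : LInfty H} {E F : Submodule ℝ H}
    (h : L.IsSplitting E F) : Nonempty (NormalForm L E F) := by
  obtain ⟨C, hD, hP, hPE, hh⟩ := h.exists_contraction
  have hg : C.Good 1 L.vf :=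
    { deg := L.isDeg_vf
      zero := L.l_zero
      one := by
        ext x
        rw [coeff_linF_one, hD, L.D_apply, L.coeff_vf]
        congr 1
        funext i
        rw [Subsingleton.elim i 0]
      sq := L.ins_vf_vf
      -- The condition is vacuous at the start, as no order lies between 2 and 1.
      normal := fun m h1 h2 => by omega }
  obtain ⟨q, T, T', hq, hT, hT', h1, h2, h3⟩ := Contraction.exists_normalForm hg
  exact ⟨⟨C, ⟨h.gradedE, hP, hPE⟩, hD, hh, q, hq, T, T', hT, hT', h1, h2, h3⟩⟩

namespace NormalForm

variable {L : LInfty H} {E F : Submodule ℝ H} (R : NormalForm L E F)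

theorem T'_ins (f : VFun H ℝ) : R.T' (ins R.q f) = ins L.vf (R.T' f) := by
  rw [← R.T'_T (ins L.vf (R.T' f)), R.T_ins, R.T_T']

/-- As `T` is a pullback, the formal map goes against the direction of normalization: from the
normal form to the original structure. -/
theorem isQMap_T : LInfty.IsQMap (R.C.normalLInfty R.good) L R.autT.toFormalMap := by
  intro f
  rw [← (toV H).injective.eq_iff, R.autT.toV_pullback, L.toV_Q, LInfty.toV_Q,
    R.autT.toV_pullback, R.T_ins, R.C.normalLInfty_vf]

theorem isQMap_T' : LInfty.IsQMap L (R.C.normalLInfty R.good) R.autT'.toFormalMap := by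
  intro f
  rw [← (toV H).injective.eq_iff, R.autT'.toV_pullback, L.toV_Q, LInfty.toV_Q,
    R.autT'.toV_pullback, R.C.normalLInfty_vf, R.T'_ins]

theorem isGraded_range : H.IsGraded (LinearMap.range R.C.D) := by
  rw [R.D_eq]
  exact L.isGraded_range

/-- The reduced `L_∞`-structure on `E`. -/
def reduced : LInfty (H.sub E R.isImage.graded) := R.isImage.reducedLInfty R.good

/-- The section of the reduction. -/
def inclusion : FormalMap (H.sub E R.isImage.graded) H :=
  R.autT.toFormalMap.comp (linearMap R.isImage.incl R.isImage.deg_incl)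

theorem toV_section (f : FormalFun H) : toV _ (R.inclusion.pullback f)
    = precomp R.isImage.incl R.isImage.deg_incl (R.T (toV H f)) := rfl

/-- The projection of the reduction. -/
def projection : FormalMap H (H.sub E R.isImage.graded) :=
  (linearMap R.isImage.proj R.isImage.deg_proj).comp R.autT'.toFormalMap

theorem toV_projection (f : FormalFun (H.sub E R.isImage.graded)) :
    toV H (R.projection.pullback f)
      = R.T' (precomp R.isImage.proj R.isImage.deg_proj (toV _ f)) := rfl

theorem isQMap_section : LInfty.IsQMap R.reduced L R.inclusion :=
  isQMap_comp R.isQMap_T (R.isImage.isQMap_incl R.good)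

theorem section_projection (f : FormalFun (H.sub E R.isImage.graded)) :
    R.inclusion.pullback (R.projection.pullback f) = f := by
  rw [← (toV _).injective.eq_iff, toV_section, toV_projection, R.T_T']
  refine vfun_ext fun n => MultilinearMap.ext fun x => ?_
  rw [coeff_precomp, coeff_precomp]
  exact congrArg _ (funext fun i => R.isImage.proj_coe (x i))

theorem isEquivalentReduction : R.reduced.IsEquivalentReduction L R.inclusion := by
  refine ⟨R.isQMap_section, R.projection,
    isQMap_comp (R.isImage.isQMap_proj R.good) R.isQMap_T', R.section_projection,
    H.sub (LinearMap.range R.C.D) R.isGraded_range,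
    (linearMap (R.isImage.toSplit R.isGraded_range)
      (R.isImage.deg_toSplit R.isGraded_range)).comp R.autT'.toFormalMap,
    R.autT.toFormalMap.comp (linearMap (R.isImage.ofSplit R.isGraded_range)
      (R.isImage.deg_ofSplit R.isGraded_range)),
    isQMap_comp (R.isImage.isQMap_toSplit R.isGraded_range R.good) R.isQMap_T',
    isQMap_comp R.isQMap_T (R.isImage.isQMap_ofSplit R.isGraded_range R.good), ?_, ?_, ?_⟩
  · intro f
    rw [← (toV _).injective.eq_iff, FormalMap.comp_pullback, FormalMap.comp_pullback,
      toV_linearMap_pullback, R.autT.toV_pullback, R.autT'.toV_pullback, R.T_T',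
      toV_linearMap_pullback]
    refine vfun_ext fun n => MultilinearMap.ext fun x => ?_
    rw [coeff_precomp, coeff_precomp]
    exact congrArg _ (funext fun i => R.isImage.toSplit_ofSplit R.isGraded_range (x i))
  · intro f
    rw [← (toV _).injective.eq_iff, FormalMap.comp_pullback, FormalMap.comp_pullback,
      R.autT'.toV_pullback, toV_linearMap_pullback, toV_linearMap_pullback,
      R.autT.toV_pullback]
    have h : precomp (R.isImage.toSplit R.isGraded_range) (R.isImage.deg_toSplit R.isGraded_range)
        (precomp (R.isImage.ofSplit R.isGraded_range) (R.isImage.deg_ofSplit R.isGraded_range)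
          (R.T (toV H f))) = R.T (toV H f) := by
      refine vfun_ext fun n => MultilinearMap.ext fun x => ?_
      rw [coeff_precomp, coeff_precomp]
      exact congrArg _ (funext fun i => R.isImage.ofSplit_toSplit R.isGraded_range (x i))
    rw [h, R.T'_T]
  · intro f
    rfl

theorem hasLinearPart : R.inclusion.HasLinearPart E.subtype := by
  intro f x
  have h := R.autT.low 1 (by omega) (toV H f)
  exact congrArg (fun t => t fun _ => (x : H)) h

theorem reduced_l_one : R.reduced.l 1 = 0 := R.isImage.reducedLInfty_l_one R.good

theorem reduced_D (x : H.sub E R.isImage.graded) : R.reduced.D x = 0 := by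
  rw [LInfty.D_apply, reduced_l_one]
  rfl

theorem isQuasiIso (h : L.IsSplitting E F) : R.reduced.IsQuasiIso L E.subtype where
  comm x := by
    rw [R.reduced_D, map_zero]
    exact (h.mem_ker x.2).symm
  injective x _ hx := by
    have hx0 : (x : H) = 0 := Submodule.disjoint_def.1 h.disjoint _ x.2 hx
    exact ⟨0, by rw [map_zero]; exact Subtype.ext hx0.symm⟩
  surjective y hy := by
    obtain ⟨e, he, z, hz, rfl⟩ := Submodule.mem_sup.1
      (h.sup_eq.symm ▸ hy : y ∈ E ⊔ LinearMap.range L.D)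
    refine ⟨⟨e, he⟩, R.reduced_D _, ?_⟩
    change e + z - e ∈ _
    rwa [add_sub_cancel_left]

theorem isMinimalModel (h : L.IsSplitting E F) : R.reduced.IsMinimalModel L :=
  ⟨R.reduced_l_one, R.inclusion, E.subtype, R.isQMap_section, R.hasLinearPart, R.isQuasiIso h⟩

theorem surjective_section : Function.Surjective R.inclusion.pullback :=
  fun f => ⟨R.projection.pullback f, R.section_projection f⟩

/-- Functions in W vanish on E and are fixed by T, so the section pulls them back to zero. For QW
the claim follows because the section is a Q-map. -/
theorem union_subset_ker : linearVanishing H E F ∪ L.Q '' linearVanishing H E F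
    ⊆ (LinearMap.ker R.inclusion.pullback : Set (FormalFun H)) := by
  have h1 : ∀ w ∈ linearVanishing H E F, R.inclusion.pullback w = 0 := by
    intro w hw
    obtain ⟨φ, hφ, hφ0⟩ := exists_of_mem_linearVanishing hw
    rw [← (toV _).injective.eq_iff, toV_section, hφ,
      R.autT.fix φ fun x hx => hφ0 x ((R.h_eq_zero x).1 hx), map_zero]
    refine vfun_ext fun n => MultilinearMap.ext fun x => ?_
    rw [coeff_precomp, map_zero, zero_apply]
    by_cases hn : n = 1
    · subst hn
      rw [coeff_linF_one]
      exact hφ0 _ (Submodule.mem_sup_left (x 0).2)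
    · rw [coeff_linF_of_ne _ hn, zero_apply]
  rintro _ (hw | ⟨w, hw, rfl⟩)
  · exact h1 _ hw
  · rw [SetLike.mem_coe, LinearMap.mem_ker, R.isQMap_section, h1 w hw, LInfty.Q_zero]

theorem coeff_T_of_mem_ker {f : FormalFun H} (hf : f ∈ LinearMap.ker R.inclusion.pullback) (n : ℕ)
    (x : Fin n → H) : coeff n (R.T (toV H f)) (fun i => R.C.P (x i)) = 0 := by
  have h := R.toV_section f
  rw [LinearMap.mem_ker.1 hf, map_zero] at h
  exact (congrArg (fun g => coeff n g fun i => R.isImage.proj (x i)) h).symm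

/-- The preimage of a space of functions under the automorphism `T'`. -/
def comapT' (J : Submodule ℝ (FormalFun H)) : Submodule ℝ (VFun H ℝ) :=
  J.comap ((toV H).symm.toLinearMap.comp R.T')

theorem mem_comapT' {J : Submodule ℝ (FormalFun H)} {g : VFun H ℝ} :
    g ∈ R.comapT' J ↔ (toV H).symm (R.T' g) ∈ J := Iff.rfl

theorem smulStar_mem_comapT' {J : Submodule ℝ (FormalFun H)} (hJ : FormalFun.IsIdeal J)
    (f : VFun H ℝ) (g : VFun H ℝ) (hg : g ∈ R.comapT' J) : smulStar g f ∈ R.comapT' J := by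
  rw [mem_comapT'] at hg ⊢
  have h : (toV H).symm (R.T' (smulStar g f))
      = (toV H).symm (R.T' g) * (toV H).symm (R.T' f) := by
    rw [LinearEquiv.symm_apply_eq, toV_mul, LinearEquiv.apply_symm_apply,
      LinearEquiv.apply_symm_apply, R.autT'.mul]
  rw [h]
  exact (hJ _ _ hg).2

theorem isClosed_comapT' {J : Submodule ℝ (FormalFun H)}
    (hJ : IsClosed (J : Set (FormalFun H))) : IsClosed (R.comapT' J : Set (VFun H ℝ)) :=
  hJ.preimage (continuous_toV_symm.comp R.autT'.cont)

/-- For φ vanishing on the image of P, φ = φ D h + φ h D. Both φ D h and φ h vanish on the kernel of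
h, so they belong to W and are fixed by `T'`. Moreover φ h D is `q` applied to φ h, since φ h kills
the nonlinear values; transported by `T'`, it lies in QW. -/
theorem linF_mem_comapT' {J : Submodule ℝ (FormalFun H)}
    (hJ : linearVanishing H E F ∪ L.Q '' linearVanishing H E F ⊆ J) (φ : H →ₗ[ℝ] ℝ)
    (hφ : ∀ x, φ (R.C.P x) = 0) : linF φ ∈ R.comapT' J := by
  have hfix : ∀ ψ : H →ₗ[ℝ] ℝ, (∀ x, R.C.h x = 0 → ψ x = 0) →
      R.T' (linF ψ) = linF ψ ∧ (toV H).symm (linF ψ) ∈ linearVanishing H E F :=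
    fun ψ hψ => ⟨R.autT'.fix ψ hψ,
      linF_mem_linearVanishing fun x hx => hψ x ((R.h_eq_zero x).2 hx)⟩
  obtain ⟨h1, h1'⟩ := hfix (φ.comp (R.C.D.comp R.C.h)) fun x hx => by simp [hx]
  obtain ⟨h2, h2'⟩ := hfix (φ.comp R.C.h) fun x hx => by simp [hx]
  have h3 : linF ((φ.comp R.C.h).comp R.C.D) = ins R.q (linF (φ.comp R.C.h)) := by
    rw [ins_linF]
    refine vfun_ext fun n => MultilinearMap.ext fun x => ?_
    rw [coeff_postcomp, R.C.apply_coeff_normal (fun x => by simp [R.C.hP]) R.good]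
    by_cases hn : n = 1
    · subst hn
      rfl
    · rw [coeff_linF_of_ne _ hn, coeff_linF_of_ne _ hn, zero_apply, zero_apply, map_zero]
  have h4 : φ = φ.comp (R.C.D.comp R.C.h) + (φ.comp R.C.h).comp R.C.D := by
    ext x
    change φ x = φ (R.C.D (R.C.h x)) + φ (R.C.h (R.C.D x))
    rw [← map_add, R.C.homotopy, map_sub, hφ, sub_zero]
  rw [h4, linF_add]
  refine Submodule.add_mem _ ?_ ?_
  · rw [mem_comapT', h1]
    exact hJ (Or.inl h1')
  · rw [mem_comapT', h3, R.T'_ins, h2]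
    have h5 : (toV H).symm (ins L.vf (linF (φ.comp R.C.h)))
        = L.Q ((toV H).symm (linF (φ.comp R.C.h))) := by
      rw [LinearEquiv.symm_apply_eq, L.toV_Q, LinearEquiv.apply_symm_apply]
    rw [h5]
    exact hJ (Or.inr ⟨_, h2', rfl⟩)

theorem mem_of_T_mem_comapT' {J : Submodule ℝ (FormalFun H)} {f : FormalFun H}
    (hf : R.T (toV H f) ∈ R.comapT' J) : f ∈ J := by
  rwa [mem_comapT', R.T'_T, LinearEquiv.symm_apply_apply] at hf

/-- After applying T, the kernel of the section consists of functions vanishing on the image of P.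
Since `T'` is multiplicative and continuous, a closed ideal containing W and QW pulls back to a
closed ideal to which `mem_ideal_of_isClosed` applies. -/
theorem ker_section_eq_closedIdealGen : LinearMap.ker R.inclusion.pullback
    = FormalFun.closedIdealGen (linearVanishing H E F ∪ L.Q '' linearVanishing H E F) := by
  refine le_antisymm (le_sInf ?_)
    (sInf_le ⟨R.inclusion.isIdeal_ker, R.inclusion.isClosed_ker, R.union_subset_ker⟩)
  rintro J ⟨hJ, hc, hS⟩ f hf
  exact R.mem_of_T_mem_comapT' (R.C.mem_ideal_of_isClosed (R.isClosed_comapT' hc)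
    (R.smulStar_mem_comapT' hJ) (R.linF_mem_comapT' hS) (R.coeff_T_of_mem_ker hf))

theorem ker_section_eq_idealGen [FiniteDimensional ℝ H] : LinearMap.ker R.inclusion.pullback
    = FormalFun.idealGen (linearVanishing H E F ∪ L.Q '' linearVanishing H E F) := by
  refine le_antisymm (le_sInf ?_) (sInf_le ⟨R.inclusion.isIdeal_ker, R.union_subset_ker⟩)
  rintro J ⟨hJ, hS⟩ f hf
  exact R.mem_of_T_mem_comapT' (R.C.mem_ideal_of_finite (R.smulStar_mem_comapT' hJ)
    (R.linF_mem_comapT' hS) (R.coeff_T_of_mem_ker hf))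

end NormalForm

end QMan

theorem mainTheorem1 (H : QMan.GrSpace.{u}) (L : QMan.LInfty H) :
    (∃ E F : Submodule ℝ H, L.IsSplitting E F) ∧
    ∀ (E F : Submodule ℝ H) (h : L.IsSplitting E F),
      (∃ e : E ≃ₗ[ℝ] L.Cohomology, ∀ x : E, ∃ hx : (x : H) ∈ LinearMap.ker L.D,
        e x = Submodule.Quotient.mk ⟨(x : H), hx⟩) ∧
      ∃ (L' : QMan.LInfty (H.sub E h.gradedE)) (i : QMan.FormalMap (H.sub E h.gradedE) H),
        L'.IsEquivalentReduction L i ∧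
        L'.IsMinimalModel L ∧
        i.HasLinearPart E.subtype ∧
        L'.IsQuasiIso L E.subtype ∧
        Function.Surjective i.pullback ∧
        LinearMap.ker i.pullback = QMan.FormalFun.closedIdealGen
          (QMan.linearVanishing H E F ∪ L.Q '' QMan.linearVanishing H E F) ∧
        (FiniteDimensional ℝ H → LinearMap.ker i.pullback = QMan.FormalFun.idealGen
          (QMan.linearVanishing H E F ∪ L.Q '' QMan.linearVanishing H E F)) := by
  refine ⟨L.exists_isSplitting, fun E F h => ⟨h.exists_cohomology_equiv, ?_⟩⟩
  obtain ⟨R⟩ := h.nonempty_normalForm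
  exact ⟨R.reduced, R.inclusion, R.isEquivalentReduction, R.isMinimalModel h, R.hasLinearPart,
    R.isQuasiIso h, R.surjective_section, R.ker_section_eq_closedIdealGen,
    fun _ => R.ker_section_eq_idealGen⟩
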